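/- Let $d\in\{2,3\}$ and let $\Omega\subset\mathbb R^d$ be a bounded domain with Lipschitz boundary. Let $\sigma\in L^\infty(\Omega)$ satisfy $\sigma\ge\lambda$ a.e. in $\Omega$ for some constant $\lambda>0$ (for instance, $\sigma$ piecewise constant on a polytopal partition of $\Omega$). Let $U\in W^{1,\infty}(\mathbb R^d;\mathbb R^d)$ (continuous representative) vanish in a neighbourhood of $\partial\Omega$, let $DU$ be its weak Jacobian, and put $$\Phi_t(x)=x+tU(x),\qquad \sigma_t=\sigma\circ\Phi_t^{-1},\qquad \mathcal A=\operatorname{div}(U)\,I-(DU+DU^T),$$ where $\Phi_t$ is bijective for small $|t|$. Let $g\in H_0^{-1/2}(\partial\Omega)$, i.e. a bounded linear functional on the space $H^{1/2}(\partial\Omega)$ of traces of $H^1(\Omega)$ functions with $\langle g,1\rangle=0$, and let $f\in H^{1/2}(\partial\Omega)$. Let $u\in H^1(\Omega)$ be the solution of $$\int_\Omega\sigma\nabla u\cdot\nabla w\,dx=\langle g,w|_{\partial\Omega}\rangle\quad\forall w\in H^1(\Omega),\qquad \int_{\partial\Omega}u\,ds=\int_{\partial\Omega}f\,ds,$$ which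 is the weak form of $-\nabla\cdot(\sigma\nabla u)=0$ in $\Omega$, $\sigma\,\partial u/\partial\nu=g$ on $\partial\Omega$; and for small $t\ne0$ let $u_t\in H^1(\Omega)$ be the solution of the same problem with $\sigma_t$ in place of $\sigma$. Then $u$ has a material derivative: there is $\dot u\in H^1(\Omega)$ with $$\int_\Omega\sigma\nabla\dot u\cdot\nabla w\,dx=-\int_\Omega\sigma\mathcal A\nabla u\cdot\nabla w\,dx\quad\forall w\in H^1(\Omega),\qquad \int_{\partial\Omega}\dot u\,ds=0,$$ such that $u_t\circ\Phi_t\in H^1(\Omega)$ for all sufficiently small $t\neq0$ and $$\frac{u_t\circ\Phi_t-u}{t}\longrightarrow\dot u\quad\text{strongly in }H^1(\Omega)\text{ as }t\to0.$$ -/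

import Mathlib

open MeasureTheory Filter Topology Set
open scoped ENNReal NNReal ContDiff RealInnerProductSpace

noncomputable section

namespace EIT

/-- `ℝ^d` with its Euclidean norm. -/
abbrev E (d : ℕ) : Type := EuclideanSpace ℝ (Fin d)

variable {d : ℕ}

/-- `Ω` has a Lipschitz boundary: near each boundary point, `Ω` is the set of points lying strictly
on one side of the graph of a Lipschitz function over a hyperplane with unit normal `ν`
(`y - ⟪ν, y⟫ • ν` is the orthogonal projection of `y` to that hyperplane). -/
def HasLipschitzBoundary (Ω : Set (E d)) : Prop :=
  ∀ x ∈ frontier Ω, ∃ r : ℝ, 0 < r ∧ ∃ ν : E d, ‖ν‖ = 1 ∧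
    ∃ (K : ℝ≥0) (ψ : E d → ℝ), LipschitzWith K ψ ∧
      ∀ y ∈ Metric.ball x r, (y ∈ Ω ↔ ψ (y - ⟪ν, y⟫ • ν) < ⟪ν, y⟫)

/-- A bounded domain (nonempty, open, connected) with Lipschitz boundary. -/
structure IsBoundedLipschitzDomain (Ω : Set (E d)) : Prop where
  isOpen : IsOpen Ω
  isConnected : IsConnected Ω
  isBounded : Bornology.IsBounded Ω
  lipschitz : HasLipschitzBoundary Ω

/-- `f'` satisfies the integration by parts identity of the weak derivative of `f` in `Ω`, tested
with all `φ ∈ C_c^∞(Ω)` in all directions `v`. (It is only used for functions `f`, `f'` that are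
locally integrable in `Ω`.) -/
def HasWeakFDeriv {F : Type*} [NormedAddCommGroup F] [NormedSpace ℝ F]
    (Ω : Set (E d)) (f : E d → F) (f' : E d → E d →L[ℝ] F) : Prop :=
  ∀ φ : E d → ℝ, ContDiff ℝ ∞ φ → HasCompactSupport φ → tsupport φ ⊆ Ω → ∀ v : E d,
    ∫ x in Ω, fderiv ℝ φ x v • f x = - ∫ x in Ω, φ x • f' x v

theorem memLp_test {Ω : Set (E d)} {φ : E d → ℝ} (h : Continuous φ) (hc : HasCompactSupport φ) :
    MemLp φ 2 (volume.restrict Ω) :=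
  (h.memLp_of_hasCompactSupport hc).restrict Ω

theorem memLp_test_fderiv {Ω : Set (E d)} {φ : E d → ℝ} (h : ContDiff ℝ ∞ φ)
    (hc : HasCompactSupport φ) (v : E d) :
    MemLp (fun x => fderiv ℝ φ x v) 2 (volume.restrict Ω) :=
  memLp_test ((h.continuous_fderiv (by simp)).clm_apply continuous_const) (hc.fderiv_apply ℝ v)

/-- The Sobolev space `H^1(Ω)`, as the space of pairs `(u, ∇u) ∈ L²(Ω) × L²(Ω; ℝ^d)` where `∇u` is
the weak gradient of `u`. The inherited norm is
`‖u‖_{H^1} = (‖u‖_{L²}² + ‖∇u‖_{L²}²)^{1/2}`. -/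
def H1 (Ω : Set (E d)) : Submodule ℝ
    (WithLp 2 (Lp ℝ 2 (volume.restrict Ω) × Lp (E d) 2 (volume.restrict Ω))) where
  carrier := {p | HasWeakFDeriv Ω p.fst (fun x => innerSL ℝ (p.snd x))}
  zero_mem' := by
    intro φ _ _ _ v
    have h1 := Lp.coeFn_zero ℝ 2 (volume.restrict Ω)
    have h2 := Lp.coeFn_zero (E d) 2 (volume.restrict Ω)
    rw [integral_eq_zero_of_ae, integral_eq_zero_of_ae, neg_zero]
    · filter_upwards [h2] with x hx
      rw [WithLp.zero_snd, hx, Pi.zero_apply, map_zero, zero_apply, smul_zero, Pi.zero_apply]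
    · filter_upwards [h1] with x hx
      rw [WithLp.zero_fst, hx, Pi.zero_apply, smul_zero]
  add_mem' := by
    intro p q hp hq φ h hc hs v
    have i1 : ∀ p : WithLp 2 (Lp ℝ 2 (volume.restrict Ω) × Lp (E d) 2 (volume.restrict Ω)),
        Integrable (fun x => fderiv ℝ φ x v • p.fst x) (volume.restrict Ω) := fun p =>
      (memLp_test_fderiv h hc v).integrable_mul (Lp.memLp p.fst)
    have i2 : ∀ p : WithLp 2 (Lp ℝ 2 (volume.restrict Ω) × Lp (E d) 2 (volume.restrict Ω)),
        Integrable (fun x => φ x • innerSL ℝ (p.snd x) v) (volume.restrict Ω) := fun p =>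
      (memLp_test h.continuous hc).integrable_mul ((Lp.memLp p.snd).inner_const v)
    have e1 : ∫ x in Ω, fderiv ℝ φ x v • (p + q).fst x
        = ∫ x in Ω, (fderiv ℝ φ x v • p.fst x + fderiv ℝ φ x v • q.fst x) := by
      refine integral_congr_ae ?_
      filter_upwards [Lp.coeFn_add p.fst q.fst] with x hx
      rw [WithLp.add_fst, hx, Pi.add_apply, smul_add]
    have e2 : ∫ x in Ω, φ x • innerSL ℝ ((p + q).snd x) v
        = ∫ x in Ω, (φ x • innerSL ℝ (p.snd x) v + φ x • innerSL ℝ (q.snd x) v) := by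
      refine integral_congr_ae ?_
      filter_upwards [Lp.coeFn_add p.snd q.snd] with x hx
      rw [WithLp.add_snd, hx, Pi.add_apply, map_add, add_apply, smul_add]
    rw [e1, e2, integral_add (i1 p) (i1 q), integral_add (i2 p) (i2 q), hp φ h hc hs v,
      hq φ h hc hs v, neg_add]
  smul_mem' := by
    intro c p hp φ h hc hs v
    have e1 : ∫ x in Ω, fderiv ℝ φ x v • (c • p).fst x
        = ∫ x in Ω, c • (fderiv ℝ φ x v • p.fst x) := by
      refine integral_congr_ae ?_
      filter_upwards [Lp.coeFn_smul c p.fst] with x hx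
      rw [WithLp.smul_fst, hx, Pi.smul_apply, smul_comm]
    have e2 : ∫ x in Ω, φ x • innerSL ℝ ((c • p).snd x) v
        = ∫ x in Ω, c • (φ x • innerSL ℝ (p.snd x) v) := by
      refine integral_congr_ae ?_
      filter_upwards [Lp.coeFn_smul c p.snd] with x hx
      rw [WithLp.smul_snd, hx, Pi.smul_apply, map_smul, smul_apply, smul_comm]
    rw [e1, e2, integral_smul, integral_smul, hp φ h hc hs v, smul_neg]

/-- The underlying `L²` function of an element of `H^1(Ω)`. -/
def fn {Ω : Set (E d)} (u : H1 Ω) : Lp ℝ 2 (volume.restrict Ω) :=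
  (u : WithLp 2 (Lp ℝ 2 (volume.restrict Ω) × Lp (E d) 2 (volume.restrict Ω))).fst

/-- The weak gradient of an element of `H^1(Ω)`. -/
def grad {Ω : Set (E d)} (u : H1 Ω) : Lp (E d) 2 (volume.restrict Ω) :=
  (u : WithLp 2 (Lp ℝ 2 (volume.restrict Ω) × Lp (E d) 2 (volume.restrict Ω))).snd

/-- The surface measure `ds` on `∂Ω`: the `(d-1)`-dimensional Hausdorff measure, in the Euclidean
normalization. -/
def surface (Ω : Set (E d)) : Measure (E d) := (μHE[d - 1]).restrict (frontier Ω)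

/-- The pairs `(φ|_Ω, φ|_{∂Ω})` for smooth `φ` on `ℝ^d`. -/
def smoothTraceGraph (Ω : Set (E d)) : Submodule ℝ (H1 Ω × Lp ℝ 2 (surface Ω)) where
  carrier := {p | ∃ φ : E d → ℝ, ContDiff ℝ ∞ φ ∧ fn p.1 =ᵐ[volume.restrict Ω] φ ∧
    p.2 =ᵐ[surface Ω] φ}
  zero_mem' := ⟨0, contDiff_const, Lp.coeFn_zero .., Lp.coeFn_zero ..⟩
  add_mem' := by
    rintro p q ⟨φ, h, h1, h2⟩ ⟨φ', h', h1', h2'⟩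
    exact ⟨φ + φ', h.add h', (Lp.coeFn_add (fn p.1) (fn q.1)).trans (h1.add h1'),
      (Lp.coeFn_add p.2 q.2).trans (h2.add h2')⟩
  smul_mem' := by
    rintro c p ⟨φ, h, h1, h2⟩
    exact ⟨c • φ, h.const_smul c, (Lp.coeFn_smul c (fn p.1)).trans (h1.const_smul c),
      (Lp.coeFn_smul c p.2).trans (h2.const_smul c)⟩

/-- The graph of the trace operator `H^1(Ω) → L²(∂Ω)`, which is the extension by continuity of the
restriction `φ ↦ φ|_{∂Ω}` of smooth functions: the closure of the graph of the latter. -/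
def traceGraph (Ω : Set (E d)) : Submodule ℝ (H1 Ω × Lp ℝ 2 (surface Ω)) :=
  (smoothTraceGraph Ω).topologicalClosure

/-- The space `H^{1/2}(∂Ω)` of the traces of the functions in `H^1(Ω)`. -/
def Hhalf (Ω : Set (E d)) : Submodule ℝ (Lp ℝ 2 (surface Ω)) :=
  (traceGraph Ω).map (LinearMap.snd ℝ (H1 Ω) (Lp ℝ 2 (surface Ω)))

/-- `γ` is the trace `u|_{∂Ω}` of `u`. -/
def IsTrace {Ω : Set (E d)} (u : H1 Ω) (γ : Hhalf Ω) : Prop :=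
  (u, (γ : Lp ℝ 2 (surface Ω))) ∈ traceGraph Ω

/-- The boundary integral `∫_{∂Ω} γ ds`. -/
def boundaryIntegral {Ω : Set (E d)} (γ : Hhalf Ω) : ℝ :=
  ∫ x, (γ : Lp ℝ 2 (surface Ω)) x ∂(surface Ω)

/-- `g ∈ H_0^{-1/2}(∂Ω)`: `g` is a linear functional on `H^{1/2}(∂Ω)` that is bounded for the norm
`‖γ‖_{H^{1/2}} = inf {‖w‖_{H^1} | w|_{∂Ω} = γ}` and vanishes on the constants. -/
structure IsNeumannDatum {Ω : Set (E d)} (g : Hhalf Ω →ₗ[ℝ] ℝ) : Prop where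
  bounded : ∃ C : ℝ, ∀ (w : H1 Ω) (γ : Hhalf Ω), IsTrace w γ → |g γ| ≤ C * ‖w‖
  zero_mean : ∀ γ : Hhalf Ω, (γ : Lp ℝ 2 (surface Ω)) =ᵐ[surface Ω] (fun _ => (1 : ℝ)) → g γ = 0

/-- `u ∈ H^1(Ω)` is a weak solution of `-∇·(s∇u) = 0` in `Ω`, `s ∂u/∂ν = g` on `∂Ω`, with the
normalization `∫_{∂Ω} u ds = ∫_{∂Ω} f ds`. -/
structure IsNeumannSolution {Ω : Set (E d)} (s : E d → ℝ) (g : Hhalf Ω →ₗ[ℝ] ℝ) (f : Hhalf Ω)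
    (u : H1 Ω) : Prop where
  weak_eq : ∀ (w : H1 Ω) (γ : Hhalf Ω), IsTrace w γ →
    ∫ x in Ω, s x * ⟪grad u x, grad w x⟫ = g γ
  normalization : ∃ γ : Hhalf Ω, IsTrace u γ ∧ boundaryIntegral γ = boundaryIntegral f

/-- `U ∈ W^{1,∞}(ℝ^d; ℝ^d)` with weak Jacobian `DU`; `U` is the continuous representative of its
class. -/
structure IsW1Infty (U : E d → E d) (DU : E d → E d →L[ℝ] E d) : Prop where
  continuous : Continuous U
  memLp : MemLp U ∞ volume
  memLp_deriv : MemLp DU ∞ volume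
  weak_deriv : HasWeakFDeriv univ U DU

/-- The transformation `Φ_t(x) = x + t U(x)`. -/
def Phi (U : E d → E d) (t : ℝ) (x : E d) : E d := x + t • U x

/-- The transported conductivity `σ_t = σ ∘ Φ_t⁻¹` (`Φ_t` is bijective for small `|t|`). -/
def transported (U : E d → E d) (σ : E d → ℝ) (t : ℝ) : E d → ℝ :=
  σ ∘ Function.invFun (Phi U t)

/-- The matrix field `𝒜 = div(U) I - (DU + DUᵀ)`. -/
def calA (DU : E d → E d →L[ℝ] E d) (x : E d) : E d →L[ℝ] E d :=
  LinearMap.trace ℝ (E d) (DU x : E d →ₗ[ℝ] E d) • ContinuousLinearMap.id ℝ (E d)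
    - (DU x + ContinuousLinearMap.adjoint (DU x))

/-- `udot` is the material derivative at `t = 0` of the family `ut`, with `u` its value at `t = 0`:
for small `t ≠ 0` the function `ut t ∘ Φ_t` lies in `H^1(Ω)`, and `(ut t ∘ Φ_t - u) / t` converges
to `udot` strongly in `H^1(Ω)` as `t → 0`. -/
def HasMaterialDerivative {Ω : Set (E d)} (U : E d → E d) (u : H1 Ω) (ut : ℝ → H1 Ω)
    (udot : H1 Ω) : Prop :=
  ∃ v : ℝ → H1 Ω,
    (∀ᶠ t in 𝓝[≠] (0 : ℝ), fn (v t) =ᵐ[volume.restrict Ω] fn (ut t) ∘ Phi U t) ∧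
    Tendsto (fun t => t⁻¹ • (v t - u)) (𝓝[≠] 0) (𝓝 udot)

end EIT

end

open EIT

open MeasureTheory Filter Topology Set
open scoped ENNReal NNReal ContDiff RealInnerProductSpace

noncomputable section

namespace EIT

variable {d : ℕ}

/-! The proof pulls `u_t` back to the reference configuration. Put `v_t = u_t ∘ Φ_t` and `A_t =
|det(1 + t DU)| (1 + t DU)⁻¹ (1 + t DU)⁻ᵀ`. For small `t`, `Φ_t` is a bi-Lipschitz homeomorphism
that maps `Ω` onto itself and is the identity near `∂Ω`. Composition with it therefore preserves
`H^1(Ω)` and traces, so neither the Neumann datum nor the boundary mean changes. Since `σ_t ∘ Φ_t =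
σ`, the change of variables turns the problem for `u_t` into `∫ σ A_t ∇v_t · ∇w = ⟨g, w⟩`
(`setIntegral_pulledMatrix`). The possibly discontinuous `σ` is never differentiated: all dependence
on `t` sits in `A_t`.

As `DU` is essentially bounded, `A_t = I + t 𝒜 + o(t)` uniformly in `x`
(`eventually_norm_pulledMatrix_sub_le`). Subtract the equations for `v_t`, `u` and `u̇`, and test
with the error `(v_t - u)/t - u̇` itself. Coercivity then makes the `L²` norm of its gradient tend
to zero (`norm_differenceQuotient_sub_le`). The boundary mean of the error is zero, so the
Friedrichs inequality `‖w‖² ≤ C (‖∇w‖² + (∫_{∂Ω} w ds)²)` (`exists_norm_sq_le`) turns this into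
convergence in `H^1(Ω)`. The same inequality gives `u̇` by Lax–Milgram.

The analysis on Lipschitz domains rests on a uniform cone property (`coneAt`). Translating into the
domain before mollifying makes smooth functions dense in `H^1(Ω)`. Translating a boundary
neighbourhood into a compact subset of `Ω` reduces the Poincaré inequality to chains of balls. The
trace inequality comes from integrating along segments transversal to the boundary graph, and with
the Poincaré inequality it yields Friedrichs. The Lipschitz property of `U` and the a.e. identity of
`DU` with its derivative come from mollification and Rademacher's theorem. -/

/-- Cauchy–Schwarz against the constant function. -/
theorem sq_lintegral_le {α : Type*} [MeasurableSpace α] (μ : Measure α) {a : α → ℝ≥0∞}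
    (ha : AEMeasurable a μ) : (∫⁻ x, a x ∂μ) ^ 2 ≤ μ univ * ∫⁻ x, a x ^ 2 ∂μ := by
  have h := ENNReal.lintegral_mul_le_Lp_mul_Lq μ Real.HolderConjugate.two_two
    (f := fun _ => 1) aemeasurable_const ha
  simp only [Pi.mul_apply, one_mul, lintegral_one, ENNReal.rpow_two,
    one_pow] at h
  calc (∫⁻ x, a x ∂μ) ^ 2 ≤ (μ univ ^ (1 / 2 : ℝ) * (∫⁻ x, a x ^ 2 ∂μ) ^ (1 / 2 : ℝ)) ^ 2 := by
        gcongr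
    _ = μ univ * ∫⁻ x, a x ^ 2 ∂μ := by
        rw [mul_pow, ← ENNReal.rpow_two, ← ENNReal.rpow_two, ← ENNReal.rpow_mul,
          ← ENNReal.rpow_mul]
        norm_num

/-! ### Mollification of weakly differentiable functions. -/

section Mollify

variable {F : Type*} [NormedAddCommGroup F] [NormedSpace ℝ F]

/-- The convolution `k ⋆ f` of a scalar kernel with a vector valued function. -/
def mollify (k : E d → ℝ) (f : E d → F) (y : E d) : F := ∫ t, k t • f (y - t)

theorem mollify_eq_convolution (k : E d → ℝ) (f : E d → F) :
    mollify k f = convolution k f (ContinuousLinearMap.lsmul ℝ ℝ) volume := by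
  ext y; simp [mollify, convolution_def]

theorem mollify_eq_swap (k : E d → ℝ) (f : E d → F) (y : E d) :
    mollify k f y = ∫ z, k (y - z) • f z := by
  rw [mollify_eq_convolution, convolution_eq_swap]; simp

theorem integrable_mollify {k : E d → ℝ} (hk : Continuous k) (hc : HasCompactSupport k)
    {f : E d → F} (hf : LocallyIntegrable f) (y : E d) :
    Integrable (fun t => k t • f (y - t)) := by
  have := hc.convolutionExists_left (ContinuousLinearMap.lsmul ℝ ℝ) hk hf y
  simpa [ConvolutionExistsAt] using! this

theorem integrable_mollify_swap {k : E d → ℝ} (hk : Continuous k) (hc : HasCompactSupport k)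
    {f : E d → F} (hf : LocallyIntegrable f) (y : E d) :
    Integrable (fun z => k (y - z) • f z) := by
  have := (integrable_mollify hk hc hf y).comp_sub_left y
  simpa using! this

theorem contDiff_mollify {k : E d → ℝ} (hk : ContDiff ℝ ∞ k) (hc : HasCompactSupport k)
    {f : E d → F} (hf : LocallyIntegrable f) : ContDiff ℝ ∞ (mollify k f) := by
  rw [mollify_eq_convolution]
  exact hc.contDiff_convolution_left (n := ⊤) _ hk hf

/-- Differentiation of a mollified weakly differentiable function: the derivative falls on the
function wherever the reflected kernel is supported in the domain. -/
theorem hasFDerivAt_mollify [CompleteSpace F] {Ω : Set (E d)} {k : E d → ℝ} (hk : ContDiff ℝ ∞ k)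
    (hc : HasCompactSupport k) {f : E d → F} {f' : E d → E d →L[ℝ] F} (hf : LocallyIntegrable f)
    (hf' : LocallyIntegrable f') (hw : HasWeakFDeriv Ω f f') {y : E d}
    (hy : ∀ t ∈ tsupport k, y - t ∈ Ω) :
    HasFDerivAt (mollify k f) (mollify k f' y) y := by
  have h1 : HasFDerivAt (mollify k f)
      (convolution (fderiv ℝ k) f ((ContinuousLinearMap.lsmul ℝ ℝ).precompL (E d)) volume y) y := by
    rw [mollify_eq_convolution]
    exact hc.hasFDerivAt_convolution_left _ (hk.of_le (by simp)) hf y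
  suffices h : mollify k f' y = convolution (fderiv ℝ k) f
      ((ContinuousLinearMap.lsmul ℝ ℝ).precompL (E d)) volume y from h ▸ h1
  refine ContinuousLinearMap.ext fun v => ?_
  -- The test function is the reflected kernel centred at `y`; its weak-derivative identity is
  -- exactly the claim after `z = y - t`.
  let φ : E d → ℝ := fun z => k (y - z)
  have hφ : ContDiff ℝ ∞ φ := hk.comp (contDiff_const.sub contDiff_id)
  have hφc : HasCompactSupport φ := hc.comp_homeomorph (Homeomorph.subLeft y)
  have hφs : tsupport φ ⊆ Ω := by
    intro z hz
    have h2 : tsupport φ ⊆ (fun z => y - z) ⁻¹' tsupport k :=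
      closure_minimal (fun z hz => subset_tsupport _ hz)
        ((isClosed_tsupport k).preimage (continuous_const.sub continuous_id))
    simpa using hy _ (h2 hz)
  have hD : ∀ z, fderiv ℝ φ z v = - fderiv ℝ k (y - z) v := by
    intro z
    have h3 : HasFDerivAt φ ((fderiv ℝ k (y - z)).comp (-ContinuousLinearMap.id ℝ (E d))) z := by
      refine HasFDerivAt.comp z (hk.differentiable (by simp) _).hasFDerivAt ?_
      simpa using (hasFDerivAt_id z).const_sub y
    rw [h3.fderiv]; simp
  have hw' := hw φ hφ hφc hφs v
  have off : ∀ z ∉ Ω, φ z = 0 := fun z hz => image_eq_zero_of_notMem_tsupport fun h => hz (hφs h)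
  have off' : ∀ z ∉ Ω, fderiv ℝ φ z v = 0 := fun z hz => by
    rw [fderiv_of_notMem_tsupport ℝ fun h => hz (hφs h)]; simp
  rw [setIntegral_eq_integral_of_forall_compl_eq_zero (fun z hz => by rw [off' z hz, zero_smul]),
    setIntegral_eq_integral_of_forall_compl_eq_zero (fun z hz => by
      rw [off z hz, zero_smul])] at hw'
  have hint : Integrable (fun z => k (y - z) • f' z) :=
    integrable_mollify_swap hk.continuous hc hf' y
  have hk1 : Continuous (fderiv ℝ k) := hk.continuous_fderiv (by simp)
  have hint2 := (hc.fderiv ℝ).convolutionExists_left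
    ((ContinuousLinearMap.lsmul ℝ ℝ (E := F)).precompL (E d)) hk1 hf y
  rw [mollify_eq_swap, ContinuousLinearMap.integral_apply hint, convolution_eq_swap,
    ContinuousLinearMap.integral_apply (hint2.integrable_swap)]
  simp only [ContinuousLinearMap.precompL_apply, ContinuousLinearMap.lsmul_apply, smul_apply]
  simp only [hD, neg_smul, integral_neg, neg_inj] at hw'
  exact hw'.symm

/-- As `k` is a probability density, `k ⋆ f - f` at `y` is an average of the differences `f (y - t)
- f y`. Cauchy–Schwarz for the measure `k dt` and Tonelli give the bound. -/
theorem lintegral_mollify_sub_le [CompleteSpace F] {k : E d → ℝ} (hk : Continuous k)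
    (hc : HasCompactSupport k)
    (h0 : ∀ t, 0 ≤ k t) (h1 : ∫ t, k t = 1) {f : E d → F} (hf : LocallyIntegrable f) :
    ∫⁻ y, ‖mollify k f y - f y‖ₑ ^ 2 ≤
      ∫⁻ t, ENNReal.ofReal (k t) * ∫⁻ y, ‖f (y - t) - f y‖ₑ ^ 2 := by
  have hki : Integrable k := hk.integrable_of_hasCompactSupport hc
  let ν : Measure (E d) := volume.withDensity fun t => ENNReal.ofReal (k t)
  have hkm : Measurable fun t => ENNReal.ofReal (k t) := hk.measurable.ennreal_ofReal
  have hν : ν univ = 1 := by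
    simp only [ν, withDensity_apply _ MeasurableSet.univ, Measure.restrict_univ]
    rw [← ofReal_integral_eq_lintegral_ofReal hki (ae_of_all _ h0), h1, ENNReal.ofReal_one]
  have hfm := hf.aestronglyMeasurable
  have hjoint : AEStronglyMeasurable (fun p : E d × E d => f (p.1 - p.2) - f p.1)
      (volume.prod volume) :=
    (hfm.comp_quasiMeasurePreserving (quasiMeasurePreserving_sub_of_right_invariant _ _)).sub
      hfm.comp_fst
  have hpt : ∀ y, ‖mollify k f y - f y‖ₑ ^ 2 ≤
      ∫⁻ t, ENNReal.ofReal (k t) * ‖f (y - t) - f y‖ₑ ^ 2 := by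
    intro y
    have hm : AEStronglyMeasurable (fun t => f (y - t) - f y) volume :=
      (hfm.comp_quasiMeasurePreserving
        (quasiMeasurePreserving_sub_left_of_right_invariant volume y)).sub
        aestronglyMeasurable_const
    have e1 : mollify k f y - f y = ∫ t, k t • (f (y - t) - f y) := by
      simp_rw [smul_sub]
      rw [integral_sub (integrable_mollify hk hc hf y) (hki.smul_const _), integral_smul_const, h1,
        one_smul, mollify]
    have hac : ν ≪ volume := withDensity_absolutelyContinuous _ _
    calc ‖mollify k f y - f y‖ₑ ^ 2 ≤ (∫⁻ t, ‖k t • (f (y - t) - f y)‖ₑ) ^ 2 := by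
          rw [e1]; gcongr; exact enorm_integral_le_lintegral_enorm _
      _ = (∫⁻ t, ‖f (y - t) - f y‖ₑ ∂ν) ^ 2 := by
          rw [lintegral_withDensity_eq_lintegral_mul₀ hkm.aemeasurable hm.enorm]
          simp_rw [enorm_smul, Pi.mul_apply, Real.enorm_of_nonneg (h0 _)]
      _ ≤ ν univ * ∫⁻ t, ‖f (y - t) - f y‖ₑ ^ 2 ∂ν :=
          sq_lintegral_le ν (hm.enorm.mono_ac hac)
      _ = _ := by
          rw [hν, one_mul, lintegral_withDensity_eq_lintegral_mul₀ hkm.aemeasurable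
            (hm.enorm.pow_const 2)]
          rfl
  calc ∫⁻ y, ‖mollify k f y - f y‖ₑ ^ 2
      ≤ ∫⁻ y, ∫⁻ t, ENNReal.ofReal (k t) * ‖f (y - t) - f y‖ₑ ^ 2 := lintegral_mono hpt
    _ = ∫⁻ t, ∫⁻ y, ENNReal.ofReal (k t) * ‖f (y - t) - f y‖ₑ ^ 2 :=
        lintegral_lintegral_swap ((hkm.comp measurable_snd).aemeasurable.mul
          (hjoint.enorm.pow_const 2))
    _ = _ := by
        simp_rw [lintegral_const_mul' _ _ ENNReal.ofReal_ne_top]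

/-- Continuity of translations in `L²`, obtained from the continuity of composition with a
continuously varying family of measure preserving maps. -/
theorem lintegral_translate_sub_lt {F : Type*} [NormedAddCommGroup F] {f : E d → F}
    (hf : MemLp f 2) {ε : ℝ≥0∞} (hε : ε ≠ 0) :
    ∃ δ > 0, ∀ t, ‖t‖ < δ → ∫⁻ y, ‖f (y - t) - f y‖ₑ ^ 2 ≤ ε := by
  let g : E d → C(E d, E d) := fun t => ⟨fun y => y - t, by fun_prop⟩
  have hgm : ∀ t, MeasurePreserving (g t) volume volume :=
    fun t => measurePreserving_sub_right volume t
  have hg : Continuous g := ContinuousMap.continuous_of_continuous_uncurry _ (by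
    exact continuous_snd.sub continuous_fst)
  have hcont : Continuous fun t => Lp.compMeasurePreserving (g t) (hgm t) (hf.toLp f) :=
    continuous_const.compMeasurePreservingLp hg hgm (by simp)
  have h0 : Lp.compMeasurePreserving (g 0) (hgm 0) (hf.toLp f) = hf.toLp f := by
    apply Lp.ext
    filter_upwards [Lp.coeFn_compMeasurePreserving (hf.toLp f) (hgm 0)] with x hx
    rw [hx]; simp [g]
  have ht := (hcont.tendsto 0)
  rw [h0, tendsto_iff_edist_tendsto_0] at ht
  have ht2 := ENNReal.Tendsto.pow (n := 2) ht
  rw [zero_pow two_ne_zero] at ht2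
  obtain ⟨δ, hδ, h⟩ := Metric.eventually_nhds_iff.1 (ht2.eventually_le_const (pos_iff_ne_zero.2 hε))
  refine ⟨δ, hδ, fun t htδ => le_trans (le_of_eq ?_) (h (y := t) (by simpa using htδ))⟩
  rw [Lp.edist_def, eLpNorm_eq_lintegral_rpow_enorm_toReal (by simp) (by simp),
    ← ENNReal.rpow_two, ← ENNReal.rpow_mul]
  simp only [ENNReal.toReal_ofNat, one_div, ne_eq, OfNat.ofNat_ne_zero, not_false_eq_true,
    inv_mul_cancel₀, ENNReal.rpow_one, ENNReal.rpow_two]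
  refine lintegral_congr_ae ?_
  filter_upwards [Lp.coeFn_compMeasurePreserving (hf.toLp f) (hgm t),
    (hgm t).quasiMeasurePreserving.ae hf.coeFn_toLp, hf.coeFn_toLp] with x h1 h2 h3
  simp only [Pi.sub_apply, h1, Function.comp_apply, h2, h3]
  rfl

/-- Mollification with a narrow kernel approximates in `L²`. -/
theorem lintegral_mollify_sub_le_of_memLp [CompleteSpace F] {f : E d → F} (hf : MemLp f 2)
    {ε : ℝ≥0∞} (hε : ε ≠ 0) : ∃ δ > 0, ∀ k : E d → ℝ, Continuous k → HasCompactSupport k →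
      (∀ t, 0 ≤ k t) → ∫ t, k t = 1 → Function.support k ⊆ Metric.ball 0 δ →
      ∫⁻ y, ‖mollify k f y - f y‖ₑ ^ 2 ≤ ε := by
  obtain ⟨δ, hδ, h⟩ := lintegral_translate_sub_lt hf hε
  refine ⟨δ, hδ, fun k hk hc h0 h1 hs => ?_⟩
  refine (lintegral_mollify_sub_le hk hc h0 h1 (hf.locallyIntegrable (by simp))).trans ?_
  have hki : Integrable k := hk.integrable_of_hasCompactSupport hc
  calc ∫⁻ t, ENNReal.ofReal (k t) * ∫⁻ y, ‖f (y - t) - f y‖ₑ ^ 2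
      ≤ ∫⁻ t, ENNReal.ofReal (k t) * ε := by
        refine lintegral_mono fun t => ?_
        by_cases hkt : k t = 0
        · simp [hkt]
        · gcongr
          exact h t (by simpa using hs hkt)
    _ = ε := by
        rw [lintegral_mul_const _ hk.measurable.ennreal_ofReal,
          ← ofReal_integral_eq_lintegral_ofReal hki (ae_of_all _ h0), h1, ENNReal.ofReal_one,
          one_mul]

end Mollify

/-! ### Weak and classical derivatives of Lipschitz and `W^{1,∞}` functions. -/

/-- A real Lipschitz function is weakly differentiable, its weak derivative being the derivative
that exists almost everywhere by Rademacher's theorem. -/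
theorem hasWeakFDeriv_of_lipschitzWith {C : ℝ≥0} {f : E d → ℝ} (hf : LipschitzWith C f)
    (Ω : Set (E d)) : HasWeakFDeriv Ω f (fderiv ℝ f) := by
  intro φ hφ hc hs v
  have off : ∀ z ∉ Ω, φ z = 0 := fun z hz => image_eq_zero_of_notMem_tsupport fun h => hz (hs h)
  have off' : ∀ z ∉ Ω, fderiv ℝ φ z v = 0 := fun z hz => by
    rw [fderiv_of_notMem_tsupport ℝ fun h => hz (hs h)]; simp
  rw [setIntegral_eq_integral_of_forall_compl_eq_zero (fun z hz => by rw [off' z hz, zero_smul]),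
    setIntegral_eq_integral_of_forall_compl_eq_zero (fun z hz => by rw [off z hz, zero_smul])]
  obtain ⟨D, hD⟩ := (hφ.of_le (by simp)).lipschitzWith_of_hasCompactSupport hc
    (𝕂 := ℝ) (n := 1) one_ne_zero
  have h := hf.integral_lineDeriv_mul_eq (μ := volume) hD hc v
  have h2 : ∀ x, lineDeriv ℝ φ x (-v) = - fderiv ℝ φ x v := fun x => by
    rw [(hφ.differentiable (by simp) x).lineDeriv_eq_fderiv]; simp
  simp_rw [h2, neg_mul] at h
  rw [integral_neg] at h
  simp only [smul_eq_mul]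
  rw [← neg_eq_iff_eq_neg, ← h]
  refine integral_congr_ae ?_
  filter_upwards [hf.ae_differentiableAt (μ := volume)] with x hx
  rw [hx.lineDeriv_eq_fderiv, mul_comm]

theorem tendsto_narrow_kernel : ∃ b : ℕ → ContDiffBump (0 : E d),
    Tendsto (fun n => (b n).rOut) atTop (𝓝 0) := by
  refine ⟨fun n => ⟨1 / ((n : ℝ) + 1) / 2, 1 / ((n : ℝ) + 1), by positivity, ?_⟩, ?_⟩
  · exact half_lt_self (by positivity)
  · exact tendsto_one_div_add_atTop_nhds_zero_nat

/-- The continuous representative of a `W^{1,∞}` function is Lipschitz. -/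
theorem IsW1Infty.exists_lipschitzWith {U : E d → E d} {DU : E d → E d →L[ℝ] E d}
    (hU : IsW1Infty U DU) : ∃ K, LipschitzWith K U := by
  obtain ⟨b, hb⟩ := tendsto_narrow_kernel (d := d)
  have hM : ∀ᵐ x, ‖DU x‖ₑ ≤ eLpNorm DU ∞ volume := by
    rw [eLpNorm_exponent_top]; exact enorm_ae_le_eLpNormEssSup DU volume
  set M := (eLpNorm DU ∞ volume).toNNReal with hMdef
  have hM' : ∀ᵐ x, ‖DU x‖ ≤ M := by
    filter_upwards [hM] with x hx
    rw [← ENNReal.coe_toNNReal hU.memLp_deriv.eLpNorm_ne_top] at hx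
    exact_mod_cast hx
  refine ⟨M, ?_⟩
  let k : ℕ → E d → ℝ := fun n => (b n).normed volume
  -- The derivative of a mollification is an average of `DU`, hence bounded by the essential
  -- supremum `M`. The Lipschitz bound survives the pointwise limit, which is `U` itself everywhere
  -- because `U` is continuous.
  have hlip : ∀ n, LipschitzWith M (mollify (k n) U) := by
    intro n
    have hk : ContDiff ℝ ∞ (k n) := (b n).contDiff_normed
    have hc : HasCompactSupport (k n) := (b n).hasCompactSupport_normed
    have hd : ∀ y, HasFDerivAt (mollify (k n) U) (mollify (k n) DU y) y := fun y =>
      hasFDerivAt_mollify hk hc hU.continuous.locallyIntegrable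
        (hU.memLp_deriv.locallyIntegrable (by simp)) hU.weak_deriv (fun _ _ => mem_univ _)
    refine lipschitzWith_of_nnnorm_fderiv_le (𝕜 := ℝ) (fun y => (hd y).differentiableAt) fun y => ?_
    rw [(hd y).fderiv, ← NNReal.coe_le_coe, coe_nnnorm]
    have hint : Integrable fun t => k n t * M :=
      (hk.continuous.integrable_of_hasCompactSupport hc).mul_const _
    calc ‖mollify (k n) DU y‖ ≤ ∫ t, k n t * M := by
          refine norm_integral_le_of_norm_le hint ?_
          filter_upwards [(quasiMeasurePreserving_sub_left_of_right_invariant volume y).ae hM']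
            with t ht
          rw [norm_smul, Real.norm_of_nonneg ((b n).nonneg_normed t)]
          exact mul_le_mul_of_nonneg_left ht ((b n).nonneg_normed t)
      _ = M := by rw [integral_mul_const, (b n).integral_normed, one_mul]
  have hlim : ∀ x, Tendsto (fun n => mollify (k n) U x) atTop (𝓝 (U x)) := fun x => by
    simp_rw [mollify_eq_convolution]
    exact ContDiffBump.convolution_tendsto_right_of_continuous hb hU.continuous x
  refine LipschitzWith.of_dist_le_mul fun x y => ?_
  exact le_of_tendsto' ((hlim x).dist (hlim y)) fun n => (hlip n).dist_le_mul x y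

/-- Uniqueness of weak derivatives, by the fundamental lemma of the calculus of variations. -/
theorem ae_eq_of_hasWeakFDeriv_univ {f : E d → ℝ} {g h : E d → E d →L[ℝ] ℝ}
    (hg : HasWeakFDeriv univ f g) (hh : HasWeakFDeriv univ f h) (v : E d)
    (hgi : LocallyIntegrable fun x => g x v) (hhi : LocallyIntegrable fun x => h x v) :
    ∀ᵐ x, g x v = h x v := by
  refine ae_eq_of_integral_contDiff_smul_eq hgi hhi fun φ hφ hc => ?_
  have h1 := hg φ hφ hc (subset_univ _) v
  have h2 := hh φ hφ hc (subset_univ _) v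
  rw [h1] at h2
  simpa using h2

theorem locallyIntegrable_fderiv_apply {C : ℝ≥0} {f : E d → ℝ} (hf : LipschitzWith C f) (v : E d) :
    LocallyIntegrable fun x => fderiv ℝ f x v := by
  refine (hf.locallyIntegrable_lineDeriv v).congr ?_
  filter_upwards [hf.ae_differentiableAt (μ := volume)] with x hx
  rw [hx.lineDeriv_eq_fderiv]

/-- The weak Jacobian of a `W^{1,∞}` function is its derivative almost everywhere. -/
theorem IsW1Infty.ae_hasFDerivAt {U : E d → E d} {DU : E d → E d →L[ℝ] E d}
    (hU : IsW1Infty U DU) : ∀ᵐ x, HasFDerivAt U (DU x) x := by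
  obtain ⟨K, hK⟩ := hU.exists_lipschitzWith
  let e := EuclideanSpace.basisFun (Fin d) ℝ
  have hUi : LocallyIntegrable U := hU.continuous.locallyIntegrable
  have hDi : LocallyIntegrable DU := hU.memLp_deriv.locallyIntegrable (by simp)
  -- Each scalar component of `U` is Lipschitz, so its Rademacher derivative is a weak derivative.
  -- By uniqueness it agrees with the corresponding entry of `DU`.
  have key : ∀ i : Fin d, ∀ j : Fin d, ∀ᵐ x, innerSL ℝ (e i) (DU x (e j)) =
      fderiv ℝ (fun x => innerSL ℝ (e i) (U x)) x (e j) := by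
    intro i j
    let a := innerSL ℝ (e i)
    have hLip : LipschitzWith (‖a‖₊ * K) fun x => a (U x) := a.lipschitz.comp hK
    have hDv : LocallyIntegrable fun x => DU x (e j) := by
      refine fun x => ?_
      obtain ⟨s, hs, hi⟩ := hDi x
      exact ⟨s, hs, hi.apply_continuousLinearMap _⟩
    have hDav : LocallyIntegrable fun x => (a.comp (DU x)) (e j) := by
      refine fun x => ?_
      obtain ⟨s, hs, hi⟩ := hDv x
      exact ⟨s, hs, a.integrable_comp hi⟩
    refine ae_eq_of_hasWeakFDeriv_univ (f := fun x => a (U x)) (g := fun x => a.comp (DU x)) ?_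
      (hasWeakFDeriv_of_lipschitzWith hLip univ) (e j) hDav
      (locallyIntegrable_fderiv_apply hLip _)
    intro φ hφ hc hs v
    have h1 := congrArg a (hU.weak_deriv φ hφ hc hs v)
    have i1 : Integrable fun x => fderiv ℝ φ x v • U x :=
      hUi.integrable_smul_left_of_hasCompactSupport
        ((hφ.continuous_fderiv (by simp)).clm_apply continuous_const) (hc.fderiv_apply ℝ v)
    have i2 : Integrable fun x => φ x • DU x v := by
      have := (hDi.integrable_smul_left_of_hasCompactSupport hφ.continuous hc)
      simpa using this.apply_continuousLinearMap v
    rw [map_neg, Measure.restrict_univ, ← a.integral_comp_comm i1, ← a.integral_comp_comm i2] at h1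
    simpa using h1
  have key' := ae_all_iff.2 fun i => ae_all_iff.2 (key i)
  filter_upwards [key', hK.ae_differentiableAt (μ := volume)] with x hx hdx
  suffices h : DU x = fderiv ℝ U x from h ▸ hdx.hasFDerivAt
  refine ContinuousLinearMap.coe_injective (e.toBasis.ext fun j => ?_)
  refine InnerProductSpace.ext_inner_left_basis (𝕜 := ℝ) e.toBasis fun i => ?_
  have h1 := hx i j
  have h2 : HasFDerivAt (fun x => innerSL ℝ (e i) (U x))
      ((innerSL ℝ (e i)).comp (fderiv ℝ U x)) x :=
    (innerSL ℝ (e i)).hasFDerivAt.comp x hdx.hasFDerivAt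
  rw [h2.fderiv] at h1
  simpa using h1

/-! ### Multiplication and composition operators on `L²`. -/

section LpOperators

variable {α F F' : Type*} [MeasurableSpace α] {μ : Measure α}
  [NormedAddCommGroup F] [NormedSpace ℝ F] [NormedAddCommGroup F'] [NormedSpace ℝ F']

theorem eLpNorm_two_sq {F : Type*} [NormedAddCommGroup F] (f : α → F) :
    eLpNorm f 2 μ ^ 2 = ∫⁻ x, ‖f x‖ₑ ^ 2 ∂μ := by
  rw [eLpNorm_eq_lintegral_rpow_enorm_toReal (by simp) (by simp), ← ENNReal.rpow_two,
    ← ENNReal.rpow_mul]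
  simp

theorem enorm_sq_Lp {F : Type*} [NormedAddCommGroup F] (f : Lp F 2 μ) :
    ‖f‖ₑ ^ 2 = ∫⁻ x, ‖f x‖ₑ ^ 2 ∂μ := by
  rw [Lp.enorm_def, eLpNorm_two_sq]

/-- Multiplication by a bounded measurable field of operators, on `L²`. -/
theorem exists_lpMul {a : α → F →L[ℝ] F'} (ha : AEStronglyMeasurable a μ) {C : ℝ}
    (hb : ∀ᵐ x ∂μ, ‖a x‖ ≤ C) :
    ∃ L : Lp F 2 μ →L[ℝ] Lp F' 2 μ, ∀ f, L f =ᵐ[μ] fun x => a x (f x) := by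
  have hm : ∀ f : Lp F 2 μ, MemLp (fun x => a x (f x)) 2 μ := fun f => by
    refine (Lp.memLp f).of_le_mul (c := C) ?_ ?_
    · exact (ContinuousLinearMap.id ℝ (F →L[ℝ] F')).aestronglyMeasurable_comp₂ ha
        (Lp.aestronglyMeasurable f)
    · filter_upwards [hb] with x hx
      exact (a x).le_of_opNorm_le hx _
  refine ⟨LinearMap.mkContinuous
    { toFun := fun f => (hm f).toLp _
      map_add' := fun f g => ?_
      map_smul' := fun c f => ?_ } C fun f => ?_, fun f => (hm f).coeFn_toLp⟩
  · apply Lp.ext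
    filter_upwards [(hm (f + g)).coeFn_toLp, (hm f).coeFn_toLp, (hm g).coeFn_toLp,
      Lp.coeFn_add f g, Lp.coeFn_add ((hm f).toLp _) ((hm g).toLp _)] with x h1 h2 h3 h4 h5
    rw [h1, h5, Pi.add_apply, h2, h3, h4, Pi.add_apply, map_add]
  · apply Lp.ext
    filter_upwards [(hm (c • f)).coeFn_toLp, (hm f).coeFn_toLp,
      Lp.coeFn_smul c f, Lp.coeFn_smul c ((hm f).toLp _)] with x h1 h2 h4 h5
    rw [h1, RingHom.id_apply, h5, Pi.smul_apply, h2, h4, Pi.smul_apply, map_smul]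
  · refine Lp.norm_le_mul_norm_of_ae_le_mul ?_
    filter_upwards [hb, (hm f).coeFn_toLp] with x hx h1
    simp only [LinearMap.coe_mk, AddHom.coe_mk, h1]
    exact (a x).le_of_opNorm_le hx _

/-- Composition with a map that distorts the measure by a bounded factor, on `L²`. -/
theorem exists_lpComp {T : α → α} (hT : Measurable T) {c : ℝ≥0}
    (hc : μ.map T ≤ c • μ) :
    ∃ L : Lp F 2 μ →L[ℝ] Lp F 2 μ, ∀ f, L f =ᵐ[μ] fun x => f (T x) := by
  have hq : Measure.QuasiMeasurePreserving T μ μ :=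
    ⟨hT, Measure.absolutelyContinuous_of_le_smul hc⟩
  have hm : ∀ f : Lp F 2 μ, MemLp (fun x => f (T x)) 2 μ := fun f => by
    have h1 : MemLp f 2 (μ.map T) := (Lp.memLp f).of_measure_le_smul (c := c) (by simp) hc
    exact (memLp_map_measure_iff h1.1 hT.aemeasurable).1 h1
  refine ⟨LinearMap.mkContinuous
    { toFun := fun f => (hm f).toLp _
      map_add' := fun f g => ?_
      map_smul' := fun c f => ?_ } (Real.sqrt c) fun f => ?_, fun f => (hm f).coeFn_toLp⟩
  · apply Lp.ext
    filter_upwards [(hm (f + g)).coeFn_toLp, (hm f).coeFn_toLp, (hm g).coeFn_toLp,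
      hq.ae (Lp.coeFn_add f g), Lp.coeFn_add ((hm f).toLp _) ((hm g).toLp _)] with x h1 h2 h3 h4 h5
    rw [h1, h5, Pi.add_apply, h2, h3, h4, Pi.add_apply]
  · apply Lp.ext
    filter_upwards [(hm (c • f)).coeFn_toLp, (hm f).coeFn_toLp,
      hq.ae (Lp.coeFn_smul c f), Lp.coeFn_smul c ((hm f).toLp _)] with x h1 h2 h4 h5
    rw [h1, RingHom.id_apply, h5, Pi.smul_apply, h2, h4, Pi.smul_apply]
  · have h1 : ‖(hm f).toLp _‖ₑ ^ 2 ≤ c * ‖f‖ₑ ^ 2 := by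
      rw [enorm_sq_Lp, enorm_sq_Lp]
      calc ∫⁻ x, ‖((hm f).toLp _ : Lp F 2 μ) x‖ₑ ^ 2 ∂μ = ∫⁻ x, ‖f (T x)‖ₑ ^ 2 ∂μ := by
            refine lintegral_congr_ae ?_
            filter_upwards [(hm f).coeFn_toLp] with x hx
            rw [hx]
        _ = ∫⁻ x, ‖f x‖ₑ ^ 2 ∂(μ.map T) :=
            (lintegral_map (((Lp.stronglyMeasurable f).enorm).pow_const 2) hT).symm
        _ ≤ ∫⁻ x, ‖f x‖ₑ ^ 2 ∂(c • μ) := lintegral_mono' hc le_rfl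
        _ = _ := by rw [lintegral_smul_measure]; rfl
    have h2 : ‖(hm f).toLp _‖ ^ 2 ≤ c * ‖f‖ ^ 2 := by
      rw [← ofReal_norm, ← ofReal_norm, ← ENNReal.ofReal_pow (norm_nonneg _),
        ← ENNReal.ofReal_pow (norm_nonneg _), ← ENNReal.ofReal_coe_nnreal,
        ← ENNReal.ofReal_mul c.coe_nonneg] at h1
      exact (ENNReal.ofReal_le_ofReal_iff (by positivity)).1 h1
    refine abs_le_of_sq_le_sq' ?_ (by positivity) |>.2
    rw [mul_pow, Real.sq_sqrt c.coe_nonneg]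
    exact h2

end LpOperators

/-! ### The Hilbert space `H^1(Ω)`. -/

theorem HasWeakFDeriv.congr {F : Type*} [NormedAddCommGroup F] [NormedSpace ℝ F]
    {Ω : Set (E d)} {f g : E d → F} {f' g' : E d → E d →L[ℝ] F} (h : HasWeakFDeriv Ω f f')
    (hf : f =ᵐ[volume.restrict Ω] g) (hf' : f' =ᵐ[volume.restrict Ω] g') :
    HasWeakFDeriv Ω g g' := by
  intro φ hφ hc hs v
  have e1 : ∫ x in Ω, fderiv ℝ φ x v • g x = ∫ x in Ω, fderiv ℝ φ x v • f x :=
    integral_congr_ae (by filter_upwards [hf] with x hx; rw [hx])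
  have e2 : ∫ x in Ω, φ x • g' x v = ∫ x in Ω, φ x • f' x v :=
    integral_congr_ae (by filter_upwards [hf'] with x hx; rw [hx])
  rw [e1, e2, h φ hφ hc hs v]

namespace H1

variable {Ω : Set (E d)}

/-- The embedding `H^1(Ω) → L²(Ω)`. -/
def fnL (Ω : Set (E d)) : H1 Ω →L[ℝ] Lp ℝ 2 (volume.restrict Ω) :=
  (WithLp.fstL 2 ℝ _ _).comp (H1 Ω).subtypeL

/-- The gradient `H^1(Ω) → L²(Ω; ℝ^d)`. -/
def gradL (Ω : Set (E d)) : H1 Ω →L[ℝ] Lp (E d) 2 (volume.restrict Ω) :=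
  (WithLp.sndL 2 ℝ _ _).comp (H1 Ω).subtypeL

theorem norm_sq (u : H1 Ω) : ‖u‖ ^ 2 = ‖fn u‖ ^ 2 + ‖grad u‖ ^ 2 :=
  WithLp.prod_norm_sq_eq_of_L2 (u : WithLp 2 (Lp ℝ 2 (volume.restrict Ω) ×
    Lp (E d) 2 (volume.restrict Ω)))

theorem hasWeakFDeriv (u : H1 Ω) : HasWeakFDeriv Ω (fn u) (fun x => innerSL ℝ (grad u x)) :=
  u.2

theorem exists_mk {f : E d → ℝ} {G : E d → E d} (hf : MemLp f 2 (volume.restrict Ω))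
    (hG : MemLp G 2 (volume.restrict Ω)) (hw : HasWeakFDeriv Ω f (fun x => innerSL ℝ (G x))) :
    ∃ w : H1 Ω, fn w =ᵐ[volume.restrict Ω] f ∧ grad w =ᵐ[volume.restrict Ω] G := by
  refine ⟨⟨WithLp.toLp 2 (hf.toLp f, hG.toLp G), ?_⟩, hf.coeFn_toLp, hG.coeFn_toLp⟩
  refine hw.congr hf.coeFn_toLp.symm ?_
  filter_upwards [hG.coeFn_toLp] with x hx
  exact congrArg (innerSL ℝ) hx.symm

theorem memLp_test_smul {φ : E d → ℝ} (h : Continuous φ) (hc : HasCompactSupport φ) (v : E d) :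
    MemLp (fun x => φ x • v) 2 (volume.restrict Ω) :=
  ((h.smul continuous_const).memLp_of_hasCompactSupport hc.smul_right).restrict Ω

/-- For a fixed test function and direction, the defining identity equates two continuous `L²`
functionals. The space is an intersection of such closed sets, which gives completeness. -/
theorem isClosed (Ω : Set (E d)) : IsClosed (H1 Ω : Set (WithLp 2
    (Lp ℝ 2 (volume.restrict Ω) × Lp (E d) 2 (volume.restrict Ω)))) := by
  have h : (H1 Ω : Set (WithLp 2 (Lp ℝ 2 (volume.restrict Ω) × Lp (E d) 2 (volume.restrict Ω)))) =
      {p | ∀ φ : E d → ℝ, ∀ (h : ContDiff ℝ ∞ φ) (hc : HasCompactSupport φ), tsupport φ ⊆ Ω →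
        ∀ v : E d, ⟪(memLp_test_fderiv h hc v).toLp _, p.fst⟫ =
          - ⟪(memLp_test_smul h.continuous hc v).toLp _,
            p.snd⟫} := by
    ext p
    refine forall_congr' fun φ => forall_congr' fun h => forall_congr' fun hc =>
      forall_congr' fun hs => forall_congr' fun v => ?_
    rw [L2.inner_def, L2.inner_def]
    have e1 : ∫ x in Ω, ⟪(memLp_test_fderiv (Ω := Ω) h hc v).toLp _ x, p.fst x⟫ =
        ∫ x in Ω, fderiv ℝ φ x v • p.fst x := by
      refine integral_congr_ae ?_
      filter_upwards [(memLp_test_fderiv (Ω := Ω) h hc v).coeFn_toLp] with x hx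
      rw [hx]; simp [mul_comm]
    have e2 : ∫ x in Ω, ⟪(memLp_test_smul (Ω := Ω) h.continuous hc v).toLp _ x, p.snd x⟫ =
        ∫ x in Ω, φ x • innerSL ℝ (p.snd x) v := by
      refine integral_congr_ae ?_
      filter_upwards [(memLp_test_smul (Ω := Ω) h.continuous hc v).coeFn_toLp] with x hx
      rw [hx, real_inner_smul_left, innerSL_apply_apply, real_inner_comm]; rfl
    rw [e1, e2]
  rw [h]
  simp only [ofPred_forall]
  refine isClosed_iInter fun φ => isClosed_iInter fun h => isClosed_iInter fun hc =>
    isClosed_iInter fun hs => isClosed_iInter fun v => ?_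
  exact isClosed_eq (continuous_const.inner (WithLp.fstL 2 ℝ _ _).continuous)
    (continuous_const.inner (WithLp.sndL 2 ℝ _ _).continuous).neg

instance : CompleteSpace (H1 Ω) := (isClosed Ω).completeSpace_coe

theorem grad_eq_zero_of_fn_eq_zero (hΩ : IsOpen Ω) {u : H1 Ω} (hu : fn u = 0) : grad u = 0 := by
  have hu' : fn u =ᵐ[volume.restrict Ω] 0 := by rw [hu]; exact Lp.coeFn_zero ..
  have key : ∀ v : E d, ∀ᵐ x, x ∈ Ω → ⟪grad u x, v⟫ = 0 := by
    intro v
    refine hΩ.ae_eq_zero_of_integral_contDiff_smul_eq_zero ?_ fun φ hφ hc hs => ?_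
    · exact locallyIntegrableOn_of_locallyIntegrable_restrict
        (((Lp.memLp (grad u)).inner_const v).locallyIntegrable (by simp))
    · have h := hasWeakFDeriv u φ hφ hc hs v
      rw [integral_eq_zero_of_ae (by filter_upwards [hu'] with x hx; simp [hx])] at h
      rw [← setIntegral_eq_integral_of_forall_compl_eq_zero (s := Ω)]
      · simpa using h
      · intro x hx
        rw [image_eq_zero_of_notMem_tsupport fun h => hx (hs h), zero_smul]
  let e := (EuclideanSpace.basisFun (Fin d) ℝ).toBasis
  have h2 := ae_all_iff.2 fun i => key (e i)
  apply Lp.ext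
  filter_upwards [ae_restrict_of_ae h2, ae_restrict_mem hΩ.measurableSet, Lp.coeFn_zero (E d) 2
    (volume.restrict Ω)] with x hx hxΩ h0
  rw [h0]
  refine InnerProductSpace.ext_inner_right_basis (𝕜 := ℝ) e fun i => ?_
  simpa using hx i hxΩ

/-- The gradient component carries no further information, so elements built by different routes can
be identified through their functions alone. -/
theorem ext_fn (hΩ : IsOpen Ω) {u w : H1 Ω} (h : fn u =ᵐ[volume.restrict Ω] fn w) : u = w := by
  have h1 : fn (u - w) = 0 := by
    change fnL Ω (u - w) = 0
    rw [map_sub, sub_eq_zero]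
    exact Lp.ext h
  have h2 := grad_eq_zero_of_fn_eq_zero hΩ h1
  have h3 := norm_sq (u - w)
  rw [h1, h2] at h3
  rw [← sub_eq_zero, ← norm_eq_zero]
  simpa using h3

end H1

theorem memLp_of_continuous {F : Type*} [NormedAddCommGroup F] {Ω : Set (E d)}
    (hb : Bornology.IsBounded Ω) {f : E d → F} (hf : Continuous f) (p : ℝ≥0∞) :
    MemLp f p (volume.restrict Ω) := by
  have : IsFiniteMeasure (volume.restrict Ω) := ⟨by simpa using hb.measure_lt_top⟩
  obtain ⟨C, hC⟩ := hb.isCompact_closure.exists_bound_of_continuousOn hf.continuousOn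
  refine MemLp.of_bound hf.aestronglyMeasurable C ?_
  have h : ∀ᵐ x ∂(volume.restrict (closure Ω)), ‖f x‖ ≤ C :=
    (ae_restrict_mem isClosed_closure.measurableSet).mono hC
  exact ae_mono (Measure.restrict_mono subset_closure le_rfl) h

theorem innerSL_gradient (f : E d → ℝ) (x : E d) : innerSL ℝ (gradient f x) = fderiv ℝ f x :=
  ContinuousLinearMap.ext fun v => by simp [inner_gradient_left]

theorem norm_gradient (f : E d → ℝ) (x : E d) : ‖gradient f x‖ = ‖fderiv ℝ f x‖ := by
  rw [← innerSL_gradient, innerSL_apply_norm]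

theorem gradient_eq_of_hasFDerivAt {f : E d → ℝ} {x v : E d}
    (h : HasFDerivAt f (innerSL ℝ v) x) : gradient f x = v := by
  refine ext_inner_right ℝ fun w => ?_
  rw [inner_gradient_left, h.fderiv, innerSL_apply_apply]

theorem continuous_gradient {f : E d → ℝ} (hf : ContDiff ℝ 1 f) : Continuous (gradient f) :=
  (InnerProductSpace.toDual ℝ (E d)).symm.continuous.comp (hf.continuous_fderiv one_ne_zero)

/-- Integration by parts against a test function. -/
theorem hasWeakFDeriv_of_contDiff {f : E d → ℝ} (hf : ContDiff ℝ 1 f) (Ω : Set (E d)) :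
    HasWeakFDeriv Ω f (fderiv ℝ f) := by
  intro φ hφ hc hs v
  have off : ∀ z ∉ Ω, φ z = 0 := fun z hz => image_eq_zero_of_notMem_tsupport fun h => hz (hs h)
  have off' : ∀ z ∉ Ω, fderiv ℝ φ z v = 0 := fun z hz => by
    rw [fderiv_of_notMem_tsupport ℝ fun h => hz (hs h)]; simp
  rw [setIntegral_eq_integral_of_forall_compl_eq_zero (fun z hz => by rw [off' z hz, zero_smul]),
    setIntegral_eq_integral_of_forall_compl_eq_zero (fun z hz => by rw [off z hz, zero_smul])]
  have c1 : Continuous fun x => fderiv ℝ φ x v :=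
    (hφ.continuous_fderiv (by simp)).clm_apply continuous_const
  have c2 : Continuous fun x => fderiv ℝ f x v :=
    (hf.continuous_fderiv one_ne_zero).clm_apply continuous_const
  have h := integral_mul_fderiv_eq_neg_fderiv_mul_of_integrable (μ := volume) (f := f) (g := φ)
    (v := v) ((c2.mul hφ.continuous).integrable_of_hasCompactSupport hc.mul_left)
    ((hf.continuous.mul c1).integrable_of_hasCompactSupport (hc.fderiv_apply ℝ v).mul_left)
    ((hf.continuous.mul hφ.continuous).integrable_of_hasCompactSupport hc.mul_left)
    (fun x _ => hf.differentiable one_ne_zero x) (fun x _ => hφ.differentiable (by simp) x)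
  simp only [smul_eq_mul]
  simpa only [mul_comm] using h

namespace H1

variable {Ω : Set (E d)}

theorem exists_of_contDiff (hb : Bornology.IsBounded Ω) {f : E d → ℝ} (hf : ContDiff ℝ 1 f) :
    ∃ w : H1 Ω, fn w =ᵐ[volume.restrict Ω] f ∧ grad w =ᵐ[volume.restrict Ω] gradient f := by
  refine exists_mk (memLp_of_continuous hb hf.continuous 2)
    (memLp_of_continuous hb (continuous_gradient hf) 2) ?_
  simp only [innerSL_gradient]
  exact hasWeakFDeriv_of_contDiff hf Ω

/-- The product of an `H^1` function and a test function. -/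
theorem exists_mul {χ : E d → ℝ} (hχ : ContDiff ℝ ∞ χ) (hc : HasCompactSupport χ) (u : H1 Ω) :
    ∃ w : H1 Ω, fn w =ᵐ[volume.restrict Ω] (fun x => χ x * fn u x) ∧
      grad w =ᵐ[volume.restrict Ω] fun x => χ x • grad u x + fn u x • gradient χ x := by
  have hg : Continuous (gradient χ) := continuous_gradient (hχ.of_le (by simp))
  have hgc : HasCompactSupport (gradient χ) :=
    (hc.fderiv ℝ).comp_left (g := (InnerProductSpace.toDual ℝ (E d)).symm) (map_zero _)
  have m1 : MemLp χ ∞ (volume.restrict Ω) :=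
    (hχ.continuous.memLp_of_hasCompactSupport hc).restrict Ω
  have m2 : MemLp (gradient χ) ∞ (volume.restrict Ω) :=
    (hg.memLp_of_hasCompactSupport hgc).restrict Ω
  have m3 : MemLp (fun x => fn u x • gradient χ x) 2 (volume.restrict Ω) :=
    m2.smul (Lp.memLp (fn u))
  refine exists_mk ((Lp.memLp (fn u)).mul m1) (((Lp.memLp (grad u)).smul m1).add m3) ?_
  intro φ hφ hφc hφs v
  have h := hasWeakFDeriv u (fun x => φ x * χ x) (hφ.mul hχ) hφc.mul_right
    ((tsupport_mul_subset_left).trans hφs) v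
  have hD : ∀ x, fderiv ℝ (fun x => φ x * χ x) x v =
      φ x * fderiv ℝ χ x v + χ x * fderiv ℝ φ x v := fun x => by
    rw [fderiv_fun_mul (hφ.differentiable (by simp) x) (hχ.differentiable (by simp) x)]
    simp
  simp only [hD, innerSL_apply_apply, smul_eq_mul] at h
  simp only [innerSL_apply_apply, inner_add_left, real_inner_smul_left, inner_gradient_left,
    smul_eq_mul]
  have i0 : MemLp (fun x => φ x * fderiv ℝ χ x v) 2 (volume.restrict Ω) :=
    memLp_test (hφ.continuous.mul ((hχ.continuous_fderiv (by simp)).clm_apply continuous_const))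
      hφc.mul_right
  have i1 : Integrable (fun x => (φ x * fderiv ℝ χ x v) * fn u x) (volume.restrict Ω) :=
    i0.integrable_mul (Lp.memLp (fn u))
  have i2' : MemLp (fun x => χ x * fderiv ℝ φ x v) 2 (volume.restrict Ω) :=
    memLp_test (hχ.continuous.mul ((hφ.continuous_fderiv (by simp)).clm_apply continuous_const))
      hc.mul_right
  have i2 : Integrable (fun x => (χ x * fderiv ℝ φ x v) * fn u x) (volume.restrict Ω) :=
    i2'.integrable_mul (Lp.memLp (fn u))
  have i3 : Integrable (fun x => (φ x * χ x) * ⟪grad u x, v⟫) (volume.restrict Ω) :=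
    (memLp_test (hφ.continuous.mul hχ.continuous) hφc.mul_right).integrable_mul
      ((Lp.memLp (grad u)).inner_const v)
  have e1 : ∫ x in Ω, (φ x * fderiv ℝ χ x v + χ x * fderiv ℝ φ x v) * fn u x =
      (∫ x in Ω, (φ x * fderiv ℝ χ x v) * fn u x) + ∫ x in Ω, (χ x * fderiv ℝ φ x v) * fn u x := by
    rw [← integral_add i1 i2]
    exact integral_congr_ae (ae_of_all _ fun x => by ring)
  have e2 : ∫ x in Ω, φ x * (χ x * ⟪grad u x, v⟫ + fn u x * fderiv ℝ χ x v) =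
      (∫ x in Ω, (φ x * χ x) * ⟪grad u x, v⟫) + ∫ x in Ω, (φ x * fderiv ℝ χ x v) * fn u x := by
    rw [← integral_add i3 i1]
    exact integral_congr_ae (ae_of_all _ fun x => by ring)
  have e3 : ∫ x in Ω, fderiv ℝ φ x v * (χ x * fn u x) =
      ∫ x in Ω, (χ x * fderiv ℝ φ x v) * fn u x :=
    integral_congr_ae (ae_of_all _ fun x => by ring)
  rw [e1] at h
  change ∫ x in Ω, fderiv ℝ φ x v * (χ x * fn u x) =
    - ∫ x in Ω, φ x * (χ x * ⟪grad u x, v⟫ + fn u x * fderiv ℝ χ x v)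
  rw [e2, e3]
  linarith

end H1

/-! ### The cone condition and the density of smooth functions. -/

/-- Translating the points of `Ω` near `x` in a fixed direction moves them away from the boundary
at a linear rate. -/
def ConeAt (Ω : Set (E d)) (x : E d) : Prop :=
  ∃ r > 0, ∃ ρ > 0, ∃ e : E d, ∀ z ∈ Metric.ball x r, z ∈ Ω → ∀ s : ℝ, 0 < s → s ≤ 1 →
    Metric.ball (z + s • e) (ρ * s) ⊆ Ω

/-- Interior points need no translation, so `e = 0` works. Near a boundary point, moving along `ν`
gains height `s r / 4`. A perturbation `b` costs at most `‖b‖` in height and `2 K ‖b‖` in the graph,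
so a ball of radius proportional to `s` stays above the graph. -/
theorem IsBoundedLipschitzDomain.coneAt {Ω : Set (E d)} (hΩ : IsBoundedLipschitzDomain Ω)
    {x : E d} (hx : x ∈ closure Ω) : ConeAt Ω x := by
  by_cases hxΩ : x ∈ Ω
  · obtain ⟨r, hr, h⟩ := Metric.isOpen_iff.1 hΩ.isOpen x hxΩ
    refine ⟨r / 2, by positivity, r / 2, by positivity, 0, fun z hz _ s hs hs1 y hy => h ?_⟩
    rw [Metric.mem_ball] at *
    rw [smul_zero, add_zero] at hy
    have := dist_triangle y z x
    nlinarith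
  · have hxf : x ∈ frontier Ω := by rw [hΩ.isOpen.frontier_eq]; exact ⟨hx, hxΩ⟩
    obtain ⟨r, hr, ν, hν, K, ψ, hψ, h⟩ := hΩ.lipschitz x hxf
    -- Chosen so that the total loss `(1 + 2 K) ‖b‖` stays below the gain `s r / 4` whenever `‖b‖ <
    -- ρ s`.
    set ρ : ℝ := r / 4 / (1 + 2 * K) with hρ
    have hK : 0 ≤ (K : ℝ) := K.coe_nonneg
    have hρ0 : 0 < ρ := by positivity
    have hρK : ρ * (1 + 2 * K) = r / 4 := by rw [hρ]; field_simp
    refine ⟨r / 2, by positivity, ρ, hρ0, (r / 4) • ν, fun z hz hzΩ s hs hs1 y hy => ?_⟩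
    rw [Metric.mem_ball] at hz hy
    set b := y - (z + s • (r / 4) • ν) with hb
    have hbn : ‖b‖ < ρ * s := by rwa [dist_eq_norm] at hy
    have hy' : y = z + s • (r / 4) • ν + b := by rw [hb]; abel
    have hinner : |⟪ν, b⟫| ≤ ‖b‖ := by
      have := abs_real_inner_le_norm ν b
      rwa [hν, one_mul] at this
    have hsn : ‖s • (r / 4) • ν‖ = s * (r / 4) := by
      rw [norm_smul, norm_smul, hν, Real.norm_of_nonneg hs.le, Real.norm_of_nonneg (by positivity),
        mul_one]
    have hρr : ρ ≤ r / 4 := by nlinarith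
    have hyball : y ∈ Metric.ball x r := by
      rw [Metric.mem_ball]
      have h1 : dist y z ≤ s * (r / 4) + ‖b‖ := by
        rw [dist_eq_norm, hy', add_assoc, add_sub_cancel_left, ← hsn]
        exact norm_add_le _ _
      have := dist_triangle y z x
      nlinarith
    have hzball : z ∈ Metric.ball x r := by rw [Metric.mem_ball]; linarith
    rw [h y hyball]
    have hz1 := (h z hzball).1 hzΩ
    have hνν : ⟪ν, ν⟫ = 1 := by rw [real_inner_self_eq_norm_sq, hν, one_pow]
    have hyν : ⟪ν, y⟫ = ⟪ν, z⟫ + s * (r / 4) + ⟪ν, b⟫ := by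
      rw [hy', inner_add_right, inner_add_right, real_inner_smul_right, real_inner_smul_right, hνν,
        mul_one]
    have hproj : y - ⟪ν, y⟫ • ν - (z - ⟪ν, z⟫ • ν) = b - ⟪ν, b⟫ • ν := by
      rw [hyν, hy']
      module
    have hlip := hψ.dist_le_mul (y - ⟪ν, y⟫ • ν) (z - ⟪ν, z⟫ • ν)
    rw [dist_eq_norm (y - _), hproj, Real.dist_eq] at hlip
    have hbb : ‖b - ⟪ν, b⟫ • ν‖ ≤ 2 * ‖b‖ := by
      refine (norm_sub_le _ _).trans ?_
      rw [norm_smul, hν, mul_one, Real.norm_eq_abs]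
      linarith
    have h1 := (abs_le.1 hlip).2
    have h2 := (abs_le.1 hinner).1
    have h3 : (K : ℝ) * ‖b - ⟪ν, b⟫ • ν‖ ≤ K * (2 * ‖b‖) := by gcongr
    have h4 : ‖b‖ * (1 + 2 * K) ≤ s * (r / 4) := by
      rw [← hρK]; nlinarith
    nlinarith

namespace H1

variable {Ω : Set (E d)}

/-- The restrictions of smooth functions on `ℝ^d` to `Ω`. -/
def smoothFns (Ω : Set (E d)) : Submodule ℝ (H1 Ω) where
  carrier := {w | ∃ φ : E d → ℝ, ContDiff ℝ ∞ φ ∧ fn w =ᵐ[volume.restrict Ω] φ}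
  zero_mem' := ⟨0, contDiff_const, Lp.coeFn_zero ..⟩
  add_mem' := by
    rintro p q ⟨φ, h, h1⟩ ⟨φ', h', h1'⟩
    exact ⟨φ + φ', h.add h', (Lp.coeFn_add (fn p) (fn q)).trans (h1.add h1')⟩
  smul_mem' := by
    rintro c p ⟨φ, h, h1⟩
    exact ⟨c • φ, h.const_smul c, (Lp.coeFn_smul c (fn p)).trans (h1.const_smul c)⟩

theorem enorm_sq (u : H1 Ω) : ‖u‖ₑ ^ 2 =
    (∫⁻ x in Ω, ‖fn u x‖ₑ ^ 2) + ∫⁻ x in Ω, ‖grad u x‖ₑ ^ 2 := by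
  rw [← enorm_sq_Lp, ← enorm_sq_Lp, ← ofReal_norm, ← ofReal_norm, ← ofReal_norm,
    ← ENNReal.ofReal_pow (norm_nonneg _), ← ENNReal.ofReal_pow (norm_nonneg _),
    ← ENNReal.ofReal_pow (norm_nonneg _), ← ENNReal.ofReal_add (by positivity) (by positivity),
    norm_sq]

theorem enorm_sub_sq_le {u w : H1 Ω} {f g : E d → ℝ} {F G : E d → E d}
    (hu : fn u =ᵐ[volume.restrict Ω] f) (hu' : grad u =ᵐ[volume.restrict Ω] F)
    (hw : fn w =ᵐ[volume.restrict Ω] g) (hw' : grad w =ᵐ[volume.restrict Ω] G) :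
    ‖u - w‖ₑ ^ 2 ≤ (∫⁻ x, ‖f x - g x‖ₑ ^ 2) + ∫⁻ x, ‖F x - G x‖ₑ ^ 2 := by
  rw [enorm_sq]
  gcongr ?_ + ?_
  · refine le_trans (le_of_eq (lintegral_congr_ae ?_)) (setLIntegral_le_lintegral Ω _)
    filter_upwards [hu, hw, Lp.coeFn_sub (fn u) (fn w)] with x h1 h2 h3
    rw [← h1, ← h2, ← Pi.sub_apply (⇑(fn u)), ← h3]
    rfl
  · refine le_trans (le_of_eq (lintegral_congr_ae ?_)) (setLIntegral_le_lintegral Ω _)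
    filter_upwards [hu', hw', Lp.coeFn_sub (grad u) (grad w)] with x h1 h2 h3
    rw [← h1, ← h2, ← Pi.sub_apply (⇑(grad u)), ← h3]
    rfl

theorem mem_closure_of_enorm_sq_le {S : Set (H1 Ω)} {w : H1 Ω}
    (h : ∀ ε : ℝ≥0∞, ε ≠ 0 → ∃ w' ∈ S, ‖w' - w‖ₑ ^ 2 ≤ ε) : w ∈ closure S := by
  rw [EMetric.mem_closure_iff]
  intro ε hε
  obtain ⟨ε', hε', hlt⟩ := exists_between hε
  obtain ⟨w', hw', h'⟩ := h (ε' ^ 2) (by simpa using hε'.ne')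
  refine ⟨w', hw', ?_⟩
  rw [edist_comm, edist_eq_enorm_sub]
  exact lt_of_le_of_lt ((ENNReal.pow_le_pow_left_iff two_ne_zero).1 h') hlt

theorem innerSL_mollify {k : E d → ℝ} (hk : Continuous k) (hc : HasCompactSupport k)
    {G : E d → E d} (hG : LocallyIntegrable G) (y : E d) :
    mollify k (fun x => innerSL ℝ (G x)) y = innerSL ℝ (mollify k G y) := by
  rw [mollify, mollify, ← ContinuousLinearMap.integral_comp_comm _ (integrable_mollify hk hc hG y)]
  simp

/-- The kernel lives near `-s e`, so mollification at `y` samples only points within `ρ s / 2` of `y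
+ s e`. If `y` is in the ball, the cone condition puts these in `Ω`, where the weak gradient is
valid. If it is not, the samples miss `K`, also for all nearby points, and both sides vanish. -/
theorem gradient_mollify_eq {x e : E d} {r ρ s δ : ℝ} (hρ : 0 < ρ)
    (hcone : ∀ z ∈ Metric.ball x r, z ∈ Ω → Metric.ball (z + s • e) (ρ * s) ⊆ Ω) (hs : 0 < s)
    {K : Set (E d)} (hKr : Metric.thickening δ K ⊆ Metric.ball x r) (hsδ : s * (‖e‖ + ρ) < δ)
    {k : E d → ℝ} (hk : ContDiff ℝ ∞ k) (hkc : HasCompactSupport k)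
    (hts : ∀ t ∈ tsupport k, ‖t + s • e‖ ≤ ρ * s / 2)
    {f : E d → ℝ} {G : E d → E d} (hfl : LocallyIntegrable f) (hGl : LocallyIntegrable G)
    (hfK : ∀ y ∉ K, f y = 0) (hGK : ∀ y ∉ K, G y = 0)
    (hweak : HasWeakFDeriv Ω f fun x => innerSL ℝ (G x)) {y : E d} (hy : y ∈ Ω) :
    gradient (mollify k f) y = mollify k G y := by
  have hρs : 0 < ρ * s := by positivity
  have hGl' : LocallyIntegrable fun x => innerSL ℝ (G x) := fun y => by
    obtain ⟨t, ht, hi⟩ := hGl y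
    exact ⟨t, ht, (innerSL ℝ).integrable_comp hi⟩
  by_cases hyr : y ∈ Metric.ball x r
  · refine gradient_eq_of_hasFDerivAt ?_
    rw [← innerSL_mollify hk.continuous hkc hGl]
    refine hasFDerivAt_mollify hk hkc hfl hGl' hweak fun t ht => ?_
    refine hcone y hyr hy ?_
    rw [Metric.mem_ball, dist_eq_norm, ← norm_neg]
    have h1 := hts t ht
    have h2 : -(y - t - (y + s • e)) = t + s • e := by abel
    rw [h2]
    linarith
  · have hz : ∀ y', dist y' y < δ - s * (‖e‖ + ρ) → ∀ t, k t ≠ 0 → y' - t ∉ K := by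
      intro y' hy' t ht hK'
      refine hyr (hKr (Metric.mem_thickening_iff.2 ⟨y' - t, hK', ?_⟩))
      have h1 := hts t (subset_tsupport _ ht)
      have h2 : ‖t‖ ≤ ‖t + s • e‖ + ‖s • e‖ := by
        simpa using norm_sub_le (t + s • e) (s • e)
      rw [norm_smul, Real.norm_of_nonneg hs.le] at h2
      have h3 : dist y (y' - t) ≤ dist y y' + ‖t‖ := by
        refine (dist_triangle y y' _).trans ?_
        rw [dist_eq_norm y' (y' - t), sub_sub_cancel]
      rw [dist_comm] at hy'
      linarith
    have hpos : 0 < δ - s * (‖e‖ + ρ) := by linarith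
    have hG0 : mollify k G y = 0 := by
      refine integral_eq_zero_of_ae (ae_of_all _ fun t => ?_)
      by_cases hkt : k t = 0
      · simp [hkt]
      · simp [hGK _ (hz y (by simpa using hpos) t hkt)]
    have hf0 : mollify k f =ᶠ[𝓝 y] fun _ => 0 := by
      filter_upwards [Metric.ball_mem_nhds y hpos] with y' hy'
      refine integral_eq_zero_of_ae (ae_of_all _ fun t => ?_)
      by_cases hkt : k t = 0
      · simp [hkt]
      · simp [hfK _ (hz y' hy' t hkt)]
    rw [hG0]
    refine gradient_eq_of_hasFDerivAt ?_
    rw [map_zero]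
    exact (hasFDerivAt_const (0 : ℝ) y).congr_of_eventuallyEq hf0

theorem exists_kernel (c : E d) {η : ℝ} (hη : 0 < η) : ∃ k : E d → ℝ, ContDiff ℝ ∞ k ∧
    HasCompactSupport k ∧ (∀ t, 0 ≤ k t) ∧ ∫ t, k t = 1 ∧ tsupport k ⊆ Metric.closedBall c η := by
  let b : ContDiffBump c := ⟨η / 2, η, by positivity, by linarith⟩
  exact ⟨b.normed volume, b.contDiff_normed, b.hasCompactSupport_normed, b.nonneg_normed,
    b.integral_normed, b.tsupport_normed_eq.subset⟩

/-- Where a cone condition holds, a weakly differentiable function with small support is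
approximated by its mollifications with kernels shifted into the domain. -/
theorem exists_contDiff_approx {x e : E d} {r ρ : ℝ} (hρ : 0 < ρ)
    (hcone : ∀ z ∈ Metric.ball x r, z ∈ Ω → ∀ s : ℝ, 0 < s → s ≤ 1 →
      Metric.ball (z + s • e) (ρ * s) ⊆ Ω)
    {K : Set (E d)} (hK : IsCompact K) (hKr : K ⊆ Metric.ball x r)
    {f : E d → ℝ} {G : E d → E d} (hfm : MemLp f 2) (hGm : MemLp G 2)
    (hfK : ∀ y ∉ K, f y = 0) (hGK : ∀ y ∉ K, G y = 0)
    (hweak : HasWeakFDeriv Ω f fun x => innerSL ℝ (G x)) {ε : ℝ≥0∞} (hε : ε ≠ 0) :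
    ∃ (φ : E d → ℝ) (H : E d → E d), ContDiff ℝ ∞ φ ∧ (∀ y ∈ Ω, gradient φ y = H y) ∧
      ∫⁻ y, ‖φ y - f y‖ₑ ^ 2 ≤ ε ∧ ∫⁻ y, ‖H y - G y‖ₑ ^ 2 ≤ ε := by
  obtain ⟨δ₁, hδ₁, H₁⟩ := lintegral_mollify_sub_le_of_memLp hfm hε
  obtain ⟨δ₂, hδ₂, H₂⟩ := lintegral_mollify_sub_le_of_memLp hGm hε
  obtain ⟨δ₃, hδ₃, H₃⟩ := hK.exists_thickening_subset_open Metric.isOpen_ball hKr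
  set δ := min δ₁ (min δ₂ δ₃) with hδ
  have hδ0 : 0 < δ := by positivity
  -- The kernel support is contained in the ball of radius `s (‖e‖ + ρ)` about the origin, which
  -- must be smaller than every tolerance collected in `δ`.
  obtain ⟨s, hs, hs1, hsδ⟩ : ∃ s : ℝ, 0 < s ∧ s ≤ 1 ∧ s * (‖e‖ + ρ) < δ := by
    have hp : 0 < ‖e‖ + ρ := by positivity
    refine ⟨min 1 (δ / 2 / (‖e‖ + ρ)), by positivity, min_le_left _ _, ?_⟩
    calc min 1 (δ / 2 / (‖e‖ + ρ)) * (‖e‖ + ρ) ≤ δ / 2 / (‖e‖ + ρ) * (‖e‖ + ρ) := by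
          gcongr; exact min_le_right _ _
      _ = δ / 2 := by field_simp
      _ < δ := by linarith
  obtain ⟨k, hk, hkc, hk0, hk1, hkt⟩ := exists_kernel (-(s • e)) (η := ρ * s / 2) (by positivity)
  have hts : ∀ t ∈ tsupport k, ‖t + s • e‖ ≤ ρ * s / 2 := by
    intro t ht
    have h := hkt ht
    rwa [mem_closedBall_iff_norm, sub_neg_eq_add] at h
  have htn : ∀ t ∈ tsupport k, ‖t‖ < δ := by
    intro t ht
    have h1 := hts t ht
    have h2 : ‖t‖ ≤ ‖t + s • e‖ + ‖s • e‖ := by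
      simpa using norm_sub_le (t + s • e) (s • e)
    rw [norm_smul, Real.norm_of_nonneg hs.le] at h2
    nlinarith
  have hsupp : ∀ δ', δ ≤ δ' → Function.support k ⊆ Metric.ball 0 δ' := fun δ' h t ht => by
    rw [mem_ball_zero_iff]
    exact (htn t (subset_tsupport _ ht)).trans_le h
  have hfl : LocallyIntegrable f := hfm.locallyIntegrable (by simp)
  have hGl : LocallyIntegrable G := hGm.locallyIntegrable (by simp)
  have hsδ₃ : s * (‖e‖ + ρ) < δ₃ := hsδ.trans_le ((min_le_right _ _).trans (min_le_right _ _))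
  refine ⟨mollify k f, mollify k G, contDiff_mollify hk hkc hfl, fun y hy =>
    gradient_mollify_eq hρ (fun z hz hzΩ => hcone z hz hzΩ s hs hs1) hs H₃ hsδ₃ hk hkc
      hts hfl hGl hfK hGK hweak hy, ?_, ?_⟩
  · exact H₁ k hk.continuous hkc hk0 hk1 (hsupp _ (min_le_left _ _))
  · exact H₂ k hk.continuous hkc hk0 hk1 (hsupp _ ((min_le_right _ _).trans (min_le_left _ _)))

/-- After extension by zero the pair is still only weakly differentiable inside `Ω`, with a possible
jump across `∂Ω`. That suffices, because the shifted kernels never look across the boundary from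
points of `Ω`. -/
theorem mem_closure_smoothFns_of_support (hΩ : IsOpen Ω) (hb : Bornology.IsBounded Ω)
    {x e : E d} {r ρ : ℝ} (hρ : 0 < ρ)
    (hcone : ∀ z ∈ Metric.ball x r, z ∈ Ω → ∀ s : ℝ, 0 < s → s ≤ 1 →
      Metric.ball (z + s • e) (ρ * s) ⊆ Ω)
    {K : Set (E d)} (hK : IsCompact K) (hKr : K ⊆ Metric.ball x r) {w : H1 Ω}
    (h0 : ∀ᵐ x ∂(volume.restrict Ω), x ∉ K → fn w x = 0)
    (h0' : ∀ᵐ x ∂(volume.restrict Ω), x ∉ K → grad w x = 0) :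
    w ∈ closure (smoothFns Ω : Set (H1 Ω)) := by
  let f : E d → ℝ := (Ω ∩ K).indicator (fn w)
  let G : E d → E d := (Ω ∩ K).indicator (grad w)
  have hΩK : MeasurableSet (Ω ∩ K) := hΩ.measurableSet.inter hK.measurableSet
  have hfm : MemLp f 2 := (memLp_indicator_iff_restrict hΩK).2
    ((Lp.memLp (fn w)).mono_measure (Measure.restrict_mono inter_subset_left le_rfl))
  have hGm : MemLp G 2 := (memLp_indicator_iff_restrict hΩK).2
    ((Lp.memLp (grad w)).mono_measure (Measure.restrict_mono inter_subset_left le_rfl))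
  have hfw : fn w =ᵐ[volume.restrict Ω] f := by
    filter_upwards [h0, ae_restrict_mem hΩ.measurableSet] with y hy hyΩ
    by_cases hyK : y ∈ K
    · simp [f, hyΩ, hyK]
    · simp [f, hyK, hy hyK]
  have hGw : grad w =ᵐ[volume.restrict Ω] G := by
    filter_upwards [h0', ae_restrict_mem hΩ.measurableSet] with y hy hyΩ
    by_cases hyK : y ∈ K
    · simp [G, hyΩ, hyK]
    · simp [G, hyK, hy hyK]
  have hweak : HasWeakFDeriv Ω f fun x => innerSL ℝ (G x) := (hasWeakFDeriv w).congr hfw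
    (by filter_upwards [hGw] with y hy; rw [hy])
  refine mem_closure_of_enorm_sq_le fun ε hε => ?_
  obtain ⟨φ, H, hφ, hφH, h1, h2⟩ := exists_contDiff_approx hρ hcone hK hKr hfm hGm
    (fun y hy => by simp [f, hy]) (fun y hy => by simp [G, hy]) hweak (ε := ε / 2)
    (by simpa using hε)
  obtain ⟨w', hw', hw''⟩ := exists_of_contDiff hb (hφ.of_le (by simp) : ContDiff ℝ 1 φ)
  refine ⟨w', ⟨φ, hφ, hw'⟩, ?_⟩
  have hw3 : grad w' =ᵐ[volume.restrict Ω] H := by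
    filter_upwards [hw'', ae_restrict_mem hΩ.measurableSet] with y hy hyΩ
    rw [hy, hφH y hyΩ]
  refine (enorm_sub_sq_le hw' hw3 hfw hGw).trans ?_
  rw [← ENNReal.add_halves ε]
  exact add_le_add h1 h2

/-- A smooth partition of unity on the compact closure splits a function into finitely many pieces,
each supported where a single cone direction works. -/
theorem closure_smoothFns_eq_univ_of_coneAt (hΩ : IsOpen Ω) (hb : Bornology.IsBounded Ω)
    (hcone : ∀ x ∈ closure Ω, ConeAt Ω x) : closure (smoothFns Ω : Set (H1 Ω)) = univ := by
  refine eq_univ_of_forall fun w => ?_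
  choose! r hr ρ hρ e he using hcone
  obtain ⟨t, htc, ht⟩ := hb.isCompact_closure.elim_nhds_subcover (fun x => Metric.ball x (r x))
    fun x hx => Metric.ball_mem_nhds x (hr x hx)
  obtain ⟨χ, hχ⟩ := SmoothPartitionOfUnity.exists_isSubordinate (modelWithCornersSelf ℝ (E d))
    (isClosed_closure (s := Ω)) (fun i : t => Metric.ball (i : E d) (r i))
    (fun i => Metric.isOpen_ball) (fun y hy => by
      obtain ⟨i, hi, hyi⟩ := mem_iUnion₂.1 (ht hy)
      exact mem_iUnion.2 ⟨⟨i, hi⟩, hyi⟩)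
  have hsm : ∀ i, ContDiff ℝ ∞ (χ i) := fun i => (χ i).contMDiff.contDiff
  have hcs : ∀ i : t, HasCompactSupport (χ i) := fun i =>
    (isCompact_closedBall (i : E d) (r i)).of_isClosed_subset (isClosed_tsupport _)
      ((hχ i).trans Metric.ball_subset_closedBall)
  choose u hu hu' using fun i => exists_mul (hsm i) (hcs i) w
  have hsum : w = ∑ i, u i := by
    refine ext_fn hΩ ?_
    have h1 : fn (∑ i, u i) = ∑ i, fn (u i) := map_sum (fnL Ω) u Finset.univ
    rw [h1]
    filter_upwards [Lp.coeFn_finsetSum Finset.univ (fun i => fn (u i)), ae_all_iff.2 hu,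
      ae_restrict_mem hΩ.measurableSet] with x h2 h3 hx
    have h4 := χ.sum_eq_one (subset_closure hx)
    rw [finsum_eq_sum_of_fintype] at h4
    rw [h2, Finset.sum_apply, Finset.sum_congr rfl fun i _ => h3 i, ← Finset.sum_mul, h4, one_mul]
  rw [← Submodule.topologicalClosure_coe]
  rw [hsum]
  refine Submodule.sum_mem _ fun i _ => ?_
  rw [← SetLike.mem_coe, Submodule.topologicalClosure_coe]
  have hi : (i : E d) ∈ closure Ω := htc i i.2
  refine mem_closure_smoothFns_of_support hΩ hb (hρ i hi) (he i hi) (hcs i) (hχ i) ?_ ?_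
  · filter_upwards [hu i] with x hx hxs
    rw [hx, image_eq_zero_of_notMem_tsupport hxs, zero_mul]
  · filter_upwards [hu' i] with x hx hxs
    have hg : gradient (χ i) x = 0 := by
      rw [← norm_eq_zero, norm_gradient, fderiv_of_notMem_tsupport ℝ hxs, norm_zero]
    rw [hx, image_eq_zero_of_notMem_tsupport hxs, hg, zero_smul, smul_zero, add_zero]

end H1

theorem IsBoundedLipschitzDomain.dense_smoothFns {Ω : Set (E d)}
    (hΩ : IsBoundedLipschitzDomain Ω) (w : H1 Ω) :
    w ∈ closure (H1.smoothFns Ω : Set (H1 Ω)) := by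
  rw [H1.closure_smoothFns_eq_univ_of_coneAt hΩ.isOpen hΩ.isBounded fun x hx => hΩ.coneAt hx]
  exact mem_univ w

/-! ### A Poincaré inequality in oscillation form. -/

/-- The Dirichlet energy of a differentiable function on `Ω`, as an extended nonnegative number. -/
def energy (Ω : Set (E d)) (u : E d → ℝ) : ℝ≥0∞ := ∫⁻ x in Ω, ‖fderiv ℝ u x‖ₑ ^ 2

/-- The fundamental theorem of calculus along a segment, followed by Cauchy–Schwarz. The integral is
taken over the full segment so that the bound does not depend on `t`. -/
theorem enorm_sub_sq_le_lintegral {u : E d → ℝ} (hu : ContDiff ℝ 1 u) (y h : E d) {t : ℝ}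
    (ht : t ∈ Icc (0 : ℝ) 1) : ‖u (y + t • h) - u y‖ₑ ^ 2 ≤
      ‖h‖ₑ ^ 2 * ∫⁻ s in Ioc (0 : ℝ) 1, ‖fderiv ℝ u (y + s • h)‖ₑ ^ 2 := by
  have hd : ∀ s : ℝ, HasDerivAt (fun s : ℝ => u (y + s • h)) (fderiv ℝ u (y + s • h) h) s := by
    intro s
    have h1 : HasDerivAt (fun s : ℝ => y + s • h) h s := by
      simpa using ((hasDerivAt_id s).smul_const h).const_add y
    exact (hu.differentiable one_ne_zero _).hasFDerivAt.comp_hasDerivAt s h1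
  have hc0 : Continuous fun s : ℝ => fderiv ℝ u (y + s • h) :=
    (hu.continuous_fderiv one_ne_zero).comp (by fun_prop)
  have hc : Continuous fun s : ℝ => fderiv ℝ u (y + s • h) h := hc0.clm_apply continuous_const
  have hftc := intervalIntegral.integral_eq_sub_of_hasDerivAt (a := 0) (b := t)
    (fun s _ => hd s) (hc.intervalIntegrable 0 t)
  rw [zero_smul, add_zero, intervalIntegral.integral_of_le ht.1] at hftc
  rw [← hftc]
  have hm : Measurable fun s : ℝ => ‖fderiv ℝ u (y + s • h)‖ₑ := hc0.enorm.measurable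
  calc ‖∫ s in Ioc (0 : ℝ) t, fderiv ℝ u (y + s • h) h‖ₑ ^ 2
      ≤ (∫⁻ s in Ioc (0 : ℝ) 1, ‖h‖ₑ * ‖fderiv ℝ u (y + s • h)‖ₑ) ^ 2 := by
        gcongr
        refine (enorm_integral_le_lintegral_enorm _).trans ?_
        refine (lintegral_mono_set (Ioc_subset_Ioc_right ht.2)).trans (lintegral_mono fun s => ?_)
        rw [mul_comm]
        exact (fderiv ℝ u (y + s • h)).le_opENorm h
    _ = ‖h‖ₑ ^ 2 * (∫⁻ s in Ioc (0 : ℝ) 1, ‖fderiv ℝ u (y + s • h)‖ₑ) ^ 2 := by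
        rw [lintegral_const_mul _ hm, mul_pow]
    _ ≤ _ := by
        gcongr
        refine (sq_lintegral_le _ hm.aemeasurable).trans ?_
        simp

/-- Integrate the segment estimate over `V`, exchange the integrals, and use translation invariance:
each shifted copy of `V` lies in `Ω`. -/
theorem lintegral_translate_sub_le {Ω : Set (E d)} (hΩ : IsOpen Ω) {u : E d → ℝ}
    (hu : ContDiff ℝ 1 u) {V : Set (E d)} (hV : MeasurableSet V) {h : E d}
    (hseg : ∀ y ∈ V, ∀ s : ℝ, 0 < s → s ≤ 1 → y + s • h ∈ Ω) :
    ∫⁻ y in V, ‖u (y + h) - u y‖ₑ ^ 2 ≤ ‖h‖ₑ ^ 2 * energy Ω u := by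
  have hc0 : Continuous fun p : E d × ℝ => fderiv ℝ u (p.1 + p.2 • h) :=
    (hu.continuous_fderiv one_ne_zero).comp (by fun_prop)
  have hc : Measurable (fun p : E d × ℝ => ‖fderiv ℝ u (p.1 + p.2 • h)‖ₑ ^ 2) :=
    hc0.enorm.measurable.pow_const 2
  calc ∫⁻ y in V, ‖u (y + h) - u y‖ₑ ^ 2
      ≤ ∫⁻ y in V, ‖h‖ₑ ^ 2 * ∫⁻ s in Ioc (0 : ℝ) 1, ‖fderiv ℝ u (y + s • h)‖ₑ ^ 2 :=
        lintegral_mono fun y => by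
          simpa using enorm_sub_sq_le_lintegral hu y h (right_mem_Icc.2 zero_le_one)
    _ = ‖h‖ₑ ^ 2 * ∫⁻ s in Ioc (0 : ℝ) 1, ∫⁻ y in V, ‖fderiv ℝ u (y + s • h)‖ₑ ^ 2 := by
        rw [lintegral_const_mul' _ _ (by finiteness), lintegral_lintegral_swap]
        exact hc.aemeasurable
    _ ≤ ‖h‖ₑ ^ 2 * ∫⁻ s in Ioc (0 : ℝ) 1, energy Ω u := by
        refine mul_le_mul_right ?_ _
        refine setLIntegral_mono measurable_const fun s hs => ?_
        calc ∫⁻ y in V, ‖fderiv ℝ u (y + s • h)‖ₑ ^ 2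
            ≤ ∫⁻ y in V, Ω.indicator (fun x => ‖fderiv ℝ u x‖ₑ ^ 2) (y + s • h) := by
              refine setLIntegral_mono' hV fun y hy => ?_
              rw [indicator_of_mem (hseg y hy s hs.1 hs.2)]
          _ ≤ ∫⁻ y, Ω.indicator (fun x => ‖fderiv ℝ u x‖ₑ ^ 2) (y + s • h) :=
              setLIntegral_le_lintegral _ _
          _ = energy Ω u := by
              rw [lintegral_add_right_eq_self, lintegral_indicator hΩ.measurableSet, energy]
    _ = ‖h‖ₑ ^ 2 * energy Ω u := by simp

/-- The oscillation of functions between `V` and `W` is controlled by their energy on `Ω`. -/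
def OscBound (Ω V W : Set (E d)) : Prop :=
  ∃ C : ℝ≥0∞, C ≠ ⊤ ∧ ∀ u : E d → ℝ, ContDiff ℝ 1 u →
    ∫⁻ x in V, ∫⁻ y in W, ‖u x - u y‖ₑ ^ 2 ≤ C * energy Ω u

theorem enorm_sub_sq_le_two (a b c : ℝ) :
    ‖a - c‖ₑ ^ 2 ≤ 2 * ‖a - b‖ₑ ^ 2 + 2 * ‖b - c‖ₑ ^ 2 := by
  have h : ‖a - c‖ ^ 2 ≤ 2 * ‖a - b‖ ^ 2 + 2 * ‖b - c‖ ^ 2 := by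
    simp only [Real.norm_eq_abs, sq_abs]
    nlinarith [sq_nonneg (a - b - (b - c))]
  have h2 : ENNReal.ofReal (‖a - c‖ ^ 2) ≤
      ENNReal.ofReal (2 * ‖a - b‖ ^ 2 + 2 * ‖b - c‖ ^ 2) := ENNReal.ofReal_le_ofReal h
  rw [ENNReal.ofReal_add (by positivity) (by positivity), ENNReal.ofReal_mul (by norm_num),
    ENNReal.ofReal_mul (by norm_num), ENNReal.ofReal_pow (norm_nonneg _),
    ENNReal.ofReal_pow (norm_nonneg _), ENNReal.ofReal_pow (norm_nonneg _)] at h2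
  simpa only [ofReal_norm, ENNReal.ofReal_ofNat] using h2

theorem measurable_osc {u : E d → ℝ} (hu : Continuous u) :
    Measurable fun p : E d × E d => ‖u p.1 - u p.2‖ₑ ^ 2 := by
  have : Continuous fun p : E d × E d => u p.1 - u p.2 := by fun_prop
  exact this.enorm.measurable.pow_const 2

theorem measurable_lintegral_osc {u : E d → ℝ} (hu : Continuous u) (μ : Measure (E d))
    [SFinite μ] : Measurable fun x => ∫⁻ y, ‖u x - u y‖ₑ ^ 2 ∂μ :=
  (measurable_osc hu).lintegral_prod_right'

namespace OscBound

variable {Ω V V' W Z : Set (E d)}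

theorem symm (h : OscBound Ω V W) : OscBound Ω W V := by
  obtain ⟨C, hC, H⟩ := h
  refine ⟨C, hC, fun u hu => ?_⟩
  rw [lintegral_lintegral_swap (measurable_osc hu.continuous).aemeasurable]
  convert H u hu using 6 with x y
  rw [enorm_sub_rev]

theorem mono (h : OscBound Ω V W) (hV : V' ⊆ V) : OscBound Ω V' W := by
  obtain ⟨C, hC, H⟩ := h
  exact ⟨C, hC, fun u hu => (lintegral_mono_set hV).trans (H u hu)⟩

theorem union (h : OscBound Ω V W) (h' : OscBound Ω V' W) : OscBound Ω (V ∪ V') W := by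
  obtain ⟨C, hC, H⟩ := h
  obtain ⟨C', hC', H'⟩ := h'
  refine ⟨C + C', by finiteness, fun u hu => ?_⟩
  rw [add_mul]
  exact (lintegral_union_le _ _ _).trans (add_le_add (H u hu) (H' u hu))

/-- Insert an intermediate value `u y` and average over `y ∈ W`. This needs `W` to have positive
finite measure. -/
theorem trans (h : OscBound Ω V W) (h' : OscBound Ω W Z) (hV : volume V ≠ ⊤) (hZ : volume Z ≠ ⊤)
    (hW : volume W ≠ 0) (hW' : volume W ≠ ⊤) : OscBound Ω V Z := by
  obtain ⟨C, hC, H⟩ := h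
  obtain ⟨C', hC', H'⟩ := h'.symm
  refine ⟨(volume W)⁻¹ * (volume Z * (2 * C) + volume V * (2 * C')), by finiteness,
    fun u hu => ?_⟩
  have hac := measurable_lintegral_osc hu.continuous (volume.restrict W)
  have hpt : ∀ x z, volume W * ‖u x - u z‖ₑ ^ 2 ≤
      2 * (∫⁻ y in W, ‖u x - u y‖ₑ ^ 2) + 2 * ∫⁻ y in W, ‖u z - u y‖ₑ ^ 2 := by
    intro x z
    have m1 : ∀ x, Measurable fun y => ‖u x - u y‖ₑ ^ 2 := fun x =>
      (continuous_const.sub hu.continuous).enorm.measurable.pow_const 2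
    rw [← lintegral_const_mul _ (m1 x), ← lintegral_const_mul _ (m1 z),
      ← lintegral_add_left ((m1 x).const_mul 2), mul_comm, ← setLIntegral_const]
    refine lintegral_mono fun y => ?_
    rw [enorm_sub_rev (u z)]
    exact enorm_sub_sq_le_two _ _ _
  have key : volume W * ∫⁻ x in V, ∫⁻ z in Z, ‖u x - u z‖ₑ ^ 2 ≤
      (volume Z * (2 * C) + volume V * (2 * C')) * energy Ω u := by
    calc volume W * ∫⁻ x in V, ∫⁻ z in Z, ‖u x - u z‖ₑ ^ 2
        = ∫⁻ x in V, ∫⁻ z in Z, volume W * ‖u x - u z‖ₑ ^ 2 := by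
          simp_rw [lintegral_const_mul' _ _ hW']
      _ ≤ ∫⁻ x in V, ∫⁻ z in Z, (2 * (∫⁻ y in W, ‖u x - u y‖ₑ ^ 2) +
            2 * ∫⁻ y in W, ‖u z - u y‖ₑ ^ 2) :=
          lintegral_mono fun x => lintegral_mono fun z => hpt x z
      _ = (∫⁻ x in V, 2 * (∫⁻ y in W, ‖u x - u y‖ₑ ^ 2)) * volume Z +
            (∫⁻ z in Z, 2 * ∫⁻ y in W, ‖u z - u y‖ₑ ^ 2) * volume V := by
          simp_rw [lintegral_add_left measurable_const, setLIntegral_const]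
          rw [lintegral_add_left ((hac.const_mul 2).mul_const _), setLIntegral_const,
            lintegral_mul_const _ (hac.const_mul 2)]
      _ ≤ (2 * (C * energy Ω u)) * volume Z + (2 * (C' * energy Ω u)) * volume V := by
          simp_rw [lintegral_const_mul' _ _ ENNReal.ofNat_ne_top]
          gcongr
          · exact H u hu
          · exact H' u hu
      _ = _ := by ring
  rw [mul_assoc, ← ENNReal.div_eq_inv_mul, ENNReal.le_div_iff_mul_le (Or.inl hW) (Or.inl hW'),
    mul_comm]
  exact key

/-- Substitute `y = x + h`. For fixed `h` the segment from `x` to `x + h` stays in the ball by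
convexity, so the translation estimate applies; only `‖h‖ < 2 r` contributes. -/
theorem ball (hΩ : IsOpen Ω) {c : E d} {r : ℝ} (hr : Metric.ball c r ⊆ Ω) :
    OscBound Ω (Metric.ball c r) (Metric.ball c r) := by
  set B := Metric.ball c r with hB
  have hBm : MeasurableSet B := measurableSet_ball
  refine ⟨∫⁻ h in Metric.ball (0 : E d) (2 * r), ENNReal.ofReal (2 * r) ^ 2, ?_, fun u hu => ?_⟩
  · rw [setLIntegral_const]
    exact ENNReal.mul_ne_top (by finiteness) (measure_ball_lt_top (μ := volume)).ne
  have hm : Measurable fun p : E d × E d =>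
      B.indicator (fun _ => (1 : ℝ≥0∞)) (p.1 + p.2) * ‖u (p.1 + p.2) - u p.1‖ₑ ^ 2 := by
    refine ((measurable_const.indicator hBm).comp (measurable_fst.add measurable_snd)).mul ?_
    have hc : Continuous fun p : E d × E d => u (p.1 + p.2) - u p.1 :=
      (hu.continuous.comp (by fun_prop)).sub (hu.continuous.comp (by fun_prop))
    exact hc.enorm.measurable.pow_const 2
  calc ∫⁻ x in B, ∫⁻ y in B, ‖u x - u y‖ₑ ^ 2
      = ∫⁻ x in B, ∫⁻ h, B.indicator (fun _ => (1 : ℝ≥0∞)) (x + h) * ‖u (x + h) - u x‖ₑ ^ 2 := by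
        refine lintegral_congr fun x => ?_
        rw [← lintegral_indicator hBm, ← lintegral_add_left_eq_self _ x]
        refine lintegral_congr fun h => ?_
        by_cases hh : x + h ∈ B
        · simp [hh, enorm_sub_rev (u x)]
        · simp [hh]
    _ = ∫⁻ h, ∫⁻ x in B, B.indicator (fun _ => (1 : ℝ≥0∞)) (x + h) * ‖u (x + h) - u x‖ₑ ^ 2 :=
        lintegral_lintegral_swap hm.aemeasurable
    _ ≤ ∫⁻ h, (Metric.ball (0 : E d) (2 * r)).indicator
          (fun _ => ENNReal.ofReal (2 * r) ^ 2 * energy Ω u) h := by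
        refine lintegral_mono fun h => ?_
        by_cases hh : h ∈ Metric.ball (0 : E d) (2 * r)
        · rw [indicator_of_mem hh]
          have hVm : MeasurableSet (B ∩ (fun x => x + h) ⁻¹' B) :=
            hBm.inter (measurable_id.add_const h hBm)
          calc ∫⁻ x in B, B.indicator (fun _ => (1 : ℝ≥0∞)) (x + h) * ‖u (x + h) - u x‖ₑ ^ 2
              = ∫⁻ x in B ∩ (fun x => x + h) ⁻¹' B, ‖u (x + h) - u x‖ₑ ^ 2 := by
                rw [← lintegral_indicator hBm, ← lintegral_indicator hVm]
                refine lintegral_congr fun x => ?_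
                by_cases h1 : x ∈ B <;> by_cases h2 : x + h ∈ B <;> simp [h1, h2]
            _ ≤ ‖h‖ₑ ^ 2 * energy Ω u := by
                refine lintegral_translate_sub_le hΩ hu hVm fun y hy s hs hs1 => hr ?_
                have hconv := (convex_ball c r) hy.1 hy.2 (sub_nonneg.2 hs1) hs.le (by ring)
                convert hconv using 1
                module
            _ ≤ _ := by
                gcongr
                rw [← ofReal_norm]
                exact ENNReal.ofReal_le_ofReal (by simpa using (mem_ball_zero_iff.1 hh).le)
        · rw [indicator_of_notMem hh]
          refine le_of_eq (setLIntegral_eq_zero hBm fun x hx => ?_)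
          have : x + h ∉ B := by
            intro hx'
            apply hh
            rw [mem_ball_zero_iff]
            have h1 := mem_ball_iff_norm.1 hx
            have h2 := mem_ball_iff_norm.1 hx'
            have h3 : ‖h‖ ≤ ‖x + h - c‖ + ‖x - c‖ := by
              simpa using norm_sub_le (x + h - c) (x - c)
            linarith
          simp [this]
    _ = _ := by
        rw [lintegral_indicator measurableSet_ball, lintegral_mul_const _ measurable_const]

/-- Compare `u x` with `u (x + e)` by the translation estimate, then use the bound already known at
the translated point. This transfers control from the interior up to the boundary. -/
theorem translate (hΩ : IsOpen Ω) (hV : MeasurableSet V) {e : E d}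
    (hseg : ∀ y ∈ V, ∀ s : ℝ, 0 < s → s ≤ 1 → y + s • e ∈ Ω) (hV' : MeasurableSet V')
    (hVV' : ∀ y ∈ V, y + e ∈ V') (hW : volume W ≠ ⊤) (h : OscBound Ω V' W) :
    OscBound Ω V W := by
  obtain ⟨C, hC, H⟩ := h
  refine ⟨volume W * (2 * ‖e‖ₑ ^ 2) + 2 * C, by finiteness, fun u hu => ?_⟩
  have hac := measurable_lintegral_osc hu.continuous (volume.restrict W)
  have hm1 : Measurable fun x => ‖u (x + e) - u x‖ₑ ^ 2 :=
    ((hu.continuous.comp (continuous_add_const e)).sub hu.continuous).enorm.measurable.pow_const 2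
  calc ∫⁻ x in V, ∫⁻ y in W, ‖u x - u y‖ₑ ^ 2
      ≤ ∫⁻ x in V, ∫⁻ y in W, (2 * ‖u (x + e) - u x‖ₑ ^ 2 + 2 * ‖u (x + e) - u y‖ₑ ^ 2) := by
        refine lintegral_mono fun x => lintegral_mono fun y => ?_
        rw [enorm_sub_rev (u (x + e)) (u x)]
        exact enorm_sub_sq_le_two _ _ _
    _ = (∫⁻ x in V, 2 * ‖u (x + e) - u x‖ₑ ^ 2) * volume W +
          2 * ∫⁻ x in V, ∫⁻ y in W, ‖u (x + e) - u y‖ₑ ^ 2 := by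
        simp_rw [lintegral_add_left measurable_const, setLIntegral_const]
        rw [lintegral_add_left ((hm1.const_mul 2).mul_const _),
          lintegral_mul_const _ (hm1.const_mul 2)]
        simp_rw [lintegral_const_mul' _ _ ENNReal.ofNat_ne_top]
    _ ≤ (2 * (‖e‖ₑ ^ 2 * energy Ω u)) * volume W + 2 * (C * energy Ω u) := by
        rw [lintegral_const_mul' _ _ ENNReal.ofNat_ne_top]
        gcongr
        · exact lintegral_translate_sub_le hΩ hu hV hseg
        · refine le_trans ?_ (H u hu)
          rw [← lintegral_indicator hV', ← lintegral_indicator hV,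
            ← lintegral_add_right_eq_self (V'.indicator _) e]
          refine lintegral_mono fun x => ?_
          by_cases hx : x ∈ V
          · rw [indicator_of_mem hx, indicator_of_mem (hVV' x hx)]
          · rw [indicator_of_notMem hx]; exact bot_le
    _ = _ := by ring

end OscBound

/-- A form of the Poincaré inequality: on a bounded domain satisfying the cone condition the mean
square oscillation of a function is controlled by its energy. -/
theorem oscBound_of_coneAt {Ω : Set (E d)} (hΩ : IsOpen Ω) (hconn : IsConnected Ω)
    (hb : Bornology.IsBounded Ω) (hcone : ∀ x ∈ closure Ω, ConeAt Ω x) : OscBound Ω Ω Ω := by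
  obtain ⟨x₀, hx₀⟩ := hconn.nonempty
  obtain ⟨r₀, hr₀, hB⟩ := Metric.isOpen_iff.1 hΩ x₀ hx₀
  set B := Metric.ball x₀ r₀ with hBdef
  have hB0 : volume B ≠ 0 := (Metric.measure_ball_pos volume x₀ hr₀).ne'
  have hBt : volume B ≠ ⊤ := measure_ball_lt_top.ne
  have hΩt : ∀ s : Set (E d), volume (s ∩ Ω) ≠ ⊤ := fun s =>
    (hb.subset inter_subset_right).measure_lt_top.ne
  -- Everything is compared with one fixed ball `B`. Chaining through overlapping balls makes this
  -- local property relatively open and closed in `Ω`, hence true throughout `Ω` by connectedness.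
  let P : E d → Prop := fun x => ∃ r > 0, OscBound Ω (Metric.ball x r ∩ Ω) B
  have hloc : ∀ x ∈ Ω, ∃ r > 0, Metric.ball x r ⊆ Ω ∧
      ∀ y ∈ Metric.ball x r, P y → ∀ z ∈ Metric.ball x r, P z := by
    intro x hx
    obtain ⟨r, hr, hrΩ⟩ := Metric.isOpen_iff.1 hΩ x hx
    refine ⟨r, hr, hrΩ, fun y hy ⟨ρ, hρ, hosc⟩ z hz => ?_⟩
    set S := Metric.ball y ρ ∩ Metric.ball x r with hS
    have hSo : IsOpen S := Metric.isOpen_ball.inter Metric.isOpen_ball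
    have hS0 : volume S ≠ 0 :=
      (hSo.measure_pos volume ⟨y, Metric.mem_ball_self hρ, hy⟩).ne'
    have hSt : volume S ≠ ⊤ :=
      ((measure_mono inter_subset_left).trans_lt measure_ball_lt_top).ne
    have h1 : OscBound Ω (Metric.ball x r) S :=
      ((OscBound.ball hΩ hrΩ).mono inter_subset_right).symm
    have h2 : OscBound Ω S B :=
      hosc.mono (inter_subset_inter_right _ hrΩ)
    have h3 := h1.trans h2 measure_ball_lt_top.ne hBt hS0 hSt
    obtain ⟨r', hr', hsub⟩ := Metric.isOpen_iff.1 Metric.isOpen_ball z hz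
    exact ⟨r', hr', h3.mono (inter_subset_left.trans hsub)⟩
  have hP : ∀ x ∈ Ω, P x := by
    have hsub : Ω ⊆ {x | x ∈ Ω ∧ P x} := by
      refine hconn.isPreconnected.subset_left_of_subset_union (v := {x | x ∈ Ω ∧ ¬ P x}) ?_ ?_ ?_
        ?_ ?_
      · refine Metric.isOpen_iff.2 fun x ⟨hx, hPx⟩ => ?_
        obtain ⟨r, hr, hrΩ, h⟩ := hloc x hx
        exact ⟨r, hr, fun y hy => ⟨hrΩ hy, h x (Metric.mem_ball_self hr) hPx y hy⟩⟩
      · refine Metric.isOpen_iff.2 fun x ⟨hx, hPx⟩ => ?_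
        obtain ⟨r, hr, hrΩ, h⟩ := hloc x hx
        exact ⟨r, hr, fun y hy => ⟨hrΩ hy, fun hPy => hPx (h y hy hPy x (Metric.mem_ball_self hr))⟩⟩
      · exact Set.disjoint_left.2 fun x h1 h2 => h2.2 h1.2
      · intro x hx
        by_cases h : P x
        · exact Or.inl ⟨hx, h⟩
        · exact Or.inr ⟨hx, h⟩
      · exact ⟨x₀, hx₀, hx₀, r₀, hr₀, (OscBound.ball hΩ hB).mono inter_subset_left⟩
    exact fun x hx => (hsub hx).2
  have hcompact : ∀ L : Set (E d), IsCompact L → (∀ x ∈ L, P x) →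
      ∃ V, IsOpen V ∧ L ⊆ V ∧ OscBound Ω (V ∩ Ω) B := by
    intro L hL hPL
    refine hL.induction_on (p := fun s => ∃ V, IsOpen V ∧ s ⊆ V ∧ OscBound Ω (V ∩ Ω) B)
      ⟨∅, isOpen_empty, subset_rfl, 0, by simp, fun u _ => by simp⟩ ?_ ?_ ?_
    · rintro s t hst ⟨V, hV, htV, h⟩
      exact ⟨V, hV, hst.trans htV, h⟩
    · rintro s t ⟨V, hV, hs, h⟩ ⟨V', hV', hs', h'⟩
      exact ⟨V ∪ V', hV.union hV', union_subset_union hs hs', by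
        rw [union_inter_distrib_right]; exact h.union h'⟩
    · intro x hx
      obtain ⟨r, hr, h⟩ := hPL x hx
      exact ⟨Metric.ball x r, mem_nhdsWithin_of_mem_nhds (Metric.ball_mem_nhds x hr),
        Metric.ball x r, Metric.isOpen_ball, subset_rfl, h⟩
  have hPc : ∀ x ∈ closure Ω, P x := by
    intro x hx
    obtain ⟨r, hr, ρ, hρ, e, he⟩ := hcone x hx
    -- The full translation, `s = 1`, keeps distance `ρ` from the complement of `Ω`, so the closure
    -- is a compact subset of `Ω`, where the interior case applies.
    set L := closure ((fun z => z + e) '' (Metric.ball x r ∩ Ω)) with hL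
    have hLc : IsCompact L := by
      refine Metric.isCompact_of_isClosed_isBounded isClosed_closure ?_
      refine Bornology.IsBounded.closure ?_
      have h1 : Bornology.IsBounded (Metric.ball x r ∩ Ω) := hb.subset inter_subset_right
      exact (LipschitzWith.id.add (LipschitzWith.const e)).isBounded_image h1
    have hLΩ : L ⊆ Ω := by
      intro y hy
      obtain ⟨_, ⟨z, ⟨hz, hzΩ⟩, rfl⟩, hyz⟩ := Metric.mem_closure_iff.1 hy ρ hρ
      refine he z hz hzΩ 1 one_pos le_rfl ?_
      rwa [one_smul, mul_one, Metric.mem_ball]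
    obtain ⟨V, hV, hLV, hosc⟩ := hcompact L hLc fun y hy => hP y (hLΩ hy)
    refine ⟨r, hr, OscBound.translate hΩ (measurableSet_ball.inter hΩ.measurableSet) (e := e) ?_
      (hV.measurableSet.inter hΩ.measurableSet) ?_ hBt hosc⟩
    · intro y hy s hs hs1
      exact he y hy.1 hy.2 s hs hs1 (Metric.mem_ball_self (by positivity))
    · intro y hy
      have : y + e ∈ L := subset_closure ⟨y, hy, rfl⟩
      exact ⟨hLV this, hLΩ this⟩
  obtain ⟨V, hV, hΩV, hosc⟩ := hcompact (closure Ω) hb.isCompact_closure hPc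
  have h1 : OscBound Ω Ω B := hosc.mono (subset_inter (subset_closure.trans hΩV) subset_rfl)
  exact h1.trans h1.symm hb.measure_lt_top.ne hb.measure_lt_top.ne hB0 hBt

/-! ### Boundary graphs, surface measure and the trace inequality. -/

/-- The hyperplane orthogonal to `ν`. -/
abbrev Hyp (ν : E d) : Submodule ℝ (E d) := (Submodule.span ℝ {ν})ᗮ

theorem inner_hyp {ν : E d} (h : Hyp ν) : ⟪ν, (h : E d)⟫ = 0 :=
  Submodule.mem_orthogonal_singleton_iff_inner_right.1 h.2

theorem finrank_hyp {ν : E d} (hν : ‖ν‖ = 1) : Module.finrank ℝ (Hyp ν) = d - 1 := by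
  have h1 := Submodule.finrank_add_finrank_orthogonal (Submodule.span ℝ {ν})
  rw [finrank_span_singleton (by rintro rfl; simp at hν), finrank_euclideanSpace_fin] at h1
  change Module.finrank ℝ ((Submodule.span ℝ {ν})ᗮ : Submodule ℝ (E d)) = d - 1
  omega

/-- The coordinates `(h, τ) ↦ h + τ a ν` of `ℝ^d` adapted to a unit vector `ν`. -/
def slabEquiv {ν : E d} (hν : ‖ν‖ = 1) {a : ℝ} (ha : a ≠ 0) : (Hyp ν × ℝ) ≃L[ℝ] E d :=
  LinearEquiv.toContinuousLinearEquiv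
    { toFun := fun p => (p.1 : E d) + p.2 • a • ν
      map_add' := fun p q => by simp only [Prod.fst_add, Prod.snd_add, Submodule.coe_add]; module
      map_smul' := fun c p => by
        simp only [Prod.smul_fst, Prod.smul_snd, Submodule.coe_smul, RingHom.id_apply,
          smul_eq_mul]
        module
      invFun := fun y => (⟨y - ⟪ν, y⟫ • ν, by
        rw [Submodule.mem_orthogonal_singleton_iff_inner_right, inner_sub_right,
          real_inner_smul_right, real_inner_self_eq_norm_sq, hν]; ring⟩, a⁻¹ * ⟪ν, y⟫)
      left_inv := fun p => by
        have h1 : ⟪ν, (p.1 : E d) + p.2 • a • ν⟫ = p.2 * a := by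
          rw [inner_add_right, inner_hyp, real_inner_smul_right, real_inner_smul_right,
            real_inner_self_eq_norm_sq, hν]; ring
        refine Prod.ext (Subtype.ext ?_) ?_
        · simp only [h1]; module
        · simp only [h1]; field_simp
      right_inv := fun y => by
        simp only [smul_smul]
        rw [mul_comm a⁻¹, mul_assoc, inv_mul_cancel₀ ha, mul_one, sub_add_cancel] }

/-- Cavalieri's principle, up to a constant. -/
theorem exists_lintegral_slab_eq {ν : E d} (hν : ‖ν‖ = 1) {a : ℝ} (ha : a ≠ 0) :
    ∃ c : ℝ≥0, ∀ G : E d → ℝ≥0∞, Measurable G →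
      ∫⁻ h : Hyp ν, (∫⁻ τ : ℝ, G ((h : E d) + τ • a • ν)) ∂μHE[d - 1] = c * ∫⁻ x, G x := by
  have hn := finrank_hyp hν
  have hH : (μHE[d - 1] : Measure (Hyp ν)).IsAddHaarMeasure := by
    rw [← hn]; infer_instance
  let μ : Measure (Hyp ν × ℝ) := (μHE[d - 1] : Measure (Hyp ν)).prod volume
  -- A linear image of the product measure is a Haar measure, hence a multiple of Lebesgue measure;
  -- only the finiteness of the factor matters.
  have hμ : (μ.map (slabEquiv hν ha)).IsAddHaarMeasure :=
    (slabEquiv hν ha).isAddHaarMeasure_map μ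
  refine ⟨(μ.map (slabEquiv hν ha)).addHaarScalarFactor volume, fun G hG => ?_⟩
  have hsm := Measure.isAddLeftInvariant_eq_smul (μ.map (slabEquiv hν ha)) volume
  have h1 : ∫⁻ x, G x ∂(μ.map (slabEquiv hν ha)) =
      ∫⁻ h : Hyp ν, (∫⁻ τ : ℝ, G ((h : E d) + τ • a • ν)) ∂μHE[d - 1] := by
    rw [lintegral_map hG (slabEquiv hν ha).continuous.measurable]
    exact lintegral_prod (μ := (μHE[d - 1] : Measure (Hyp ν))) (ν := volume) _
      (hG.comp (slabEquiv hν ha).continuous.measurable).aemeasurable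
  rw [← h1]
  generalize (μ.map (slabEquiv hν ha)).addHaarScalarFactor volume = c at hsm ⊢
  rw [hsm, lintegral_smul_measure]
  rfl

theorem euclideanHausdorffMeasure_image_le {X Y : Type*} [EMetricSpace X] [EMetricSpace Y]
    [MeasurableSpace X] [BorelSpace X] [MeasurableSpace Y] [BorelSpace Y] {K : ℝ≥0} {f : X → Y}
    (hf : LipschitzWith K f) (n : ℕ) (s : Set X) :
    μHE[n] (f '' s) ≤ (K : ℝ≥0∞) ^ n * μHE[n] s := by
  rw [Measure.euclideanHausdorffMeasure_def, Measure.euclideanHausdorffMeasure_def,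
    Measure.smul_apply, Measure.smul_apply, mul_smul_comm]
  gcongr
  simpa using hf.hausdorffMeasure_image_le (d := n) (by positivity) s

section Graph

variable {Ω : Set (E d)} {x ν : E d} {r : ℝ} {K : ℝ≥0} {ψ : E d → ℝ}

/-- The graph parametrization of the boundary over the hyperplane. -/
def graphMap (ν : E d) (ψ : E d → ℝ) (h : Hyp ν) : E d := (h : E d) + ψ h • ν

theorem lipschitzWith_graphMap (hν : ‖ν‖ = 1) (hψ : LipschitzWith K ψ) :
    LipschitzWith (1 + K) (graphMap ν ψ) := by
  refine LipschitzWith.of_dist_le_mul fun h h' => ?_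
  have h1 := hψ.dist_le_mul (h : E d) h'
  rw [Real.dist_eq] at h1
  calc dist (graphMap ν ψ h) (graphMap ν ψ h')
      = ‖((h : E d) - h') + (ψ h - ψ h') • ν‖ := by
        rw [dist_eq_norm, graphMap, graphMap]; congr 1; module
    _ ≤ ‖(h : E d) - h'‖ + |ψ h - ψ h'| := by
        refine (norm_add_le _ _).trans ?_
        rw [norm_smul, hν, mul_one, Real.norm_eq_abs]
    _ ≤ dist h h' + K * dist h h' := by
        rw [← dist_eq_norm]
        exact add_le_add le_rfl h1
    _ = _ := by push_cast; ring

/-- A frontier point is outside `Ω`, so not above the graph, and is a limit of points above it.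
Conversely, pushing a graph point slightly along `ν` enters `Ω`. -/
theorem mem_frontier_iff_of_graph (hΩ : IsOpen Ω) (hν : ‖ν‖ = 1) (hψ : LipschitzWith K ψ)
    (h : ∀ y ∈ Metric.ball x r, (y ∈ Ω ↔ ψ (y - ⟪ν, y⟫ • ν) < ⟪ν, y⟫)) {y : E d}
    (hy : y ∈ Metric.ball x r) : y ∈ frontier Ω ↔ ψ (y - ⟪ν, y⟫ • ν) = ⟪ν, y⟫ := by
  rw [hΩ.frontier_eq, Set.mem_sdiff, h y hy, not_lt]
  have hc : Continuous fun z : E d => ⟪ν, z⟫ - ψ (z - ⟪ν, z⟫ • ν) := by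
    have := hψ.continuous
    fun_prop
  constructor
  · rintro ⟨h1, h2⟩
    refine le_antisymm ?_ h2
    have h3 : y ∈ closure (Metric.ball x r ∩ Ω) :=
      Metric.isOpen_ball.inter_closure ⟨hy, h1⟩
    have h4 : closure (Metric.ball x r ∩ Ω) ⊆ {z | 0 ≤ ⟪ν, z⟫ - ψ (z - ⟪ν, z⟫ • ν)} :=
      closure_minimal (fun z hz => sub_nonneg.2 ((h z hz.1).1 hz.2).le)
        (isClosed_le continuous_const hc)
    exact sub_nonneg.1 (h4 h3)
  · intro h1
    refine ⟨?_, h1.ge⟩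
    have hcont : Continuous fun s : ℝ => y + s • ν := by fun_prop
    have ht : Tendsto (fun s : ℝ => y + s • ν) (𝓝[>] 0) (𝓝 y) := by
      have := (hcont.tendsto 0).mono_left (nhdsWithin_le_nhds (s := Ioi 0))
      simpa using this
    refine mem_closure_of_tendsto ht ?_
    filter_upwards [ht (Metric.isOpen_ball.mem_nhds hy), self_mem_nhdsWithin] with s hs hs0
    rw [h _ hs]
    have e1 : ⟪ν, y + s • ν⟫ = ⟪ν, y⟫ + s := by
      rw [inner_add_right, real_inner_smul_right, real_inner_self_eq_norm_sq, hν]; ring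
    have e2 : y + s • ν - ⟪ν, y + s • ν⟫ • ν = y - ⟪ν, y⟫ • ν := by rw [e1]; module
    rw [e2, e1, h1]
    exact lt_add_of_pos_right _ hs0

theorem graphMap_proj (hν : ‖ν‖ = 1) {y : E d} (hy : ψ (y - ⟪ν, y⟫ • ν) = ⟪ν, y⟫) :
    ∃ h : Hyp ν, graphMap ν ψ h = y := by
  refine ⟨⟨y - ⟪ν, y⟫ • ν, ?_⟩, ?_⟩
  · rw [Submodule.mem_orthogonal_singleton_iff_inner_right, inner_sub_right,
      real_inner_smul_right, real_inner_self_eq_norm_sq, hν]; ring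
  · rw [graphMap, hy, sub_add_cancel]

theorem inner_graphMap (hν : ‖ν‖ = 1) (h : Hyp ν) : ⟪ν, graphMap ν ψ h⟫ = ψ h := by
  rw [graphMap, inner_add_right, inner_hyp, real_inner_smul_right, real_inner_self_eq_norm_sq, hν]
  ring

theorem graphMap_sub (hν : ‖ν‖ = 1) (h : Hyp ν) :
    graphMap ν ψ h - ⟪ν, graphMap ν ψ h⟫ • ν = h := by
  rw [inner_graphMap hν, graphMap, add_sub_cancel_right]

/-- Integrals over a collar above a piece of the boundary are controlled by integrals over `Ω`. -/
theorem exists_lintegral_collar_le (hΩ : IsOpen Ω) (hν : ‖ν‖ = 1) (hr : 0 < r)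
    (hψ : LipschitzWith K ψ)
    (h : ∀ y ∈ Metric.ball x r, (y ∈ Ω ↔ ψ (y - ⟪ν, y⟫ • ν) < ⟪ν, y⟫)) :
    ∃ C : ℝ≥0∞, C ≠ ⊤ ∧ ∀ G : E d → ℝ≥0∞, Measurable G →
      ∫⁻ y in Metric.ball x (r / 2) ∩ frontier Ω, (∫⁻ s in Ioc (0 : ℝ) 1, G (y + s • (r / 2) • ν))
        ∂μHE[d - 1] ≤ C * ∫⁻ y in Ω, G y := by
  have ha : r / 2 ≠ 0 := by positivity
  obtain ⟨c, hc⟩ := exists_lintegral_slab_eq hν ha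
  refine ⟨((1 + K : ℝ≥0) : ℝ≥0∞) ^ (d - 1) * c, by finiteness, fun G hG => ?_⟩
  set p := graphMap ν ψ with hp
  have hpl := lipschitzWith_graphMap hν hψ
  have hpm : Measurable p := hpl.continuous.measurable
  set N := Metric.ball x (r / 2) with hN
  have hNm : MeasurableSet N := measurableSet_ball
  let μ : Measure (Hyp ν) := (μHE[d - 1]).restrict (p ⁻¹' N)
  -- The boundary piece lies in the image of the hyperplane under the `(1 + K)`-Lipschitz graph map,
  -- which enlarges `(d - 1)`-dimensional measure by at most the factor `(1 + K)^(d - 1)`.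
  have hle : (μHE[d - 1] : Measure (E d)).restrict (N ∩ frontier Ω) ≤
      ((1 + K : ℝ≥0) : ℝ≥0∞) ^ (d - 1) • μ.map p := by
    refine Measure.le_iff.2 fun B hB => ?_
    rw [Measure.restrict_apply hB, Measure.smul_apply, Measure.map_apply hpm hB,
      Measure.restrict_apply (hpm hB), smul_eq_mul]
    refine (measure_mono ?_).trans (euclideanHausdorffMeasure_image_le hpl (d - 1) _)
    rintro y ⟨hyB, hyN, hyf⟩
    have hyr : y ∈ Metric.ball x r := Metric.ball_subset_ball (by linarith) hyN
    obtain ⟨h', rfl⟩ := graphMap_proj hν ((mem_frontier_iff_of_graph hΩ hν hψ h hyr).1 hyf)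
    exact ⟨h', ⟨hyB, hyN⟩, rfl⟩
  have hGm : Measurable fun y : E d => ∫⁻ s in Ioc (0 : ℝ) 1, G (y + s • (r / 2) • ν) := by
    have h1 : Measurable fun q : E d × ℝ => G (q.1 + q.2 • (r / 2) • ν) :=
      hG.comp (Continuous.measurable (by fun_prop))
    exact h1.lintegral_prod_right'
  have hin : ∀ h' : Hyp ν, p h' ∈ N → ∀ s ∈ Ioc (0 : ℝ) 1, p h' + s • (r / 2) • ν ∈ Ω := by
    intro h' hh' s hs
    have hb : p h' + s • (r / 2) • ν ∈ Metric.ball x r := by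
      rw [mem_ball_iff_norm] at hh' ⊢
      have e1 : p h' + s • (r / 2) • ν - x = (p h' - x) + s • (r / 2) • ν := by abel
      rw [e1]
      refine (norm_add_le _ _).trans_lt ?_
      rw [norm_smul, norm_smul, hν, Real.norm_of_nonneg hs.1.le,
        Real.norm_of_nonneg (by positivity)]
      nlinarith [hs.2]
    rw [h _ hb]
    have e1 : ⟪ν, p h' + s • (r / 2) • ν⟫ = ψ h' + s * (r / 2) := by
      rw [inner_add_right, hp, inner_graphMap hν, real_inner_smul_right, real_inner_smul_right,
        real_inner_self_eq_norm_sq, hν]; ring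
    have e2 : p h' + s • (r / 2) • ν - ⟪ν, p h' + s • (r / 2) • ν⟫ • ν = h' := by
      rw [e1, hp, graphMap]; module
    rw [e2, e1]
    have := hs.1
    exact lt_add_of_pos_right _ (by positivity)
  calc ∫⁻ y in N ∩ frontier Ω, (∫⁻ s in Ioc (0 : ℝ) 1, G (y + s • (r / 2) • ν)) ∂μHE[d - 1]
      ≤ ((1 + K : ℝ≥0) : ℝ≥0∞) ^ (d - 1) *
          ∫⁻ h', (∫⁻ s in Ioc (0 : ℝ) 1, G (p h' + s • (r / 2) • ν)) ∂μ := by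
        rw [← lintegral_map hGm hpm, ← smul_eq_mul, ← lintegral_smul_measure]
        exact lintegral_mono' hle le_rfl
    _ ≤ ((1 + K : ℝ≥0) : ℝ≥0∞) ^ (d - 1) * (c * ∫⁻ y in Ω, G y) := by
        gcongr
        rw [← lintegral_indicator hΩ.measurableSet, ← hc _ (hG.indicator hΩ.measurableSet)]
        refine (setLIntegral_mono' (hpm hNm) fun h' hh' => ?_).trans
          (setLIntegral_le_lintegral _ _)
        calc ∫⁻ s in Ioc (0 : ℝ) 1, G (p h' + s • (r / 2) • ν)
            ≤ ∫⁻ s in Ioc (0 : ℝ) 1, Ω.indicator G (p h' + s • (r / 2) • ν) :=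
              setLIntegral_mono' measurableSet_Ioc fun s hs => by
                rw [indicator_of_mem (hin h' hh' s hs)]
          _ ≤ ∫⁻ s, Ω.indicator G (p h' + s • (r / 2) • ν) := setLIntegral_le_lintegral _ _
          -- Over each base point the height `ψ h'` is only a translation of the vertical variable,
          -- so the collar integral becomes one in flat slab coordinates.
          _ = ∫⁻ s, Ω.indicator G ((h' : E d) + (s + (r / 2)⁻¹ * ψ h') • (r / 2) • ν) := by
              refine lintegral_congr fun s => ?_
              congr 1
              rw [hp, graphMap, add_smul, smul_smul ((r / 2)⁻¹ * ψ h'), mul_assoc, mul_comm (ψ _),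
                inv_mul_cancel_left₀ ha]
              abel
          _ = ∫⁻ s, Ω.indicator G ((h' : E d) + s • (r / 2) • ν) :=
              lintegral_add_right_eq_self
                (fun s : ℝ => Ω.indicator G ((h' : E d) + s • (r / 2) • ν)) _
    _ = _ := by rw [mul_assoc]

/-- The boundary has positive measure near each of its points. -/
theorem frontier_measure_pos (hΩ : IsOpen Ω) (hν : ‖ν‖ = 1) (hψ : LipschitzWith K ψ)
    (h : ∀ y ∈ Metric.ball x r, (y ∈ Ω ↔ ψ (y - ⟪ν, y⟫ • ν) < ⟪ν, y⟫)) (hr : 0 < r)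
    (hx : x ∈ frontier Ω) : μHE[d - 1] (frontier Ω) ≠ 0 := by
  intro h0
  have hn := finrank_hyp hν
  have hH : (μHE[d - 1] : Measure (Hyp ν)).IsAddHaarMeasure := by
    rw [← hn]; infer_instance
  obtain ⟨h₀, hh₀⟩ := graphMap_proj hν
    ((mem_frontier_iff_of_graph hΩ hν hψ h (Metric.mem_ball_self hr)).1 hx)
  have hopen : IsOpen (graphMap ν ψ ⁻¹' Metric.ball x r) :=
    Metric.isOpen_ball.preimage (lipschitzWith_graphMap hν hψ).continuous
  have hpos := hopen.measure_pos (μHE[d - 1] : Measure (Hyp ν)) ⟨h₀, by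
    rw [mem_preimage, hh₀]; exact Metric.mem_ball_self hr⟩
  -- Projection to the hyperplane is `1`-Lipschitz and undoes the graph map. A null boundary would
  -- thus make a nonempty open set of the hyperplane null.
  let π : E d → Hyp ν := (Hyp ν).orthogonalProjectionOnto
  have hπ : LipschitzWith 1 π :=
    (Hyp ν).orthogonalProjectionOnto.lipschitz.weaken (by
      rw [← NNReal.coe_le_coe]; exact (Hyp ν).orthogonalProjectionOnto_norm_le)
  have hsub : graphMap ν ψ ⁻¹' Metric.ball x r ⊆ π '' frontier Ω := by
    intro h' hh'
    refine ⟨graphMap ν ψ h', ?_, ?_⟩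
    · rw [mem_frontier_iff_of_graph hΩ hν hψ h hh', graphMap_sub hν, inner_graphMap hν]
    · have h1 : (Hyp ν).orthogonalProjectionOnto ν = 0 := by
        rw [Submodule.orthogonalProjectionOnto_eq_zero_iff, Submodule.orthogonal_orthogonal]
        exact Submodule.mem_span_singleton_self ν
      simp only [π, graphMap, map_add, map_smul, h1, smul_zero, add_zero]
      exact Submodule.orthogonalProjectionOnto_mem_subspace_eq_self h'
  have := (measure_mono hsub).trans (euclideanHausdorffMeasure_image_le hπ (d - 1) _)
  rw [h0, mul_zero] at this
  exact hpos.not_ge this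

end Graph

/-- A bounded nonempty open set in a noncompact space is not clopen, so it has a frontier point,
near which the measure is positive. In dimension `0` the whole space is compact and the frontier may
be empty. -/
theorem IsBoundedLipschitzDomain.surface_univ_ne_zero {Ω : Set (E d)} (hd : d ≠ 0)
    (hΩ : IsBoundedLipschitzDomain Ω) : surface Ω univ ≠ 0 := by
  have hne : (frontier Ω).Nonempty := by
    have : Nonempty (Fin d) := ⟨⟨0, Nat.pos_of_ne_zero hd⟩⟩
    rw [nonempty_frontier_iff]
    refine ⟨hΩ.isConnected.nonempty, fun h => ?_⟩
    exact NoncompactSpace.noncompact_univ (X := E d)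
      (Metric.isCompact_of_isClosed_isBounded isClosed_univ (h ▸ hΩ.isBounded))
  obtain ⟨x, hx⟩ := hne
  obtain ⟨r, hr, ν, hν, K, ψ, hψ, h⟩ := hΩ.lipschitz x hx
  rw [surface, Measure.restrict_apply_univ]
  exact frontier_measure_pos hΩ.isOpen hν hψ h hr hx

/-- The trace inequality. -/
theorem IsBoundedLipschitzDomain.exists_trace_le {Ω : Set (E d)}
    (hΩ : IsBoundedLipschitzDomain Ω) : ∃ C : ℝ≥0∞, C ≠ ⊤ ∧ ∀ u : E d → ℝ, ContDiff ℝ 1 u →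
      ∫⁻ y, ‖u y‖ₑ ^ 2 ∂(surface Ω) ≤ C * ((∫⁻ x in Ω, ‖u x‖ₑ ^ 2) + energy Ω u) := by
  have hcomp : IsCompact (frontier Ω) :=
    hΩ.isBounded.isCompact_closure.of_isClosed_subset isClosed_frontier frontier_subset_closure
  suffices H : ∃ C : ℝ≥0∞, C ≠ ⊤ ∧ ∀ u : E d → ℝ, ContDiff ℝ 1 u →
      ∫⁻ y in frontier Ω ∩ frontier Ω, ‖u y‖ₑ ^ 2 ∂μHE[d - 1] ≤
        C * ((∫⁻ x in Ω, ‖u x‖ₑ ^ 2) + energy Ω u) by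
    rwa [inter_self] at H
  refine hcomp.induction_on (p := fun s => ∃ C : ℝ≥0∞, C ≠ ⊤ ∧ ∀ u : E d → ℝ, ContDiff ℝ 1 u →
      ∫⁻ y in s ∩ frontier Ω, ‖u y‖ₑ ^ 2 ∂μHE[d - 1] ≤
        C * ((∫⁻ x in Ω, ‖u x‖ₑ ^ 2) + energy Ω u)) ⟨0, by simp, fun u _ => by simp⟩ ?_ ?_ ?_
  · rintro s t hst ⟨C, hC, H⟩
    exact ⟨C, hC, fun u hu => (lintegral_mono_set (inter_subset_inter_left _ hst)).trans (H u hu)⟩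
  · rintro s t ⟨C, hC, H⟩ ⟨C', hC', H'⟩
    refine ⟨C + C', by finiteness, fun u hu => ?_⟩
    rw [union_inter_distrib_right, add_mul]
    exact (lintegral_union_le _ _ _).trans (add_le_add (H u hu) (H' u hu))
  · intro x hx
    obtain ⟨r, hr, ν, hν, K, ψ, hψ, h⟩ := hΩ.lipschitz x hx
    obtain ⟨C, hC, H⟩ := exists_lintegral_collar_le hΩ.isOpen hν hr hψ h
    refine ⟨Metric.ball x (r / 2), mem_nhdsWithin_of_mem_nhds
      (Metric.ball_mem_nhds x (by positivity)), 2 * C + 2 * ‖(r / 2) • ν‖ₑ ^ 2 * C,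
      by finiteness, fun u hu => ?_⟩
    have hfd : Continuous (fderiv ℝ u) := hu.continuous_fderiv one_ne_zero
    set e := (r / 2) • ν with he
    have hm1 : ∀ y, Measurable fun s : ℝ => ‖u (y + s • e)‖ₑ ^ 2 := fun y => by
      have : Continuous fun s : ℝ => u (y + s • e) := hu.continuous.comp (by fun_prop)
      exact this.enorm.measurable.pow_const 2
    have hm2 : Measurable fun y => ∫⁻ s in Ioc (0 : ℝ) 1, ‖u (y + s • e)‖ₑ ^ 2 := by
      have : Continuous fun q : E d × ℝ => u (q.1 + q.2 • e) := hu.continuous.comp (by fun_prop)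
      exact (this.enorm.measurable.pow_const 2).lintegral_prod_right'
    -- Compare `u y` with `u (y + s e)` and average over `s ∈ (0, 1]`. The collar estimate then
    -- controls both resulting terms.
    have hpt : ∀ y, ‖u y‖ₑ ^ 2 ≤ 2 * (∫⁻ s in Ioc (0 : ℝ) 1, ‖u (y + s • e)‖ₑ ^ 2) +
        2 * ‖e‖ₑ ^ 2 * ∫⁻ s in Ioc (0 : ℝ) 1, ‖fderiv ℝ u (y + s • e)‖ₑ ^ 2 := by
      intro y
      calc ‖u y‖ₑ ^ 2 = ∫⁻ _ in Ioc (0 : ℝ) 1, ‖u y‖ₑ ^ 2 := by simp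
        _ ≤ ∫⁻ s in Ioc (0 : ℝ) 1, (2 * ‖u (y + s • e)‖ₑ ^ 2 +
              2 * ‖e‖ₑ ^ 2 * ∫⁻ s in Ioc (0 : ℝ) 1, ‖fderiv ℝ u (y + s • e)‖ₑ ^ 2) := by
            refine setLIntegral_mono' measurableSet_Ioc fun s hs => ?_
            have h1 := enorm_sub_sq_le_two (u y) (u (y + s • e)) 0
            have h2 := enorm_sub_sq_le_lintegral hu y e (Ioc_subset_Icc_self hs)
            rw [sub_zero, sub_zero, enorm_sub_rev, add_comm] at h1
            refine h1.trans ?_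
            rw [mul_assoc]
            gcongr
        _ = _ := by
            rw [lintegral_add_left ((hm1 y).const_mul 2), lintegral_const_mul _ (hm1 y)]
            simp
    calc ∫⁻ y in Metric.ball x (r / 2) ∩ frontier Ω, ‖u y‖ₑ ^ 2 ∂μHE[d - 1]
        ≤ ∫⁻ y in Metric.ball x (r / 2) ∩ frontier Ω,
            (2 * (∫⁻ s in Ioc (0 : ℝ) 1, ‖u (y + s • e)‖ₑ ^ 2) +
            2 * ‖e‖ₑ ^ 2 * ∫⁻ s in Ioc (0 : ℝ) 1, ‖fderiv ℝ u (y + s • e)‖ₑ ^ 2) ∂μHE[d - 1] :=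
          lintegral_mono hpt
      _ ≤ 2 * (C * ∫⁻ x in Ω, ‖u x‖ₑ ^ 2) + 2 * ‖e‖ₑ ^ 2 * (C * energy Ω u) := by
          rw [lintegral_add_left (hm2.const_mul 2), lintegral_const_mul' _ _ (by finiteness),
            lintegral_const_mul' _ _ (by finiteness)]
          gcongr
          · exact H _ (hu.continuous.enorm.measurable.pow_const 2)
          · exact H _ (hfd.enorm.measurable.pow_const 2)
      _ ≤ _ := by
          rw [add_mul, mul_assoc, mul_assoc, mul_assoc, mul_assoc]
          gcongr
          · exact le_self_add
          · exact le_add_self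

/-! ### Extension by density and Lax–Milgram. -/

section Abstract

/-- The closure of the graph of a densely defined bounded operator is the graph of its
extension. -/
theorem exists_clm_of_graph {X Y : Type*} [NormedAddCommGroup X] [NormedSpace ℝ X]
    [NormedAddCommGroup Y] [NormedSpace ℝ Y] [CompleteSpace Y] (G : Submodule ℝ (X × Y)) {C : ℝ}
    (hC : 0 ≤ C) (hG : ∀ p ∈ G, ‖p.2‖ ≤ C * ‖p.1‖)
    (hdense : ∀ x, x ∈ closure {x | ∃ y, (x, y) ∈ G}) :
    ∃ T : X →L[ℝ] Y, ∀ x y, (x, y) ∈ G.topologicalClosure ↔ y = T x := by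
  -- The bound persists in the closure. It gives uniqueness of the second component there; applied
  -- to differences, it makes images of convergent sequences Cauchy.
  have H : ∀ p ∈ G.topologicalClosure, ‖p.2‖ ≤ C * ‖p.1‖ := fun p hp =>
    closure_minimal (t := {p : X × Y | ‖p.2‖ ≤ C * ‖p.1‖}) hG
      (isClosed_le continuous_snd.norm (continuous_const.mul continuous_fst.norm)) hp
  have hex : ∀ x, ∃ y, (x, y) ∈ G.topologicalClosure := by
    intro x
    obtain ⟨x', hx', hlim⟩ := mem_closure_iff_seq_limit.1 (hdense x)
    choose y hy using hx'
    have hcau : CauchySeq y := by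
      rw [Metric.cauchySeq_iff]
      intro ε hε
      obtain ⟨N, hN⟩ := Metric.cauchySeq_iff.1 hlim.cauchySeq (ε / (C + 1)) (by positivity)
      refine ⟨N, fun m hm n hn => ?_⟩
      have h1 := hG _ (G.sub_mem (hy m) (hy n))
      have h2 := hN m hm n hn
      rw [dist_eq_norm, lt_div_iff₀ (by positivity)] at h2
      rw [dist_eq_norm]
      simp only [Prod.mk_sub_mk] at h1
      nlinarith [norm_nonneg (x' m - x' n)]
    obtain ⟨y₀, hy₀⟩ := cauchySeq_tendsto_of_complete hcau
    exact ⟨y₀, mem_closure_of_tendsto (hlim.prodMk_nhds hy₀) (Eventually.of_forall hy)⟩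
  choose y hy using hex
  have huniq : ∀ x y₁ y₂, (x, y₁) ∈ G.topologicalClosure → (x, y₂) ∈ G.topologicalClosure →
      y₁ = y₂ := by
    intro x y₁ y₂ h1 h2
    have h := H _ (G.topologicalClosure.sub_mem h1 h2)
    simp only [Prod.mk_sub_mk, sub_self, norm_zero, mul_zero] at h
    exact sub_eq_zero.1 (norm_le_zero_iff.1 h)
  refine ⟨LinearMap.mkContinuous
    { toFun := y
      map_add' := fun u w => huniq _ _ _ (hy _) (G.topologicalClosure.add_mem (hy u) (hy w))
      map_smul' := fun c w => huniq _ _ _ (hy _) (G.topologicalClosure.smul_mem c (hy w)) } C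
    fun w => H _ (hy w), fun x y' => ⟨fun h => huniq _ _ _ h (hy x), ?_⟩⟩
  rintro rfl
  exact hy x

variable {V L : Type*} [NormedAddCommGroup V] [InnerProductSpace ℝ V]
  [NormedAddCommGroup L] [InnerProductSpace ℝ L]

theorem norm_sq_le_of_dense (D : V →L[ℝ] L) (m : V →L[ℝ] ℝ) {C : ℝ} {S : Set V}
    (hS : ∀ w ∈ S, ‖w‖ ^ 2 ≤ C * (‖D w‖ ^ 2 + m w ^ 2)) {w : V} (hw : w ∈ closure S) :
    w ∈ {w : V | ‖w‖ ^ 2 ≤ C * (‖D w‖ ^ 2 + m w ^ 2)} :=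
  have h : IsClosed {w : V | ‖w‖ ^ 2 ≤ C * (‖D w‖ ^ 2 + m w ^ 2)} :=
    isClosed_le (continuous_norm.pow 2)
      (continuous_const.mul ((D.continuous.norm.pow 2).add (m.continuous.pow 2)))
  h.closure_subset_iff.2 (fun w hw => Set.mem_ofPred_eq ▸ hS w hw) hw

/-- A variant of the Lax–Milgram lemma, for a form that is coercive modulo the kernel of `D`. -/
theorem exists_solution_of_coercive [CompleteSpace V] (D : V →L[ℝ] L) (m : V →L[ℝ] ℝ) {C : ℝ}
    (hC : 0 < C) (H : ∀ w, ‖w‖ ^ 2 ≤ C * (‖D w‖ ^ 2 + m w ^ 2)) (M : L →L[ℝ] L) {lam : ℝ}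
    (hlam : 0 < lam) (hM : ∀ G, lam * ‖G‖ ^ 2 ≤ ⟪M G, G⟫) (F : L) {w₁ : V} (hw₁ : D w₁ = 0)
    (hmw₁ : m w₁ ≠ 0) : ∃ u, (∀ w, ⟪M (D u), D w⟫ = ⟪F, D w⟫) ∧ m u = 0 := by
  -- The term `m u * m w` restores coercivity on the kernel of `D`.
  let B : V →L[ℝ] V →L[ℝ] ℝ := LinearMap.mkContinuous₂
    (LinearMap.mk₂ ℝ (fun u w => ⟪M (D u), D w⟫ + m u * m w)
      (fun u u' w => by simp only [map_add, inner_add_left]; ring)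
      (fun c u w => by simp only [map_smul, real_inner_smul_left, smul_eq_mul]; ring)
      (fun u w w' => by simp only [map_add, inner_add_right]; ring)
      (fun c u w => by simp only [map_smul, real_inner_smul_right, smul_eq_mul]; ring))
    (‖M‖ * ‖D‖ * ‖D‖ + ‖m‖ * ‖m‖) (fun u w => by
      rw [LinearMap.mk₂_apply]
      refine (norm_add_le _ _).trans ?_
      have h1 : ‖⟪M (D u), D w⟫‖ ≤ ‖M‖ * ‖D‖ * ‖D‖ * ‖u‖ * ‖w‖ := by
        refine (norm_inner_le_norm _ _).trans ?_
        calc ‖M (D u)‖ * ‖D w‖ ≤ (‖M‖ * (‖D‖ * ‖u‖)) * (‖D‖ * ‖w‖) := by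
              gcongr
              · exact (M.le_opNorm _).trans (by gcongr; exact D.le_opNorm u)
              · exact D.le_opNorm w
          _ = _ := by ring
      have h2 : ‖m u * m w‖ ≤ ‖m‖ * ‖m‖ * ‖u‖ * ‖w‖ := by
        rw [norm_mul]
        calc ‖m u‖ * ‖m w‖ ≤ (‖m‖ * ‖u‖) * (‖m‖ * ‖w‖) := by
              gcongr
              · exact m.le_opNorm u
              · exact m.le_opNorm w
          _ = _ := by ring
      linarith)
  have hB : ∀ u w, B u w = ⟪M (D u), D w⟫ + m u * m w := fun u w => rfl
  have hcoer : IsCoercive B := by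
    refine ⟨min lam 1 / C, by positivity, fun u => ?_⟩
    rw [hB]
    have h1 := H u
    have h2 := hM (D u)
    rw [mul_assoc, ← sq, div_mul_eq_mul_div, div_le_iff₀ hC]
    have h3 : min lam 1 * (‖D u‖ ^ 2 + m u ^ 2) ≤ ⟪M (D u), D u⟫ + m u * m u := by
      have h4 : min lam 1 * ‖D u‖ ^ 2 ≤ lam * ‖D u‖ ^ 2 := by
        gcongr; exact min_le_left _ _
      have h5 : min lam 1 * m u ^ 2 ≤ 1 * m u ^ 2 := by gcongr; exact min_le_right _ _
      nlinarith
    have h4 : 0 ≤ min lam 1 := by positivity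
    nlinarith
  let u : V := hcoer.continuousLinearEquivOfBilin.symm
    ((InnerProductSpace.toDual ℝ V).symm ((innerSL ℝ F).comp D))
  have hu : ∀ w, ⟪M (D u), D w⟫ + m u * m w = ⟪F, D w⟫ := by
    intro w
    rw [← hB, ← hcoer.continuousLinearEquivOfBilin_apply, ContinuousLinearEquiv.apply_symm_apply,
      InnerProductSpace.toDual_symm_apply]
    rfl
  -- Testing with `w₁`, a constant function in the application, kills every term except the added
  -- one, which therefore disappears from the equation.
  have hmu : m u = 0 := by
    have h1 := hu w₁
    rw [hw₁, inner_zero_right, inner_zero_right, zero_add] at h1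
    exact (mul_eq_zero.1 h1).resolve_right hmw₁
  refine ⟨u, fun w => ?_, hmu⟩
  have h1 := hu w
  rwa [hmu, zero_mul, add_zero] at h1

end Abstract

/-! ### The trace operator, the Friedrichs inequality and the Neumann problem. -/

namespace H1

variable {Ω : Set (E d)}

theorem grad_ae_eq_gradient (hΩ : IsOpen Ω) (hb : Bornology.IsBounded Ω) {w : H1 Ω}
    {φ : E d → ℝ} (hφ : ContDiff ℝ 1 φ) (hw : fn w =ᵐ[volume.restrict Ω] φ) :
    grad w =ᵐ[volume.restrict Ω] gradient φ := by
  obtain ⟨w', h1, h2⟩ := exists_of_contDiff hb hφ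
  rwa [← ext_fn hΩ (hw.trans h1.symm)] at h2

theorem lintegral_fn_sq {w : H1 Ω} {φ : E d → ℝ} (hw : fn w =ᵐ[volume.restrict Ω] φ) :
    ‖fn w‖ₑ ^ 2 = ∫⁻ x in Ω, ‖φ x‖ₑ ^ 2 := by
  rw [enorm_sq_Lp]
  exact lintegral_congr_ae (by filter_upwards [hw] with x h1; rw [h1])

theorem enorm_grad_sq_of_contDiff (hΩ : IsOpen Ω) (hb : Bornology.IsBounded Ω) {w : H1 Ω}
    {φ : E d → ℝ} (hφ : ContDiff ℝ 1 φ) (hw : fn w =ᵐ[volume.restrict Ω] φ) :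
    ‖grad w‖ₑ ^ 2 = energy Ω φ := by
  rw [enorm_sq_Lp, energy]
  refine lintegral_congr_ae ?_
  filter_upwards [grad_ae_eq_gradient hΩ hb hφ hw] with x h1
  rw [h1, ← ofReal_norm, ← ofReal_norm, norm_gradient]

end H1

theorem energy_const (Ω : Set (E d)) (c : ℝ) : energy Ω (fun _ => c) = 0 := by
  have h : ∀ x : E d, ‖fderiv ℝ (fun _ : E d => c) x‖ₑ ^ 2 = 0 := fun x => by
    rw [fderiv_fun_const, Pi.zero_apply, ← ofReal_norm, norm_zero, ENNReal.ofReal_zero, zero_pow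
      two_ne_zero]
  simp only [energy, h, lintegral_zero]

namespace IsBoundedLipschitzDomain

variable {Ω : Set (E d)}

theorem isCompact_frontier (hΩ : IsBoundedLipschitzDomain Ω) : IsCompact (frontier Ω) :=
  hΩ.isBounded.isCompact_closure.of_isClosed_subset isClosed_frontier frontier_subset_closure

/-- The trace inequality applied to the constant `1` bounds the surface area by a multiple of the
volume. -/
theorem isFiniteMeasure_surface (hΩ : IsBoundedLipschitzDomain Ω) :
    IsFiniteMeasure (surface Ω) := by
  obtain ⟨C, hC, H⟩ := hΩ.exists_trace_le
  refine ⟨?_⟩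
  have h := H (fun _ => 1) contDiff_const
  rw [energy_const, add_zero] at h
  simp only [enorm_one, one_pow, lintegral_one, Measure.restrict_apply_univ] at h
  exact h.trans_lt (ENNReal.mul_lt_top hC.lt_top hΩ.isBounded.measure_lt_top)

theorem memLp_surface (hΩ : IsBoundedLipschitzDomain Ω) {φ : E d → ℝ} (hφ : Continuous φ)
    (p : ℝ≥0∞) : MemLp φ p (surface Ω) := by
  have := hΩ.isFiniteMeasure_surface
  obtain ⟨C, hC⟩ := hΩ.isCompact_frontier.exists_bound_of_continuousOn hφ.continuousOn
  exact MemLp.of_bound hφ.aestronglyMeasurable C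
    ((ae_restrict_mem isClosed_frontier.measurableSet).mono hC)

theorem norm_le_of_enorm_sq_le {X Y : Type*} [NormedAddCommGroup X] [NormedAddCommGroup Y]
    {x : X} {y : Y} {C : ℝ≥0∞} (hC : C ≠ ⊤) (h : ‖y‖ₑ ^ 2 ≤ C * ‖x‖ₑ ^ 2) :
    ‖y‖ ≤ Real.sqrt C.toReal * ‖x‖ := by
  rw [← ofReal_norm, ← ofReal_norm, ← ENNReal.ofReal_pow (norm_nonneg _),
    ← ENNReal.ofReal_pow (norm_nonneg _), ← ENNReal.ofReal_toReal hC,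
    ← ENNReal.ofReal_mul ENNReal.toReal_nonneg,
    ENNReal.ofReal_le_ofReal_iff (by positivity)] at h
  refine abs_le_of_sq_le_sq' ?_ (by positivity) |>.2
  rw [mul_pow, Real.sq_sqrt ENNReal.toReal_nonneg]
  exact h

theorem exists_norm_trace_le (hΩ : IsBoundedLipschitzDomain Ω) :
    ∃ C : ℝ, 0 ≤ C ∧ ∀ p ∈ smoothTraceGraph Ω, ‖p.2‖ ≤ C * ‖p.1‖ := by
  obtain ⟨C, hC, H⟩ := hΩ.exists_trace_le
  refine ⟨Real.sqrt C.toReal, Real.sqrt_nonneg _, ?_⟩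
  rintro ⟨w, γ⟩ ⟨φ, hφ, h1, h2⟩
  have hφ1 : ContDiff ℝ 1 φ := hφ.of_le (by simp)
  refine norm_le_of_enorm_sq_le hC ?_
  rw [H1.enorm_sq, ← enorm_sq_Lp, ← enorm_sq_Lp, H1.lintegral_fn_sq h1,
    H1.enorm_grad_sq_of_contDiff hΩ.isOpen hΩ.isBounded hφ1 h1, enorm_sq_Lp]
  refine le_trans (le_of_eq (lintegral_congr_ae ?_)) (H φ hφ1)
  filter_upwards [h2] with x hx
  rw [← hx]

/-- The trace operator. -/
theorem exists_trace (hΩ : IsBoundedLipschitzDomain Ω) :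
    ∃ tr : H1 Ω →L[ℝ] Lp ℝ 2 (surface Ω), ∀ w γ, (w, γ) ∈ traceGraph Ω ↔ γ = tr w := by
  obtain ⟨C, hC, H⟩ := hΩ.exists_norm_trace_le
  refine exists_clm_of_graph (smoothTraceGraph Ω) hC H fun w =>
    closure_mono ?_ (hΩ.dense_smoothFns w)
  rintro w ⟨φ, hφ, h1⟩
  have hm := hΩ.memLp_surface hφ.continuous 2
  exact ⟨hm.toLp φ, φ, hφ, h1, hm.coeFn_toLp⟩

/-- The boundary integral of the trace is a bounded functional on `H^1(Ω)`. -/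
theorem exists_boundaryMean (hΩ : IsBoundedLipschitzDomain Ω) :
    ∃ m : H1 Ω →L[ℝ] ℝ, (∀ w, ∃ γ : Hhalf Ω, IsTrace w γ) ∧
      (∀ w (γ : Hhalf Ω), IsTrace w γ → boundaryIntegral γ = m w) ∧
      ∀ w (φ : E d → ℝ), ContDiff ℝ ∞ φ → fn w =ᵐ[volume.restrict Ω] φ →
        m w = ∫ x, φ x ∂(surface Ω) := by
  have := hΩ.isFiniteMeasure_surface
  obtain ⟨tr, htr⟩ := hΩ.exists_trace
  have h1 : MemLp (fun _ : E d => (1 : ℝ)) 2 (surface Ω) := memLp_const 1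
  have hm : ∀ γ : Lp ℝ 2 (surface Ω), ⟪h1.toLp _, γ⟫ = ∫ x, γ x ∂(surface Ω) := by
    intro γ
    rw [L2.inner_def]
    refine integral_congr_ae ?_
    filter_upwards [h1.coeFn_toLp] with x hx
    rw [hx]; simp
  refine ⟨(innerSL ℝ (h1.toLp _)).comp tr, fun w => ?_, fun w γ hγ => ?_, fun w φ hφ hw => ?_⟩
  · exact ⟨⟨tr w, ⟨(w, tr w), (htr w _).2 rfl, rfl⟩⟩, (htr w _).2 rfl⟩
  · have h2 := (htr w γ).1 hγ
    rw [ContinuousLinearMap.comp_apply, innerSL_apply_apply, hm, ← h2]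
    rfl
  · have hφm := hΩ.memLp_surface hφ.continuous 2
    have h2 : hφm.toLp φ = tr w :=
      (htr w _).1 (subset_closure ⟨φ, hφ, hw, hφm.coeFn_toLp⟩)
    rw [ContinuousLinearMap.comp_apply, innerSL_apply_apply, hm, ← h2]
    exact integral_congr_ae hφm.coeFn_toLp

/-- A Friedrichs inequality for smooth functions. -/
theorem exists_friedrichs (hd : d ≠ 0) (hΩ : IsBoundedLipschitzDomain Ω) :
    ∃ C : ℝ≥0∞, C ≠ ⊤ ∧ ∀ u : E d → ℝ, ContDiff ℝ 1 u → ∫⁻ x in Ω, ‖u x‖ₑ ^ 2 ≤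
      C * (energy Ω u + ‖∫ x, u x ∂(surface Ω)‖ₑ ^ 2) := by
  have := hΩ.isFiniteMeasure_surface
  have hS0 := hΩ.surface_univ_ne_zero hd
  obtain ⟨Ct, hCt, Ht⟩ := hΩ.exists_trace_le
  obtain ⟨Cp, hCp, Hp⟩ := oscBound_of_coneAt hΩ.isOpen hΩ.isConnected hΩ.isBounded
    fun x hx => hΩ.coneAt hx
  set S := surface Ω with hS
  have hSt : S univ ≠ ⊤ := measure_ne_top _ _
  have hΩt : volume Ω ≠ ⊤ := hΩ.isBounded.measure_lt_top.ne
  refine ⟨(S univ ^ 2)⁻¹ * (2 * S univ * (Ct * (Cp + volume Ω)) + 2 * volume Ω), ?_,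
    fun u hu => ?_⟩
  · have : (S univ ^ 2)⁻¹ ≠ ⊤ := ENNReal.inv_ne_top.2 (pow_ne_zero 2 hS0)
    finiteness
  -- For each `y`, the trace inequality is applied to `z ↦ u y - u z`; integrating over `y` leaves
  -- the oscillation over `Ω × Ω`, which Poincaré bounds by the energy.
  have hosc : ∫⁻ y in Ω, (∫⁻ z, ‖u y - u z‖ₑ ^ 2 ∂S) ≤ Ct * (Cp + volume Ω) * energy Ω u := by
    calc ∫⁻ y in Ω, (∫⁻ z, ‖u y - u z‖ₑ ^ 2 ∂S)
        ≤ ∫⁻ y in Ω, Ct * ((∫⁻ x in Ω, ‖u y - u x‖ₑ ^ 2) + energy Ω u) := by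
          refine lintegral_mono fun y => ?_
          have h := Ht (fun z => u y - u z) (contDiff_const.sub hu)
          refine h.trans (le_of_eq ?_)
          congr 2
          simp only [energy]
          refine lintegral_congr fun x => ?_
          rw [fderiv_const_sub, enorm_neg]
      _ = Ct * ((∫⁻ y in Ω, ∫⁻ x in Ω, ‖u y - u x‖ₑ ^ 2) + energy Ω u * volume Ω) := by
          rw [lintegral_const_mul' _ _ hCt, lintegral_add_right _ measurable_const,
            setLIntegral_const]
      _ ≤ Ct * (Cp * energy Ω u + energy Ω u * volume Ω) := by
          gcongr
          exact Hp u hu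
      _ = _ := by ring
  -- Split `u y`, multiplied by the surface area, into its deviation from the boundary integral and
  -- the boundary integral itself.
  have hpt : ∀ y, S univ ^ 2 * ‖u y‖ₑ ^ 2 ≤
      2 * S univ * (∫⁻ z, ‖u y - u z‖ₑ ^ 2 ∂S) + 2 * ‖∫ x, u x ∂S‖ₑ ^ 2 := by
    intro y
    have hui : Integrable u S := (hΩ.memLp_surface hu.continuous 1).integrable le_rfl
    have h1 := enorm_sub_sq_le_two (S.real univ * u y) (∫ x, u x ∂S) 0
    rw [sub_zero, sub_zero, enorm_mul, mul_pow] at h1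
    have h2 : ‖S.real univ‖ₑ = S univ := by
      rw [Real.enorm_of_nonneg measureReal_nonneg, ofReal_measureReal]
    have h3 : S.real univ * u y - ∫ x, u x ∂S = ∫ z, (u y - u z) ∂S := by
      rw [integral_sub (integrable_const _) hui, integral_const, smul_eq_mul]
    rw [h2, h3] at h1
    refine h1.trans ?_
    rw [mul_assoc]
    gcongr
    have hm : Continuous fun z => u y - u z := continuous_const.sub hu.continuous
    calc ‖∫ z, (u y - u z) ∂S‖ₑ ^ 2 ≤ (∫⁻ z, ‖u y - u z‖ₑ ∂S) ^ 2 := by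
          gcongr
          exact enorm_integral_le_lintegral_enorm _
      _ ≤ _ := sq_lintegral_le S hm.enorm.measurable.aemeasurable
  have key : S univ ^ 2 * ∫⁻ x in Ω, ‖u x‖ₑ ^ 2 ≤
      (2 * S univ * (Ct * (Cp + volume Ω)) + 2 * volume Ω) *
        (energy Ω u + ‖∫ x, u x ∂S‖ₑ ^ 2) := by
    calc S univ ^ 2 * ∫⁻ x in Ω, ‖u x‖ₑ ^ 2 = ∫⁻ x in Ω, S univ ^ 2 * ‖u x‖ₑ ^ 2 := by
          rw [lintegral_const_mul' _ _ (by finiteness)]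
      _ ≤ ∫⁻ y in Ω, (2 * S univ * (∫⁻ z, ‖u y - u z‖ₑ ^ 2 ∂S) + 2 * ‖∫ x, u x ∂S‖ₑ ^ 2) :=
          lintegral_mono hpt
      _ = 2 * S univ * (∫⁻ y in Ω, (∫⁻ z, ‖u y - u z‖ₑ ^ 2 ∂S)) +
            2 * ‖∫ x, u x ∂S‖ₑ ^ 2 * volume Ω := by
          rw [lintegral_add_right _ measurable_const, setLIntegral_const,
            lintegral_const_mul' _ _ (by finiteness)]
      _ ≤ 2 * S univ * (Ct * (Cp + volume Ω) * energy Ω u) +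
            2 * ‖∫ x, u x ∂S‖ₑ ^ 2 * volume Ω := by gcongr
      _ ≤ 2 * S univ * (Ct * (Cp + volume Ω) * (energy Ω u + ‖∫ x, u x ∂S‖ₑ ^ 2)) +
            2 * (energy Ω u + ‖∫ x, u x ∂S‖ₑ ^ 2) * volume Ω := by
          gcongr
          · exact le_self_add
          · exact le_add_self
      _ = _ := by ring
  rw [mul_assoc, ← ENNReal.div_eq_inv_mul, ENNReal.le_div_iff_mul_le
    (Or.inl (pow_ne_zero 2 hS0)) (Or.inl (by finiteness)), mul_comm]
  exact key

theorem norm_sq_le_of_enorm_sq_le {X Y Z : Type*} [NormedAddCommGroup X] [NormedAddCommGroup Y]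
    [NormedAddCommGroup Z] {x : X} {y : Y} {z : Z} {C : ℝ≥0∞} (hC : C ≠ ⊤)
    (h : ‖x‖ₑ ^ 2 ≤ C * (‖y‖ₑ ^ 2 + ‖z‖ₑ ^ 2)) :
    ‖x‖ ^ 2 ≤ C.toReal * (‖y‖ ^ 2 + ‖z‖ ^ 2) := by
  rwa [← ofReal_norm, ← ofReal_norm, ← ofReal_norm,
    ← ENNReal.ofReal_pow (norm_nonneg _), ← ENNReal.ofReal_pow (norm_nonneg _),
    ← ENNReal.ofReal_pow (norm_nonneg _), ← ENNReal.ofReal_add (by positivity) (by positivity),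
    ← ENNReal.ofReal_toReal hC, ← ENNReal.ofReal_mul ENNReal.toReal_nonneg,
    ENNReal.ofReal_le_ofReal_iff (by positivity)] at h

theorem norm_fn_sq_le (hΩ : IsBoundedLipschitzDomain Ω) {m : H1 Ω →L[ℝ] ℝ}
    (hm : ∀ w (φ : E d → ℝ), ContDiff ℝ ∞ φ → fn w =ᵐ[volume.restrict Ω] φ →
        m w = ∫ x, φ x ∂(surface Ω)) {C : ℝ≥0∞} (hC : C ≠ ⊤)
    (H : ∀ u : E d → ℝ, ContDiff ℝ 1 u → ∫⁻ x in Ω, ‖u x‖ₑ ^ 2 ≤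
      C * (energy Ω u + ‖∫ x, u x ∂(surface Ω)‖ₑ ^ 2)) (w : H1 Ω) (hw : w ∈ H1.smoothFns Ω) :
    ‖fn w‖ ^ 2 ≤ C.toReal * (‖grad w‖ ^ 2 + ‖m w‖ ^ 2) := by
  obtain ⟨φ, hφ, hwφ⟩ := hw
  have hφ1 : ContDiff ℝ 1 φ := hφ.of_le (by simp)
  refine norm_sq_le_of_enorm_sq_le hC ?_
  rw [H1.lintegral_fn_sq hwφ, H1.enorm_grad_sq_of_contDiff hΩ.isOpen hΩ.isBounded hφ1 hwφ,
    hm w φ hφ hwφ]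
  exact H φ hφ1

/-- The coercivity estimate used both for solvability and for upgrading gradient convergence. It
passes from smooth functions to `H^1(Ω)` because both sides are continuous. -/
theorem exists_norm_sq_le (hd : d ≠ 0) (hΩ : IsBoundedLipschitzDomain Ω) {m : H1 Ω →L[ℝ] ℝ}
    (hm : ∀ w (φ : E d → ℝ), ContDiff ℝ ∞ φ → fn w =ᵐ[volume.restrict Ω] φ →
        m w = ∫ x, φ x ∂(surface Ω)) :
    ∃ C : ℝ, 0 < C ∧ ∀ w : H1 Ω, ‖w‖ ^ 2 ≤ C * (‖grad w‖ ^ 2 + m w ^ 2) := by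
  obtain ⟨C, hC, H⟩ := hΩ.exists_friedrichs hd
  have aux : ∀ {a b c e : ℝ}, a ≤ c * (b + e) → 0 ≤ e → a + b ≤ (c + 1) * (b + e) := by
    intro a b c e h1 h2
    linarith
  have key : ∀ w ∈ (H1.smoothFns Ω : Set (H1 Ω)),
      ‖w‖ ^ 2 ≤ (C.toReal + 1) * (‖H1.gradL Ω w‖ ^ 2 + m w ^ 2) := by
    intro w hw
    have h1 := hΩ.norm_fn_sq_le hm hC H w hw
    rw [Real.norm_eq_abs, sq_abs] at h1
    exact (H1.norm_sq w).trans_le (aux h1 (sq_nonneg _))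
  exact ⟨C.toReal + 1, by positivity, fun w =>
    norm_sq_le_of_dense (H1.gradL Ω) m key (hΩ.dense_smoothFns w)⟩

/-- Solvability of the Neumann problem with the right-hand side in divergence form and zero boundary
mean. -/
theorem exists_solution (hd : d ≠ 0) (hΩ : IsBoundedLipschitzDomain Ω) {m : H1 Ω →L[ℝ] ℝ}
    (hm : ∀ w (φ : E d → ℝ), ContDiff ℝ ∞ φ → fn w =ᵐ[volume.restrict Ω] φ →
        m w = ∫ x, φ x ∂(surface Ω))
    (M : Lp (E d) 2 (volume.restrict Ω) →L[ℝ] Lp (E d) 2 (volume.restrict Ω)) {lam : ℝ}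
    (hlam : 0 < lam) (hM : ∀ G, lam * ‖G‖ ^ 2 ≤ ⟪M G, G⟫)
    (F : Lp (E d) 2 (volume.restrict Ω)) :
    ∃ u : H1 Ω, (∀ w, ⟪M (grad u), grad w⟫ = ⟪F, grad w⟫) ∧ m u = 0 := by
  obtain ⟨C, hC, H⟩ := hΩ.exists_norm_sq_le hd hm
  obtain ⟨w, hw, -⟩ := H1.exists_of_contDiff hΩ.isBounded
    (contDiff_const (c := (1 : ℝ)) : ContDiff ℝ 1 fun _ : E d => (1 : ℝ))
  have hg : grad w = 0 := by
    have h := H1.enorm_grad_sq_of_contDiff hΩ.isOpen hΩ.isBounded contDiff_const hw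
    rw [energy_const] at h
    simpa using h
  have := hΩ.isFiniteMeasure_surface
  have hS : (surface Ω).real univ ≠ 0 :=
    (measureReal_ne_zero_iff (measure_ne_top _ _)).2 (hΩ.surface_univ_ne_zero hd)
  refine exists_solution_of_coercive (H1.gradL Ω) m hC H M hlam hM F hg ?_
  rw [hm w _ contDiff_const hw]
  simpa using hS

end IsBoundedLipschitzDomain

/-! ### Lipschitz functions vanishing near the boundary. -/

theorem measurable_gradient (f : E d → ℝ) : Measurable (gradient f) :=
  (InnerProductSpace.toDual ℝ (E d)).symm.continuous.measurable.comp (measurable_fderiv ℝ f)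

theorem memLp_gradient_of_lipschitzWith {C : ℝ≥0} {ψ : E d → ℝ} (hψ : LipschitzWith C ψ)
    (hc : HasCompactSupport ψ) : MemLp (gradient ψ) 2 := by
  have hgc : HasCompactSupport (gradient ψ) :=
    (hc.fderiv ℝ).comp_left (g := (InnerProductSpace.toDual ℝ (E d)).symm) (map_zero _)
  have hm : AEStronglyMeasurable (gradient ψ) (volume.restrict (tsupport (gradient ψ))) :=
    (measurable_gradient ψ).aestronglyMeasurable
  have : IsFiniteMeasure (volume.restrict (tsupport (gradient ψ))) :=
    ⟨by rw [Measure.restrict_apply_univ]; exact hgc.isCompact.measure_lt_top⟩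
  have h := MemLp.of_bound (p := 2) hm C (Eventually.of_forall fun x => by
    rw [norm_gradient]; exact norm_fderiv_le_of_lipschitz ℝ hψ)
  rw [← memLp_indicator_iff_restrict (isClosed_tsupport _).measurableSet] at h
  rwa [indicator_eq_self.2 (subset_tsupport _)] at h

theorem hasWeakFDeriv_gradient_of_lipschitzWith {C : ℝ≥0} {ψ : E d → ℝ} (hψ : LipschitzWith C ψ)
    (Ω : Set (E d)) : HasWeakFDeriv Ω ψ fun x => innerSL ℝ (gradient ψ x) := by
  simp only [innerSL_gradient]
  exact hasWeakFDeriv_of_lipschitzWith hψ Ω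

/-- Mollification with a kernel narrower than the neighbourhood of `K` where `ψ` vanishes keeps
exact zeros on `K`, which is what makes the trace of the limit zero. -/
theorem exists_contDiff_approx_of_lipschitzWith {K : Set (E d)} (hK : IsCompact K) {C : ℝ≥0}
    {ψ : E d → ℝ} (hψ : LipschitzWith C ψ) (hc : HasCompactSupport ψ)
    (h0 : ∀ᶠ x in 𝓝ˢ K, ψ x = 0) {ε : ℝ≥0∞} (hε : ε ≠ 0) :
    ∃ φ : E d → ℝ, ContDiff ℝ ∞ φ ∧ ∫⁻ y, ‖φ y - ψ y‖ₑ ^ 2 ≤ ε ∧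
      ∫⁻ y, ‖gradient φ y - gradient ψ y‖ₑ ^ 2 ≤ ε ∧ ∀ y ∈ K, φ y = 0 := by
  have hψm : MemLp ψ 2 := hψ.continuous.memLp_of_hasCompactSupport hc
  have hGm := memLp_gradient_of_lipschitzWith hψ hc
  obtain ⟨δ₁, hδ₁, H₁⟩ := lintegral_mollify_sub_le_of_memLp hψm hε
  obtain ⟨δ₂, hδ₂, H₂⟩ := lintegral_mollify_sub_le_of_memLp hGm hε
  obtain ⟨V, hV, hFV, hV0⟩ := mem_nhdsSet_iff_exists.1 h0
  obtain ⟨δ₃, hδ₃, H₃⟩ := hK.exists_thickening_subset_open hV hFV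
  set δ := min δ₁ (min δ₂ δ₃) with hδ
  have hδ0 : 0 < δ := by positivity
  obtain ⟨k, hk, hkc, hk0, hk1, hkt⟩ := H1.exists_kernel (0 : E d) (η := δ / 2) (by positivity)
  have hkδ : ∀ t ∈ tsupport k, ‖t‖ < δ := fun t ht => by
    have h := hkt ht
    rw [mem_closedBall_zero_iff] at h
    linarith
  have hsupp : ∀ δ', δ ≤ δ' → Function.support k ⊆ Metric.ball 0 δ' := fun δ' h t ht => by
    rw [mem_ball_zero_iff]
    exact (hkδ t (subset_tsupport _ ht)).trans_le h
  have hψl : LocallyIntegrable ψ := hψm.locallyIntegrable (by simp)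
  have hGl : LocallyIntegrable (gradient ψ) := hGm.locallyIntegrable (by simp)
  have hGl' : LocallyIntegrable fun x => innerSL ℝ (gradient ψ x) := by
    have h : MemLp (fun x => innerSL ℝ (gradient ψ x)) 2 := by
      refine MemLp.of_le hGm ?_ (Eventually.of_forall fun x => (innerSL_apply_norm _ _).le)
      exact (innerSL ℝ : E d →L[ℝ] _).continuous.comp_aestronglyMeasurable hGm.1
    exact h.locallyIntegrable (by simp)
  have hgrad : gradient (mollify k ψ) = mollify k (gradient ψ) := by
    ext1 y
    refine gradient_eq_of_hasFDerivAt ?_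
    rw [← H1.innerSL_mollify hk.continuous hkc hGl]
    exact hasFDerivAt_mollify hk hkc hψl hGl' (hasWeakFDeriv_gradient_of_lipschitzWith hψ univ)
      fun t _ => mem_univ _
  refine ⟨mollify k ψ, contDiff_mollify hk hkc hψl,
    H₁ k hk.continuous hkc hk0 hk1 (hsupp _ (min_le_left _ _)), ?_, fun y hy =>
    integral_eq_zero_of_ae (Eventually.of_forall fun t => ?_)⟩
  · rw [hgrad]
    exact H₂ k hk.continuous hkc hk0 hk1 (hsupp _ ((min_le_right _ _).trans (min_le_left _ _)))
  · by_cases ht : t ∈ tsupport k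
    · have : ψ (y - t) = 0 := hV0 (H₃ (Metric.mem_thickening_iff.2 ⟨y, hy, by
        rw [dist_eq_norm, sub_sub_cancel_left, norm_neg]
        exact (hkδ t ht).trans_le ((min_le_right _ _).trans (min_le_right _ _))⟩))
      simp [this]
    · simp [image_eq_zero_of_notMem_tsupport ht]

/-- The predicate `p` carries a property of the approximants, here vanishing on the boundary, into
the set whose closure is taken. -/
theorem H1.mem_closure_of_contDiff_approx {Ω : Set (E d)} (hb : Bornology.IsBounded Ω)
    {S : Set (H1 Ω)} {p : (E d → ℝ) → Prop} (hS : ∀ (w' : H1 Ω) (φ : E d → ℝ), ContDiff ℝ ∞ φ →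
      fn w' =ᵐ[volume.restrict Ω] φ → p φ → w' ∈ S) {w : H1 Ω}
    {g : E d → ℝ} {G : E d → E d} (hw : fn w =ᵐ[volume.restrict Ω] g)
    (hw' : grad w =ᵐ[volume.restrict Ω] G)
    (h : ∀ ε : ℝ≥0∞, ε ≠ 0 → ∃ φ : E d → ℝ, ContDiff ℝ ∞ φ ∧ ∫⁻ x, ‖φ x - g x‖ₑ ^ 2 ≤ ε ∧
      ∫⁻ x, ‖gradient φ x - G x‖ₑ ^ 2 ≤ ε ∧ p φ) : w ∈ closure S := by
  have h' : ∀ ε : ℝ≥0∞, ε ≠ 0 → ∃ w' ∈ S, ∃ φ : E d → ℝ, fn w' =ᵐ[volume.restrict Ω] φ ∧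
      grad w' =ᵐ[volume.restrict Ω] gradient φ ∧
      ∫⁻ x, ‖φ x - g x‖ₑ ^ 2 ≤ ε ∧ ∫⁻ x, ‖gradient φ x - G x‖ₑ ^ 2 ≤ ε := by
    intro ε hε
    obtain ⟨φ, hφ, h1, h2, h3⟩ := h ε hε
    have hφ1 : ContDiff ℝ 1 φ := hφ.of_le (by simp)
    obtain ⟨w', h4, h5⟩ := exists_of_contDiff hb hφ1
    exact ⟨w', hS w' φ hφ h4 h3, φ, h4, h5, h1, h2⟩
  choose! w' hwS f h1 h2 h3 h4 using h'
  have key : ∀ ε : ℝ≥0∞, ε ≠ 0 → ‖w' (ε / 2) - w‖ₑ ^ 2 ≤ ε := fun ε hε =>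
    have hε' : ε / 2 ≠ 0 := by simpa using hε
    ((enorm_sub_sq_le (h1 _ hε') (h2 _ hε') hw hw').trans
      (add_le_add (h3 _ hε') (h4 _ hε'))).trans (ENNReal.add_halves ε).le
  exact mem_closure_of_enorm_sq_le fun ε hε =>
    ⟨w' (ε / 2), hwS _ (by simpa using hε), key ε hε⟩

/-- A compactly supported Lipschitz function that vanishes near `∂Ω` has zero trace. -/
theorem H1.exists_of_lipschitzWith {Ω : Set (E d)} (hb : Bornology.IsBounded Ω) {C : ℝ≥0}
    {ψ : E d → ℝ} (hψ : LipschitzWith C ψ) (hc : HasCompactSupport ψ)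
    (h0 : ∀ᶠ x in 𝓝ˢ (frontier Ω), ψ x = 0) :
    ∃ w : H1 Ω, fn w =ᵐ[volume.restrict Ω] ψ ∧ grad w =ᵐ[volume.restrict Ω] gradient ψ ∧
      (w, 0) ∈ traceGraph Ω := by
  have hψm : MemLp ψ 2 := hψ.continuous.memLp_of_hasCompactSupport hc
  have hGm := memLp_gradient_of_lipschitzWith hψ hc
  have hK : IsCompact (frontier Ω) :=
    hb.isCompact_closure.of_isClosed_subset isClosed_frontier frontier_subset_closure
  obtain ⟨w, hw1, hw2⟩ := exists_mk (hψm.restrict Ω) (hGm.restrict Ω)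
    (hasWeakFDeriv_gradient_of_lipschitzWith hψ Ω)
  refine ⟨w, hw1, hw2, ?_⟩
  have hS : ∀ (w' : H1 Ω) (φ : E d → ℝ), ContDiff ℝ ∞ φ → fn w' =ᵐ[volume.restrict Ω] φ →
      (∀ y ∈ frontier Ω, φ y = 0) → (w', (0 : Lp ℝ 2 (surface Ω))) ∈ smoothTraceGraph Ω := by
    intro w' φ hφ h4 h3
    refine ⟨φ, hφ, h4, ?_⟩
    filter_upwards [Lp.coeFn_zero ℝ 2 (surface Ω),
      ae_restrict_mem isClosed_frontier.measurableSet] with y hy hyF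
    exact hy.trans (h3 y hyF).symm
  have hcl := mem_closure_of_contDiff_approx hb (p := fun φ => ∀ y ∈ frontier Ω, φ y = 0)
    (S := {w' : H1 Ω | (w', (0 : Lp ℝ 2 (surface Ω))) ∈ smoothTraceGraph Ω}) hS hw1 hw2
    fun ε hε => exists_contDiff_approx_of_lipschitzWith hK hψ hc h0 hε
  exact map_mem_closure (f := fun w' : H1 Ω => (w', (0 : Lp ℝ 2 (surface Ω))))
    (by fun_prop) hcl fun w' hw' => hw'

/-! ### Pullback of `H^1` functions by maps fixing the boundary. -/

section Abstract

/-- Bounded operators on the components of a space, that are compatible with it on a dense set,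
induce an operator on it. -/
theorem exists_clm_of_components {V A B : Type*} [NormedAddCommGroup V] [NormedSpace ℝ V]
    [CompleteSpace V] [NormedAddCommGroup A] [NormedSpace ℝ A] [NormedAddCommGroup B]
    [NormedSpace ℝ B] (P : V →L[ℝ] A) (Q : V →L[ℝ] B) (hPQ : ∀ v, ‖v‖ ≤ ‖P v‖ + ‖Q v‖)
    (L₀ : A →L[ℝ] A) (L₁ : B →L[ℝ] B) {S : Set V} (hS : ∀ v, v ∈ closure S)
    (h : ∀ w ∈ S, ∃ w', P w' = L₀ (P w) ∧ Q w' = L₁ (Q w)) :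
    ∃ J : V →L[ℝ] V, ∀ w, P (J w) = L₀ (P w) ∧ Q (J w) = L₁ (Q w) := by
  let G₀ : Submodule ℝ (V × V) := LinearMap.ker
    ((P.comp (.snd ℝ V V) - (L₀.comp P).comp (.fst ℝ V V) : V × V →L[ℝ] A) : V × V →ₗ[ℝ] A)
  let G₁ : Submodule ℝ (V × V) := LinearMap.ker
    ((Q.comp (.snd ℝ V V) - (L₁.comp Q).comp (.fst ℝ V V) : V × V →L[ℝ] B) : V × V →ₗ[ℝ] B)
  have hG : ∀ p : V × V, p ∈ G₀ ⊓ G₁ ↔ P p.2 = L₀ (P p.1) ∧ Q p.2 = L₁ (Q p.1) := fun p => by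
    simp [G₀, G₁, sub_eq_zero]
  -- The compatible pairs already form a closed subspace, so the extended operator satisfies both
  -- component identities.
  have hcl : IsClosed ((G₀ ⊓ G₁ : Submodule ℝ (V × V)) : Set (V × V)) :=
    (ContinuousLinearMap.isClosed_ker _).inter (ContinuousLinearMap.isClosed_ker _)
  obtain ⟨J, hJ⟩ := exists_clm_of_graph (G₀ ⊓ G₁) (C := ‖L₀‖ * ‖P‖ + ‖L₁‖ * ‖Q‖) (by positivity)
    (fun p hp => by
      obtain ⟨h1, h2⟩ := (hG p).1 hp
      refine (hPQ p.2).trans ?_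
      rw [h1, h2, add_mul, mul_assoc, mul_assoc]
      gcongr
      · exact L₀.le_of_opNorm_le_of_le le_rfl (P.le_opNorm _)
      · exact L₁.le_of_opNorm_le_of_le le_rfl (Q.le_opNorm _))
    (fun v => closure_mono (fun w hw => by
      obtain ⟨w', hw'⟩ := h w hw
      exact ⟨w', (hG (w, w')).2 hw'⟩) (hS v))
  refine ⟨J, fun w => ?_⟩
  have h1 := (hJ w (J w)).2 rfl
  rw [hcl.submodule_topologicalClosure_eq] at h1
  exact (hG (w, J w)).1 h1

end Abstract

theorem norm_le_add_of_sq_eq {a b c : ℝ≥0} (h : (a : ℝ) ^ 2 = (b : ℝ) ^ 2 + (c : ℝ) ^ 2) :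
    (a : ℝ) ≤ b + c :=
  abs_le_of_sq_le_sq' (by rw [h]; nlinarith [mul_nonneg b.coe_nonneg c.coe_nonneg])
    (by positivity) |>.2

/-- `T` is a bi-Lipschitz homeomorphism that maps `Ω` onto itself and is the identity near `∂Ω`. -/
structure FixesBoundary (Ω : Set (E d)) (T : E d ≃ₜ E d) : Prop where
  lipschitz : ∃ K, LipschitzWith K T
  lipschitz_symm : ∃ K, LipschitzWith K T.symm
  eventually_eq : ∀ᶠ x in 𝓝ˢ (frontier Ω), T x = x
  mem_iff : ∀ x, T x ∈ Ω ↔ x ∈ Ω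

/-- `w'` is `w ∘ T`, with the gradient given by the chain rule and the trace of `w`. -/
structure IsPullback {Ω : Set (E d)} (T : E d ≃ₜ E d) (w w' : H1 Ω) : Prop where
  fn_eq : fn w' =ᵐ[volume.restrict Ω] fun x => fn w (T x)
  grad_eq : grad w' =ᵐ[volume.restrict Ω]
    fun x => ContinuousLinearMap.adjoint (fderiv ℝ T x) (grad w (T x))
  isTrace : ∀ γ, IsTrace w γ → IsTrace w' γ

namespace FixesBoundary

variable {Ω : Set (E d)} {T : E d ≃ₜ E d}

theorem symm (hT : FixesBoundary Ω T) : FixesBoundary Ω T.symm where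
  lipschitz := hT.lipschitz_symm
  lipschitz_symm := hT.lipschitz
  eventually_eq := hT.eventually_eq.mono fun x hx => by rw [T.symm_apply_eq, hx]
  mem_iff x := by rw [← hT.mem_iff, T.apply_symm_apply]

theorem volume_image_le {K : ℝ≥0} {S : E d → E d} (hS : LipschitzWith K S) (A : Set (E d)) :
    volume (S '' A) ≤ (K : ℝ≥0∞) ^ d * volume A := by
  have h := euclideanHausdorffMeasure_image_le hS d A
  rwa [EuclideanSpace.euclideanHausdorffMeasure_eq_volume] at h

/-- Preimages under `T` are images under the Lipschitz inverse, which enlarges volume by at most a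
fixed factor. -/
theorem exists_map_le (hT : FixesBoundary Ω T) :
    ∃ c : ℝ≥0, (volume.restrict Ω).map T ≤ c • volume.restrict Ω := by
  obtain ⟨K, hK⟩ := hT.lipschitz_symm
  refine ⟨K ^ d, Measure.le_iff.2 fun B hB => ?_⟩
  have hTB : MeasurableSet (T ⁻¹' B) := T.measurable hB
  rw [Measure.map_apply T.measurable hB, Measure.restrict_apply hTB, Measure.smul_apply,
    Measure.restrict_apply hB]
  have h : T ⁻¹' B ∩ Ω = T.symm '' (B ∩ Ω) := by
    rw [T.image_symm, preimage_inter]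
    congr 1
    ext x
    exact (hT.mem_iff x).symm
  rw [h]
  refine (volume_image_le hK _).trans (le_of_eq ?_)
  rw [ENNReal.smul_def, ENNReal.coe_pow, smul_eq_mul]

theorem quasiMeasurePreserving (hT : FixesBoundary Ω T) :
    Measure.QuasiMeasurePreserving T (volume.restrict Ω) (volume.restrict Ω) := by
  obtain ⟨c, hc⟩ := hT.exists_map_le
  exact ⟨T.measurable, Measure.absolutelyContinuous_of_le_smul hc⟩

/-- The pullback of gradients. -/
theorem exists_pullback (hT : FixesBoundary Ω T) :
    ∃ L : Lp (E d) 2 (volume.restrict Ω) →L[ℝ] Lp (E d) 2 (volume.restrict Ω), ∀ G,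
      L G =ᵐ[volume.restrict Ω] fun x => ContinuousLinearMap.adjoint (fderiv ℝ T x) (G (T x)) := by
  obtain ⟨c, hc⟩ := hT.exists_map_le
  obtain ⟨K, hK⟩ := hT.lipschitz
  obtain ⟨L₁, h₁⟩ := exists_lpComp (F := E d) T.measurable hc
  have hm : AEStronglyMeasurable (fun x => ContinuousLinearMap.adjoint (fderiv ℝ T x))
      (volume.restrict Ω) :=
    (ContinuousLinearMap.adjoint (𝕜 := ℝ) (E := E d)
      (F := E d)).continuous.comp_aestronglyMeasurable
      (measurable_fderiv ℝ T).aestronglyMeasurable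
  obtain ⟨L₂, h₂⟩ := exists_lpMul hm (C := K) (Eventually.of_forall fun x => by
    rw [LinearIsometryEquiv.norm_map]
    exact norm_fderiv_le_of_lipschitz ℝ hK)
  refine ⟨L₂.comp L₁, fun G => ?_⟩
  filter_upwards [h₁ G, h₂ (L₁ G)] with x hx hx'
  rw [ContinuousLinearMap.comp_apply, hx', hx]

theorem eventually_comp_sub_eq_zero (hT : FixesBoundary Ω T) (φ : E d → ℝ) :
    ∀ᶠ x in 𝓝ˢ (frontier Ω), φ (T x) - φ x = 0 :=
  hT.eventually_eq.mono fun x hx => by rw [hx, sub_self]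

theorem ae_gradient_comp_sub (hT : FixesBoundary Ω T) {φ : E d → ℝ} (hφ : ContDiff ℝ 1 φ) :
    ∀ᵐ x, gradient (fun x => φ (T x) - φ x) x =
      ContinuousLinearMap.adjoint (fderiv ℝ T x) (gradient φ (T x)) - gradient φ x := by
  obtain ⟨K, hK⟩ := hT.lipschitz
  filter_upwards [hK.ae_differentiableAt (μ := volume)] with x hx
  have hd : ∀ y, HasFDerivAt φ (fderiv ℝ φ y) y := fun y =>
    (hφ.differentiable one_ne_zero y).hasFDerivAt
  refine gradient_eq_of_hasFDerivAt ?_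
  have h := ((hd (T x)).comp x hx.hasFDerivAt).sub (hd x)
  convert! h using 1
  ext v
  simp [ContinuousLinearMap.adjoint_inner_left, inner_gradient_left]

/-- The cutoff leaves the function unchanged on `Ω` and makes it globally Lipschitz, so that its
composition with `T` is Lipschitz too. -/
theorem exists_hasCompactSupport_eqOn (hb : Bornology.IsBounded Ω) {φ : E d → ℝ}
    (hφ : ContDiff ℝ ∞ φ) :
    ∃ φ' : E d → ℝ, ContDiff ℝ ∞ φ' ∧ HasCompactSupport φ' ∧ EqOn φ φ' Ω := by
  obtain ⟨R, hR⟩ := hb.subset_ball (0 : E d)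
  let b : ContDiffBump (0 : E d) := ⟨|R| + 1, |R| + 2, by positivity, by linarith⟩
  refine ⟨fun x => b x * φ x, b.contDiff.mul hφ, b.hasCompactSupport.mul_right, fun x hx => ?_⟩
  have h : b x = 1 := b.one_of_mem_closedBall (Metric.ball_subset_closedBall
    (Metric.ball_subset_ball ((le_abs_self R).trans (by simp [b])) (hR hx)))
  simp [h]

/-- Composition of smooth functions with `T`. -/
theorem exists_isPullback_of_mem_smoothFns (hΩ : IsBoundedLipschitzDomain Ω)
    (hT : FixesBoundary Ω T) {w : H1 Ω} (hws : w ∈ H1.smoothFns Ω) :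
    ∃ w' : H1 Ω, IsPullback T w w' := by
  have hq := hT.quasiMeasurePreserving
  obtain ⟨K, hK⟩ := hT.lipschitz
  obtain ⟨φ₀, hφ₀, hw₀⟩ := hws
  obtain ⟨φ, hφ, hc, hφe⟩ := exists_hasCompactSupport_eqOn hΩ.isBounded hφ₀
  have hw : fn w =ᵐ[volume.restrict Ω] φ := by
    filter_upwards [hw₀, ae_restrict_mem hΩ.isOpen.measurableSet] with x h1 h2
    rw [h1, hφe h2]
  have hφ1 : ContDiff ℝ 1 φ := hφ.of_le (by simp)
  have hw' := H1.grad_ae_eq_gradient hΩ.isOpen hΩ.isBounded hφ1 hw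
  obtain ⟨C, hC⟩ := hφ1.lipschitzWith_of_hasCompactSupport hc one_ne_zero
  have hcT : HasCompactSupport fun x => φ (T x) - φ x :=
    (hc.comp_homeomorph T).sub hc
  -- Write `φ ∘ T = (φ ∘ T - φ) + φ`. The difference vanishes near `∂Ω`, hence has zero trace, so
  -- the composition inherits the trace of `φ`.
  obtain ⟨w₀, h1, h2, h3⟩ := H1.exists_of_lipschitzWith hΩ.isBounded ((hC.comp hK).sub hC) hcT
    (hT.eventually_comp_sub_eq_zero φ)
  refine ⟨w₀ + w, ?_, ?_, fun γ hγ => ?_⟩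
  · filter_upwards [h1, hw, Lp.coeFn_add (fn w₀) (fn w), hq.ae hw] with x e1 e2 e3 e4
    refine e3.trans ?_
    rw [Pi.add_apply, e1, e2, e4]
    simp
  · filter_upwards [h2, hw', Lp.coeFn_add (grad w₀) (grad w),
      ae_restrict_of_ae (hT.ae_gradient_comp_sub hφ1), hq.ae hw'] with x e1 e2 e3 e4 e5
    refine e3.trans ?_
    rw [Pi.add_apply, e1, e2, e5]
    refine (congrArg (· + gradient φ x) e4).trans ?_
    simp
  · have h4 := (traceGraph Ω).add_mem h3 hγ
    rwa [Prod.mk_add_mk, zero_add] at h4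

-- Composition and the chain-rule action on gradients are bounded on `L²` and compatible on smooth
-- functions, so they induce a bounded operator on `H^1(Ω)`. Invariance of the trace extends by
-- continuity from the same dense set.
set_option maxHeartbeats 1000000 in
theorem exists_isPullback (hΩ : IsBoundedLipschitzDomain Ω) (hT : FixesBoundary Ω T) (w : H1 Ω) :
    ∃ w' : H1 Ω, IsPullback T w w' := by
  obtain ⟨c, hc⟩ := hT.exists_map_le
  obtain ⟨L₀, hL₀⟩ := exists_lpComp (F := ℝ) T.measurable hc
  obtain ⟨L₁, hL₁⟩ := hT.exists_pullback
  obtain ⟨tr, htr⟩ := hΩ.exists_trace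
  have key : ∀ w ∈ (H1.smoothFns Ω : Set (H1 Ω)), ∃ w' : H1 Ω,
      fn w' = L₀ (fn w) ∧ grad w' = L₁ (grad w) ∧ tr w' = tr w := fun w hw =>
    (hT.exists_isPullback_of_mem_smoothFns hΩ hw).imp fun w' h =>
      ⟨Lp.ext (h.fn_eq.trans (hL₀ _).symm), Lp.ext (h.grad_eq.trans (hL₁ _).symm),
        ((htr _ _).1 (h.isTrace ⟨tr w, ⟨(w, tr w), (htr w _).2 rfl, rfl⟩⟩ ((htr w _).2 rfl))).symm⟩
  have hPQ : ∀ w : H1 Ω, ‖w‖ ≤ ‖H1.fnL Ω w‖ + ‖H1.gradL Ω w‖ := fun w =>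
    norm_le_add_of_sq_eq (a := ‖w‖₊) (b := ‖fn w‖₊) (c := ‖grad w‖₊) (H1.norm_sq w)
  obtain ⟨J, hJ⟩ := exists_clm_of_components (H1.fnL Ω) (H1.gradL Ω) hPQ L₀ L₁
    hΩ.dense_smoothFns fun w hw => (key w hw).imp fun w' h => ⟨h.1, h.2.1⟩
  have hJ₀ : ∀ w, fn (J w) = L₀ (fn w) := fun w => (hJ w).1
  have hJ₁ : ∀ w, grad (J w) = L₁ (grad w) := fun w => (hJ w).2
  have hJeq : ∀ w w', fn w' = L₀ (fn w) → w' = J w := fun w w' h =>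
    H1.ext_fn hΩ.isOpen (by rw [h, hJ₀])
  have hJtr : EqOn (tr.comp J) tr (H1.smoothFns Ω : Set (H1 Ω)) := fun w hw =>
    (key w hw).elim fun w' h => (congrArg tr (hJeq w w' h.1)).symm.trans h.2.2
  refine ⟨J w, ?_, ?_, fun γ hγ => ?_⟩
  · rw [hJ₀]
    exact hL₀ (fn w)
  · rw [hJ₁]
    exact hL₁ (grad w)
  · exact (htr _ _).2 (((htr _ _).1 hγ).trans
      (hJtr.closure (tr.comp J).continuous tr.continuous (hΩ.dense_smoothFns w)).symm)

end FixesBoundary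

/-! ### The maps `Φ_t` as homeomorphisms preserving the domain. -/

theorem norm_sub_le_two_mul_norm_Phi_sub {U : E d → E d} {K : ℝ≥0} (hU : LipschitzWith K U) {t : ℝ}
    (ht : |t| * K ≤ 1 / 2) (x y : E d) : ‖x - y‖ ≤ 2 * ‖Phi U t x - Phi U t y‖ := by
  have h1 : Phi U t x - Phi U t y = (x - y) + t • (U x - U y) := by
    simp only [Phi, smul_sub]; abel
  have h2 : ‖t • (U x - U y)‖ ≤ 1 / 2 * ‖x - y‖ := by
    rw [norm_smul, Real.norm_eq_abs]
    calc |t| * ‖U x - U y‖ ≤ |t| * (K * ‖x - y‖) := by gcongr; exact hU.norm_sub_le x y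
      _ = |t| * K * ‖x - y‖ := by ring
      _ ≤ _ := by gcongr
  have h3 : ‖x - y‖ ≤ ‖(x - y) + t • (U x - U y)‖ + ‖t • (U x - U y)‖ := by
    simpa using norm_sub_le ((x - y) + t • (U x - U y)) (t • (U x - U y))
  rw [h1]
  linarith

theorem injective_Phi {U : E d → E d} {K : ℝ≥0} (hU : LipschitzWith K U) {t : ℝ}
    (ht : |t| * K ≤ 1 / 2) : Function.Injective (Phi U t) := fun x y h => by
  have h1 := norm_sub_le_two_mul_norm_Phi_sub hU ht x y
  rw [h, sub_self, norm_zero, mul_zero] at h1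
  exact sub_eq_zero.1 (norm_le_zero_iff.1 h1)

/-- A perturbation of the identity with Lipschitz constant at most `1 / 2` is a global
homeomorphism, by the quantitative inverse function theorem. -/
theorem exists_homeomorph_Phi {U : E d → E d} {K : ℝ≥0} (hU : LipschitzWith K U) {t : ℝ}
    (ht : |t| * K ≤ 1 / 2) : ∃ T : E d ≃ₜ E d, ⇑T = Phi U t := by
  have h : ApproximatesLinearOn (Phi U t)
      ((ContinuousLinearEquiv.refl ℝ (E d) : E d ≃L[ℝ] E d) : E d →L[ℝ] E d) univ
      (1 / 2 : ℝ≥0) := by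
    intro x _ y _
    have h1 : Phi U t x - Phi U t y - (x - y) = t • (U x - U y) := by
      simp only [Phi, smul_sub]; abel
    rw [ContinuousLinearEquiv.coe_coe, ContinuousLinearEquiv.refl_apply, h1, norm_smul,
      Real.norm_eq_abs]
    calc |t| * ‖U x - U y‖ ≤ |t| * (K * ‖x - y‖) := by gcongr; exact hU.norm_sub_le x y
      _ = |t| * K * ‖x - y‖ := by ring
      _ ≤ _ := by gcongr; simpa using ht
  refine ⟨h.toHomeomorph (Phi U t) ?_, rfl⟩
  rcases subsingleton_or_nontrivial (E d) with hs | hs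
  · exact Or.inl hs
  · right
    have : ‖((ContinuousLinearEquiv.refl ℝ (E d)).symm : E d →L[ℝ] E d)‖₊ = 1 := by
      rw [ContinuousLinearEquiv.refl_symm, ContinuousLinearEquiv.coe_refl, ← NNReal.coe_inj]
      exact ContinuousLinearMap.norm_id
    rw [this, inv_one, div_lt_one (by norm_num)]
    norm_num

theorem inter_frontier_nonempty {X : Type*} [TopologicalSpace X] {S A : Set X}
    (hS : IsPreconnected S) (h1 : (S ∩ A).Nonempty) (h2 : (S ∩ Aᶜ).Nonempty) :
    (S ∩ frontier A).Nonempty := by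
  by_contra hne
  have hcov : ∀ x ∈ S, x ∈ interior A ∨ x ∈ interior Aᶜ := by
    intro x hx
    by_contra hcon
    rw [not_or, interior_compl, notMem_compl_iff] at hcon
    exact hne ⟨x, hx, hcon.2, hcon.1⟩
  obtain ⟨x, hxS, hxA⟩ := h1
  obtain ⟨y, hyS, hyA⟩ := h2
  obtain ⟨z, -, hz1, hz2⟩ := hS (interior A) (interior Aᶜ) isOpen_interior isOpen_interior hcov
    ⟨x, hxS, (hcov x hxS).resolve_right fun h => interior_subset h hxA⟩
    ⟨y, hyS, (hcov y hyS).resolve_left fun h => hyA (interior_subset h)⟩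
  exact interior_subset hz2 (interior_subset hz1)

/-- If `x` and `Φ_t x` were on different sides, the segment between them would meet `∂Ω` at some
`Φ_{st} x`. That point is fixed by `Φ_{st}`, so injectivity makes it equal to `x`. Then `x ∈ ∂Ω` is
fixed by `Φ_t`, a contradiction. -/
theorem Phi_mem_iff {Ω : Set (E d)} {U : E d → E d} {K : ℝ≥0} (hU : LipschitzWith K U) {t : ℝ}
    (ht : |t| * K ≤ 1 / 2) (hU0 : ∀ x ∈ frontier Ω, U x = 0) (x : E d) :
    Phi U t x ∈ Ω ↔ x ∈ Ω := by
  by_contra hne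
  have hx : x ∈ frontier Ω := by
    let c : ℝ → E d := fun s => x + (s * t) • U x
    have hc : Continuous c := by fun_prop
    have h0 : c 0 = x := by simp [c]
    have h1 : c 1 = Phi U t x := by simp [c, Phi]
    have hpre : IsPreconnected (c '' Icc 0 1) := isPreconnected_Icc.image c hc.continuousOn
    have m0 : x ∈ c '' Icc 0 1 := ⟨0, by simp, h0⟩
    have m1 : Phi U t x ∈ c '' Icc 0 1 := ⟨1, by simp, h1⟩
    obtain ⟨y, ⟨s, hs, rfl⟩, hy⟩ : (c '' Icc 0 1 ∩ frontier Ω).Nonempty := by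
      by_cases hxΩ : x ∈ Ω
      · exact inter_frontier_nonempty hpre ⟨x, m0, hxΩ⟩ ⟨_, m1, fun h => hne (by simp [h, hxΩ])⟩
      · exact inter_frontier_nonempty hpre ⟨_, m1, by tauto⟩ ⟨x, m0, hxΩ⟩
    have hst : |s * t| * K ≤ 1 / 2 := by
      refine le_trans ?_ ht
      rw [abs_mul, abs_of_nonneg hs.1]
      gcongr
      exact mul_le_of_le_one_left (abs_nonneg _) hs.2
    have h2 : Phi U (s * t) (c s) = Phi U (s * t) x := by
      rw [Phi, hU0 _ hy, smul_zero, add_zero]; rfl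
    rwa [injective_Phi hU hst h2] at hy
  exact hne (by rw [Phi, hU0 x hx, smul_zero, add_zero])

theorem fixesBoundary_of_eq_Phi {Ω : Set (E d)} {U : E d → E d} {K : ℝ≥0} (hU : LipschitzWith K U)
    {t : ℝ} (ht : |t| * K ≤ 1 / 2) (hU0 : ∀ᶠ x in 𝓝ˢ (frontier Ω), U x = 0) {T : E d ≃ₜ E d}
    (hT : ⇑T = Phi U t) : FixesBoundary Ω T where
  lipschitz := by
    rw [hT]
    exact ⟨_, LipschitzWith.id.add ((lipschitzWith_smul t).comp hU)⟩
  lipschitz_symm := by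
    refine ⟨2, LipschitzWith.of_dist_le_mul fun x y => ?_⟩
    have h := norm_sub_le_two_mul_norm_Phi_sub hU ht (T.symm x) (T.symm y)
    rw [← hT, T.apply_symm_apply, T.apply_symm_apply] at h
    simpa [dist_eq_norm] using h
  eventually_eq := hU0.mono fun x hx => by rw [hT, Phi, hx, smul_zero, add_zero]
  mem_iff x := by
    rw [hT]
    exact Phi_mem_iff hU ht (fun y hy => hU0.self_of_nhdsSet y hy) x

/-! ### Differentiating the pulled-back coefficient matrix. -/

section Algebra

variable {R : Type*} [NormedRing R] [NormedAlgebra ℝ R] [CompleteSpace R] [StarRing R]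
  [NormedStarGroup R]

/-- The product rule: inversion has derivative `-M` at the identity, the adjoint contributes `-star
M`, and the absolute value is locally inactive since `f 0 = 1`. -/
theorem exists_hasFDerivAt_abs_smul_inverse [StarModule ℝ R] {f : R → ℝ} {D : R →L[ℝ] ℝ}
    (hD : HasFDerivAt f D 0) (hf : f 0 = 1) : ∃ D' : R →L[ℝ] R,
      HasFDerivAt (fun M => |f M| • (Ring.inverse (1 + M) * star (Ring.inverse (1 + M)))) D' 0 ∧
      ∀ M, D' M = D M • (1 : R) - (M + star M) := by
  have hI : HasFDerivAt (fun M : R => Ring.inverse (1 + M)) (-ContinuousLinearMap.id ℝ R) 0 := by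
    have h1 := hasFDerivAt_ringInverse (𝕜 := ℝ) (1 : Rˣ)
    have h2 : HasFDerivAt (fun M : R => 1 + M) (ContinuousLinearMap.id ℝ _) 0 :=
      (hasFDerivAt_id 0).const_add 1
    rw [Units.val_one, ← add_zero (1 : R)] at h1
    convert! h1.comp 0 h2 using 1
    ext1 M
    simp
  have hS := (starL' ℝ : R ≃L[ℝ] R).hasFDerivAt.comp 0 hI
  have habs : (fun M => |f M|) =ᶠ[𝓝 0] f := by
    filter_upwards [hD.continuousAt.eventually (lt_mem_nhds (hf.symm ▸ one_pos))] with M hM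
    exact abs_of_pos hM
  refine ⟨_, (hD.congr_of_eventuallyEq habs).smul (hI.mul' hS), fun M => ?_⟩
  simp [hf]
  abel

theorem continuousAt_abs_smul_inverse {f : R → ℝ} (hf : Continuous f) {M : R}
    (hM : IsUnit (1 + M)) :
    ContinuousAt (fun M => |f M| • (Ring.inverse (1 + M) * star (Ring.inverse (1 + M)))) M := by
  have h1 : ContinuousAt (fun M : R => 1 + M) M := by fun_prop
  have h2 : ContinuousAt (fun M : R => Ring.inverse (1 + M)) M :=
    ContinuousAt.comp (g := Ring.inverse) (NormedRing.inverse_continuousAt hM.unit) h1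
  exact hf.continuousAt.abs.smul (h2.mul h2.star)

end Algebra

section LinearAlgebra

theorem differentiable_det : Differentiable ℝ fun M : E d →L[ℝ] E d => M.det := by
  let b := (EuclideanSpace.basisFun (Fin d) ℝ).toBasis
  let ℓ : Fin d → Fin d → (E d →L[ℝ] E d) →L[ℝ] ℝ := fun i j =>
    LinearMap.toContinuousLinearMap
      { toFun := fun M => LinearMap.toMatrix b b (M : E d →ₗ[ℝ] E d) i j
        map_add' := fun M N => by simp
        map_smul' := fun c M => by simp }
  have h : (fun M : E d →L[ℝ] E d => M.det) =
      fun M => ∑ τ : Equiv.Perm (Fin d), Equiv.Perm.sign τ • ∏ i, ℓ (τ i) i M := by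
    ext M
    rw [ContinuousLinearMap.det, ← LinearMap.det_toMatrix b, Matrix.det_apply]
    rfl
  rw [h]
  refine Differentiable.fun_sum fun τ _ => ?_
  simp only [Units.smul_def, zsmul_eq_mul]
  refine (differentiable_const _).mul ?_
  exact (contDiff_prod (n := 1) fun i _ => (ℓ (τ i) i).contDiff).differentiable one_ne_zero

/-- The determinant is a polynomial in `s` with constant term `1` and linear coefficient the trace;
the remainder carries a factor `s ^ 2`. -/
theorem hasDerivAt_det_one_add_smul (M : E d →L[ℝ] E d) :
    HasDerivAt (fun s : ℝ => (1 + s • M).det) (LinearMap.trace ℝ (E d) (M : E d →ₗ[ℝ] E d)) 0 := by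
  let b := (EuclideanSpace.basisFun (Fin d) ℝ).toBasis
  set A := LinearMap.toMatrix b b (M : E d →ₗ[ℝ] E d) with hA
  set p := (1 + (Polynomial.X : Polynomial ℝ) • A.map ⇑Polynomial.C).det.divX.divX with hp
  have h : (fun s : ℝ => (1 + s • M).det) = fun s => 1 + A.trace * s + p.eval s * s ^ 2 := by
    ext s
    rw [← Matrix.det_one_add_smul, ContinuousLinearMap.det, ← LinearMap.det_toMatrix b, hA]
    congr 1
    have : ((1 + s • M : E d →L[ℝ] E d) : E d →ₗ[ℝ] E d) = 1 + s • (M : E d →ₗ[ℝ] E d) := rfl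
    rw [this, map_add, map_smul, LinearMap.toMatrix_one]
  rw [h, LinearMap.trace_eq_matrix_trace ℝ b]
  have h1 := (((hasDerivAt_id (0 : ℝ)).const_mul A.trace).const_add 1).add
    ((p.hasDerivAt 0).mul (hasDerivAt_pow 2 (0 : ℝ)))
  convert! h1 using 1
  simp [hA]

theorem exists_hasFDerivAt_det_one_add :
    ∃ D : (E d →L[ℝ] E d) →L[ℝ] ℝ, HasFDerivAt (fun M : E d →L[ℝ] E d => (1 + M).det) D 0 ∧
      ∀ M : E d →L[ℝ] E d, D M = LinearMap.trace ℝ (E d) (M : E d →ₗ[ℝ] E d) := by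
  have hd : HasFDerivAt (fun M : E d →L[ℝ] E d => (1 + M).det) _ 0 :=
    ((differentiable_det.comp ((differentiable_const 1).add differentiable_id)) 0).hasFDerivAt
  refine ⟨_, hd, fun M => ?_⟩
  have h1 : HasDerivAt (fun s : ℝ => s • M) M 0 := by
    simpa using (hasDerivAt_id (0 : ℝ)).smul_const M
  rw [← zero_smul ℝ M] at hd
  have h2 := hd.comp_hasDerivAt (0 : ℝ) h1
  rw [zero_smul] at h2
  exact h2.unique (hasDerivAt_det_one_add_smul M)

/-- The coefficient matrix of the Dirichlet form pulled back by a map with Jacobian `1 + M`. -/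
def pulledMatrix (M : E d →L[ℝ] E d) : E d →L[ℝ] E d :=
  |(1 + M).det| • (Ring.inverse (1 + M) * star (Ring.inverse (1 + M)))

theorem det_one_clm : (1 : E d →L[ℝ] E d).det = 1 := by
  rw [ContinuousLinearMap.det]
  exact LinearMap.det_id

theorem pulledMatrix_zero : pulledMatrix (0 : E d →L[ℝ] E d) = 1 := by
  simp [pulledMatrix, det_one_clm]

/-- The origin of `𝒜`: the determinant contributes the divergence and the two inverse factors the
symmetrised Jacobian. -/
theorem exists_hasFDerivAt_pulledMatrix :
    ∃ D : (E d →L[ℝ] E d) →L[ℝ] (E d →L[ℝ] E d), HasFDerivAt (pulledMatrix (d := d)) D 0 ∧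
      ∀ M : E d →L[ℝ] E d, D M = LinearMap.trace ℝ (E d) (M : E d →ₗ[ℝ] E d) •
        ContinuousLinearMap.id ℝ (E d) - (M + ContinuousLinearMap.adjoint M) := by
  obtain ⟨D, hD, hDM⟩ := exists_hasFDerivAt_det_one_add (d := d)
  obtain ⟨D', hD', hDM'⟩ := exists_hasFDerivAt_abs_smul_inverse hD
    (by rw [add_zero, det_one_clm])
  refine ⟨D', hD', fun M => ?_⟩
  rw [hDM', hDM]
  rfl

/-- Differentiability at the single point `0` gives estimates uniform over bounded `M`, since `t •
M` tends to `0` uniformly. With `M = DU x` this is uniformity in `x`. -/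
theorem eventually_norm_pulledMatrix_sub_le (R : ℝ) {ε : ℝ} (hε : 0 < ε) :
    ∀ᶠ t : ℝ in 𝓝 0, ∀ M : E d →L[ℝ] E d, ‖M‖ ≤ R → ‖pulledMatrix (t • M) - 1‖ ≤ ε ∧
      ‖pulledMatrix (t • M) - 1 - t • (LinearMap.trace ℝ (E d) (M : E d →ₗ[ℝ] E d) •
        ContinuousLinearMap.id ℝ (E d) - (M + ContinuousLinearMap.adjoint M))‖ ≤ ε * |t| := by
  obtain ⟨D, hD, hDM⟩ := exists_hasFDerivAt_pulledMatrix (d := d)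
  have hR : 0 < |R| + 1 := by positivity
  have h1 : ∀ᶠ N : E d →L[ℝ] E d in 𝓝 0, ‖pulledMatrix N - 1‖ ≤ ε := by
    have h := hD.continuousAt
    rw [ContinuousAt, pulledMatrix_zero] at h
    filter_upwards [Metric.tendsto_nhds.1 h ε hε] with N hN
    rw [← dist_eq_norm]
    exact hN.le
  have h2 : ∀ᶠ N : E d →L[ℝ] E d in 𝓝 0,
      ‖pulledMatrix N - 1 - D N‖ ≤ ε / (|R| + 1) * ‖N‖ := by
    have h := hD.isLittleO.bound (show 0 < ε / (|R| + 1) by positivity)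
    simpa [pulledMatrix_zero] using h
  obtain ⟨δ, hδ, H⟩ := Metric.eventually_nhds_iff.1 (h1.and h2)
  filter_upwards [Metric.ball_mem_nhds (0 : ℝ) (show 0 < δ / (|R| + 1) by positivity)]
    with t ht M hM
  rw [mem_ball_zero_iff, Real.norm_eq_abs, lt_div_iff₀ hR] at ht
  have hM' : ‖M‖ ≤ |R| + 1 := by linarith [le_abs_self R]
  have htM : ‖t • M‖ ≤ |t| * (|R| + 1) := by
    rw [norm_smul, Real.norm_eq_abs]
    gcongr
  obtain ⟨h3, h4⟩ := H (y := t • M) (by rw [dist_zero_right]; linarith)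
  refine ⟨h3, ?_⟩
  rw [map_smul, hDM] at h4
  refine h4.trans ?_
  calc ε / (|R| + 1) * ‖t • M‖ ≤ ε / (|R| + 1) * (|t| * (|R| + 1)) := by gcongr
    _ = ε * |t| := by field_simp

theorem isUnit_one_add {M : E d →L[ℝ] E d} (hM : ‖M‖ < 1) : IsUnit (1 + M) := by
  have h := isUnit_one_sub_of_norm_lt_one (x := -M) (by rwa [norm_neg])
  rwa [sub_neg_eq_add] at h

/-- The inverse factors cancel the adjoint Jacobians that the chain rule attaches to the two
gradients, leaving only the volume factor. -/
theorem inner_pulledMatrix {M : E d →L[ℝ] E d} (hM : ‖M‖ < 1) (p q : E d) :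
    ⟪pulledMatrix M (ContinuousLinearMap.adjoint (1 + M) p),
      ContinuousLinearMap.adjoint (1 + M) q⟫ = |(1 + M).det| * ⟪p, q⟫ := by
  have h1 := Ring.mul_inverse_cancel _ (isUnit_one_add hM)
  have h2 : star (Ring.inverse (1 + M)) * star (1 + M) = 1 := by rw [← star_mul, h1, star_one]
  rw [ContinuousLinearMap.adjoint_inner_right, pulledMatrix, ← ContinuousLinearMap.star_eq_adjoint]
  have h3 : (1 + M) ((|(1 + M).det| • (Ring.inverse (1 + M) * star (Ring.inverse (1 + M))))
      (star (1 + M) p)) = |(1 + M).det| • p := by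
    rw [smul_apply, map_smul]
    congr 1
    have : ((1 + M) * (Ring.inverse (1 + M) * star (Ring.inverse (1 + M))) * star (1 + M)) p
      = p := by
      rw [← mul_assoc, h1, one_mul, h2]; rfl
    exact this
  rw [h3, real_inner_smul_left]

theorem continuousAt_pulledMatrix {M : E d →L[ℝ] E d} (hM : ‖M‖ < 1) :
    ContinuousAt pulledMatrix M :=
  continuousAt_abs_smul_inverse
    (differentiable_det.continuous.comp (continuous_const.add continuous_id)) (isUnit_one_add hM)

/-- Continuity of the matrix function is available on the unit ball, where `1 + M` is invertible.
Since the field takes its values there a.e., replacing the function by `0` outside changes nothing.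
-/
theorem aestronglyMeasurable_pulledMatrix {α : Type*} [MeasurableSpace α] {μ : Measure α}
    {a : α → E d →L[ℝ] E d} (ha : AEStronglyMeasurable a μ) (h : ∀ᵐ x ∂μ, ‖a x‖ < 1) :
    AEStronglyMeasurable (fun x => pulledMatrix (a x)) μ := by
  classical
  have hm : Measurable ((Metric.ball (0 : E d →L[ℝ] E d) 1).piecewise pulledMatrix 0) := by
    refine ContinuousOn.measurable_piecewise (fun M hM => ?_) continuousOn_const
      measurableSet_ball
    exact (continuousAt_pulledMatrix (mem_ball_zero_iff.1 hM)).continuousWithinAt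
  refine (hm.comp_aemeasurable ha.aemeasurable).aestronglyMeasurable.congr ?_
  filter_upwards [h] with x hx
  exact piecewise_eq_of_mem _ _ _ (mem_ball_zero_iff.2 hx)

end LinearAlgebra

/-! ### Change of variables for bi-Lipschitz maps. -/

/-- The change of variables formula. -/
theorem FixesBoundary.setIntegral_comp {Ω : Set (E d)} {T : E d ≃ₜ E d} (hT : FixesBoundary Ω T)
    (hΩ : IsOpen Ω) (g : E d → ℝ) :
    ∫ x in Ω, |(fderiv ℝ T x).det| * g (T x) = ∫ x in Ω, g x := by
  obtain ⟨K, hK⟩ := hT.lipschitz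
  have hD : MeasurableSet {x | DifferentiableAt ℝ T x} := measurableSet_of_differentiableAt ℝ T
  set D := {x | DifferentiableAt ℝ T x} with hDdef
  have hD0 : volume Dᶜ = 0 := hK.ae_differentiableAt (μ := volume)
  have h := integral_image_eq_integral_abs_det_fderiv_smul volume (hΩ.measurableSet.inter hD)
    (f := T) (f' := fderiv ℝ T)
    (fun x hx => (show DifferentiableAt ℝ T x from hx.2).hasFDerivAt.hasFDerivWithinAt)
    T.injective.injOn g
  -- Points of non-differentiability are null by Rademacher, and their image under a Lipschitz map
  -- is null, so discarding them affects neither side.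
  have e1 : (T '' (Ω ∩ D) : Set (E d)) =ᵐ[volume] Ω := by
    refine (LE.le.eventuallyLE ?_).antisymm ?_
    · rintro _ ⟨x, hx, rfl⟩
      exact (hT.mem_iff x).2 hx.1
    · rw [ae_le_set]
      refine measure_mono_null ?_ (le_antisymm ((FixesBoundary.volume_image_le hK Dᶜ).trans
        (by rw [hD0, mul_zero])) zero_le)
      rintro y ⟨hy, hy'⟩
      obtain ⟨x, rfl⟩ := T.surjective y
      exact ⟨x, fun hx => hy' ⟨x, ⟨(hT.mem_iff x).1 hy, hx⟩, rfl⟩, rfl⟩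
  have e2 : (Ω ∩ D : Set (E d)) =ᵐ[volume] Ω := by
    refine (LE.le.eventuallyLE inter_subset_left).antisymm ?_
    rw [ae_le_set]
    exact measure_mono_null (fun x hx => fun hxD => hx.2 ⟨hx.1, hxD⟩) hD0
  rw [setIntegral_congr_set e1, setIntegral_congr_set e2] at h
  rw [h]
  rfl

/-! ### Abstract estimates for difference quotients. -/

section Abstract

variable {V L : Type*} [NormedAddCommGroup V] [InnerProductSpace ℝ V]
  [NormedAddCommGroup L] [InnerProductSpace ℝ L]

/-- Coercivity is applied to the error. Its `m`-component vanishes, so its full norm is controlled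
by the `D`-component alone. -/
theorem tendsto_of_tendsto_components (D : V →L[ℝ] L) (m : V →L[ℝ] ℝ) {C : ℝ}
    (H : ∀ w, ‖w‖ ^ 2 ≤ C * (‖D w‖ ^ 2 + m w ^ 2)) {v : ℝ → V} {u udot : V} {l : Filter ℝ}
    (hm : ∀ᶠ t in l, m (v t) = m u) (hm0 : m udot = 0)
    (hD : Tendsto (fun t => t⁻¹ • (D (v t) - D u)) l (𝓝 (D udot))) :
    Tendsto (fun t => t⁻¹ • (v t - u)) l (𝓝 udot) := by
  rw [tendsto_iff_norm_sub_tendsto_zero] at hD ⊢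
  have h1 : Tendsto (fun t => Real.sqrt (C * ‖t⁻¹ • (D (v t) - D u) - D udot‖ ^ 2)) l (𝓝 0) := by
    have h := ((hD.pow 2).const_mul C).sqrt
    simpa using h
  refine tendsto_of_tendsto_of_tendsto_of_le_of_le' tendsto_const_nhds h1
    (Eventually.of_forall fun t => norm_nonneg _) ?_
  filter_upwards [hm] with t ht
  refine Real.le_sqrt_of_sq_le ((H _).trans (le_of_eq ?_))
  rw [map_sub, map_smul, map_sub, map_sub, map_smul, map_sub, ht, hm0]
  simp

/-- The estimate behind the differentiability of the solution with respect to the coefficients. -/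
theorem norm_differenceQuotient_sub_le {S A A' : L →L[ℝ] L} {lam : ℝ} (hlam : 0 < lam)
    (hS : ∀ G, lam * ‖G‖ ^ 2 ≤ ⟪S G, G⟫) {t : ℝ} (ht : t ≠ 0) {a b c ζ : L}
    (hζ : ζ = t⁻¹ • (a - b) - c) (h1 : ⟪S (A a), ζ⟫ = ⟪S b, ζ⟫)
    (h2 : ⟪S c, ζ⟫ = -⟪S (A' b), ζ⟫) {ε : ℝ} (hA : ∀ G, ‖A G - G‖ ≤ ε * ‖G‖)
    (hA' : ∀ G, ‖A G - G - t • A' G‖ ≤ ε * |t| * ‖G‖) (hε : 0 ≤ ε) (hεS : ‖S‖ * ε ≤ lam / 2) :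
    ‖ζ‖ ≤ 2 * ‖S‖ / lam * ε * (‖b‖ + ‖c‖) := by
  -- The consistency error: `A a = b + t (ζ + c + e + A' b)`. The limit equation for `c` cancels the
  -- term with `A' b`, leaving `⟪S ζ, ζ⟫ = -⟪S e, ζ⟫`.
  set e : L := (A (ζ + c) - (ζ + c)) + t⁻¹ • (A b - b - t • A' b) with he
  have ha : a = b + t • (ζ + c) := by
    rw [hζ, sub_add_cancel, smul_inv_smul₀ ht, add_sub_cancel]
  have hAa : A a = b + t • (ζ + c) + t • e + t • A' b := by
    rw [he, ha, map_add, map_smul, smul_add t (A (ζ + c) - (ζ + c)), smul_inv_smul₀ ht, smul_sub]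
    abel
  have h3 : ⟪S ζ, ζ⟫ = -⟪S e, ζ⟫ := by
    rw [hAa] at h1
    simp only [map_add, map_smul, inner_add_left, real_inner_smul_left] at h1
    have h4 : t * (⟪S ζ, ζ⟫ + ⟪S e, ζ⟫) = 0 := by linear_combination h1 - t * h2
    have h5 := (mul_eq_zero.1 h4).resolve_left ht
    linarith
  have h4 : ‖e‖ ≤ ε * (‖ζ‖ + ‖c‖) + ε * ‖b‖ := by
    refine (norm_add_le _ _).trans (add_le_add ((hA _).trans ?_) ?_)
    · gcongr
      exact norm_add_le _ _
    · rw [norm_smul, norm_inv, Real.norm_eq_abs, inv_mul_le_iff₀ (abs_pos.2 ht)]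
      refine (hA' b).trans (le_of_eq (by ring))
  have h5 : lam * ‖ζ‖ ^ 2 ≤ ‖S‖ * (ε * (‖ζ‖ + ‖c‖) + ε * ‖b‖) * ‖ζ‖ := by
    calc lam * ‖ζ‖ ^ 2 ≤ ⟪S ζ, ζ⟫ := hS ζ
      _ = -⟪S e, ζ⟫ := h3
      _ ≤ |⟪S e, ζ⟫| := neg_le_abs _
      _ ≤ ‖S e‖ * ‖ζ‖ := abs_real_inner_le_norm _ _
      _ ≤ _ := by
        gcongr
        exact S.le_of_opNorm_le_of_le le_rfl h4
  rcases eq_or_lt_of_le (norm_nonneg ζ) with h0 | h0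
  · rw [← h0]; positivity
  have h6 : lam * ‖ζ‖ ≤ ‖S‖ * (ε * (‖ζ‖ + ‖c‖) + ε * ‖b‖) := by
    refine le_of_mul_le_mul_right ?_ h0
    linarith [sq ‖ζ‖]
  rw [div_mul_eq_mul_div, div_mul_eq_mul_div, le_div_iff₀ hlam]
  -- The part of the error bound proportional to `‖ζ‖` is absorbed on the left using `‖S‖ ε ≤ lam /
  -- 2`; this explains the factor `2` in the conclusion.
  nlinarith

end Abstract

/-! ### Coefficient fields as operators on `L²`. -/

section Coefficients

variable {α : Type*} [MeasurableSpace α] {μ : Measure α}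

theorem ae_norm_le_toReal_eLpNorm_top {F : Type*} [NormedAddCommGroup F] {f : α → F}
    (hf : MemLp f ⊤ μ) : ∀ᵐ x ∂μ, ‖f x‖ ≤ (eLpNorm f ⊤ μ).toReal := by
  have h : ∀ᵐ x ∂μ, ‖f x‖ₑ ≤ eLpNorm f ⊤ μ := by
    rw [eLpNorm_exponent_top]; exact enorm_ae_le_eLpNormEssSup f μ
  filter_upwards [h] with x hx
  rw [← toReal_enorm]
  exact ENNReal.toReal_mono hf.2.ne hx

theorem norm_lpMul_sub_le {F : Type*} [NormedAddCommGroup F] [NormedSpace ℝ F]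
    {a a' : α → F →L[ℝ] F} {A A' : Lp F 2 μ →L[ℝ] Lp F 2 μ}
    (hA : ∀ f, A f =ᵐ[μ] fun x => a x (f x)) (hA' : ∀ f, A' f =ᵐ[μ] fun x => a' x (f x)) {t C : ℝ}
    (h : ∀ᵐ x ∂μ, ‖a x - 1 - t • a' x‖ ≤ C) (f : Lp F 2 μ) : ‖A f - f - t • A' f‖ ≤ C * ‖f‖ := by
  refine Lp.norm_le_mul_norm_of_ae_le_mul ?_
  filter_upwards [hA f, hA' f, h, Lp.coeFn_sub (A f - f) (t • A' f), Lp.coeFn_sub (A f) f,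
    Lp.coeFn_smul t (A' f)] with x h1 h2 h3 h4 h5 h6
  rw [h4, Pi.sub_apply, h5, Pi.sub_apply, h6, Pi.smul_apply, h1, h2]
  exact (a x - 1 - t • a' x).le_of_opNorm_le h3 (f x)

theorem inner_lpMul_eq {F : Type*} [NormedAddCommGroup F] [InnerProductSpace ℝ F] {σ : α → ℝ}
    {S : Lp F 2 μ →L[ℝ] Lp F 2 μ}
    (hS : ∀ f, S f =ᵐ[μ] fun x => (σ x • ContinuousLinearMap.id ℝ F) (f x)) {f g : Lp F 2 μ}
    {f' : α → F} (hf : f =ᵐ[μ] f') : ⟪S f, g⟫ = ∫ x, σ x * ⟪f' x, g x⟫ ∂μ := by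
  rw [L2.inner_def]
  refine integral_congr_ae ?_
  filter_upwards [hS f, hf] with x h1 h2
  rw [h1, ← h2]
  simp [real_inner_smul_left]

theorem lpMul_coercive {F : Type*} [NormedAddCommGroup F] [InnerProductSpace ℝ F] {σ : α → ℝ}
    {S : Lp F 2 μ →L[ℝ] Lp F 2 μ}
    (hS : ∀ f, S f =ᵐ[μ] fun x => (σ x • ContinuousLinearMap.id ℝ F) (f x)) {lam : ℝ}
    (hσ : ∀ᵐ x ∂μ, lam ≤ σ x) (f : Lp F 2 μ) : lam * ‖f‖ ^ 2 ≤ ⟪S f, f⟫ := by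
  rw [← real_inner_self_eq_norm_sq, L2.inner_def, L2.inner_def, ← integral_const_mul]
  refine integral_mono_ae ((L2.integrable_inner f f).const_mul lam) (L2.integrable_inner _ f) ?_
  filter_upwards [hS f, hσ] with x h1 h2
  rw [h1]
  simp only [smul_apply, ContinuousLinearMap.id_apply, real_inner_smul_left]
  exact mul_le_mul_of_nonneg_right h2 real_inner_self_nonneg

end Coefficients

/-! ### The transported problem and its difference quotients. -/

theorem transported_Phi {U : E d → E d} {t : ℝ} (h : Function.Injective (Phi U t)) (σ : E d → ℝ)
    (x : E d) : transported U σ t (Phi U t x) = σ x :=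
  congrArg σ (Function.leftInverse_invFun h x)

theorem IsW1Infty.ae_fderiv_eq {U : E d → E d} {DU : E d → E d →L[ℝ] E d} (hU : IsW1Infty U DU)
    {t : ℝ} {T : E d ≃ₜ E d} (hT : ⇑T = Phi U t) : ∀ᵐ x, fderiv ℝ T x = 1 + t • DU x := by
  filter_upwards [hU.ae_hasFDerivAt] with x hx
  rw [hT]
  exact ((hasFDerivAt_id x).add (hx.const_smul t)).fderiv

/-- The transported problem in the reference configuration. -/
theorem setIntegral_pulledMatrix {Ω : Set (E d)} (hΩ : IsBoundedLipschitzDomain Ω) {U : E d → E d}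
    {DU : E d → E d →L[ℝ] E d} (hU : IsW1Infty U DU) {t : ℝ} (ht : ∀ᵐ x, ‖t • DU x‖ < 1)
    {T : E d ≃ₜ E d} (hT : ⇑T = Phi U t) (hTΩ : FixesBoundary Ω T) {σ : E d → ℝ}
    {g : Hhalf Ω →ₗ[ℝ] ℝ} {f : Hhalf Ω} {ut v : H1 Ω}
    (hut : IsNeumannSolution (transported U σ t) g f ut) (hv : IsPullback T ut v) {w : H1 Ω}
    {γ : Hhalf Ω} (hγ : IsTrace w γ) :
    ∫ x in Ω, σ x * ⟪pulledMatrix (t • DU x) (grad v x), grad w x⟫ = g γ := by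
  -- The problem for `u_t` is tested with `w ∘ T⁻¹`, which has the trace of `w`, so the right-hand
  -- side remains `g γ`. Pulling back once more recovers `w` and expresses its gradient through the
  -- chain rule.
  obtain ⟨w', hw'⟩ := hTΩ.symm.exists_isPullback hΩ w
  obtain ⟨w'', hw''⟩ := hTΩ.exists_isPullback hΩ w'
  have hww : w'' = w := by
    refine H1.ext_fn hΩ.isOpen (hw''.fn_eq.trans ?_)
    filter_upwards [hTΩ.quasiMeasurePreserving.ae hw'.fn_eq] with x hx
    rw [hx, T.symm_apply_apply]
  rw [hww] at hw''
  rw [← hut.weak_eq w' γ (hw'.isTrace γ hγ), ← hTΩ.setIntegral_comp hΩ.isOpen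
    fun x => transported U σ t x * ⟪grad ut x, grad w' x⟫]
  refine integral_congr_ae ?_
  filter_upwards [hv.grad_eq, hw''.grad_eq, ae_restrict_of_ae (hU.ae_fderiv_eq hT),
    ae_restrict_of_ae ht] with x h1 h2 h3 h4
  rw [h1, h2, h3, inner_pulledMatrix h4, hT, transported_Phi (hT ▸ T.injective)]
  ring

section MaterialDerivative

variable {Ω : Set (E d)} {σ : E d → ℝ} {U : E d → E d} {DU : E d → E d →L[ℝ] E d}

theorem exists_lpMul_conductivity (hσ : MemLp σ ⊤ (volume.restrict Ω)) :
    ∃ S : Lp (E d) 2 (volume.restrict Ω) →L[ℝ] Lp (E d) 2 (volume.restrict Ω), ∀ G,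
      S G =ᵐ[volume.restrict Ω] fun x => (σ x • ContinuousLinearMap.id ℝ (E d)) (G x) := by
  refine exists_lpMul (C := (eLpNorm σ ⊤ (volume.restrict Ω)).toReal)
    (hσ.1.smul aestronglyMeasurable_const) ?_
  filter_upwards [ae_norm_le_toReal_eLpNorm_top hσ] with x hx
  rw [norm_smul]
  refine (mul_le_of_le_one_right (norm_nonneg _) ContinuousLinearMap.norm_id_le).trans hx

theorem exists_lpMul_calA (hU : IsW1Infty U DU) (Ω : Set (E d)) :
    ∃ A : Lp (E d) 2 (volume.restrict Ω) →L[ℝ] Lp (E d) 2 (volume.restrict Ω), ∀ G,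
      A G =ᵐ[volume.restrict Ω] fun x => calA DU x (G x) := by
  obtain ⟨D, -, hD⟩ := exists_hasFDerivAt_pulledMatrix (d := d)
  -- As a fixed continuous linear image of `DU`, the field `𝒜` inherits measurability and essential
  -- boundedness.
  have h : calA DU = fun x => D (DU x) := funext fun x => (hD (DU x)).symm
  rw [h]
  refine exists_lpMul (C := ‖D‖ * (eLpNorm DU ⊤ volume).toReal)
    (D.continuous.comp_aestronglyMeasurable hU.memLp_deriv.1.restrict) (ae_restrict_of_ae ?_)
  filter_upwards [ae_norm_le_toReal_eLpNorm_top hU.memLp_deriv] with x hx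
  exact D.le_of_opNorm_le_of_le le_rfl hx

theorem eventually_abs_mul_le (a : ℝ) {b : ℝ} (hb : 0 < b) : ∀ᶠ t : ℝ in 𝓝[≠] 0, |t| * a ≤ b := by
  have h : Tendsto (fun t : ℝ => |t| * a) (𝓝[≠] 0) (𝓝 0) := by
    have : Continuous fun t : ℝ => |t| * a := by fun_prop
    simpa using (this.tendsto 0).mono_left nhdsWithin_le_nhds
  exact h.eventually (ge_mem_nhds hb)

theorem IsW1Infty.eventually_norm_smul_lt_one (hU : IsW1Infty U DU) :
    ∀ᶠ t : ℝ in 𝓝[≠] 0, ∀ᵐ x, ‖t • DU x‖ < 1 := by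
  filter_upwards [eventually_abs_mul_le (eLpNorm DU ⊤ volume).toReal one_half_pos] with t ht
  filter_upwards [ae_norm_le_toReal_eLpNorm_top hU.memLp_deriv] with x hx
  rw [norm_smul, Real.norm_eq_abs]
  calc |t| * ‖DU x‖ ≤ |t| * (eLpNorm DU ⊤ volume).toReal := by gcongr
    _ < 1 := by linarith

/-- The coefficients of the pulled back problem are differentiable in `t`, uniformly in `x`. -/
theorem IsW1Infty.eventually_exists_lpMul (hU : IsW1Infty U DU)
    {A' : Lp (E d) 2 (volume.restrict Ω) →L[ℝ] Lp (E d) 2 (volume.restrict Ω)}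
    (hA' : ∀ G, A' G =ᵐ[volume.restrict Ω] fun x => calA DU x (G x)) {ε : ℝ} (hε : 0 < ε) :
    ∀ᶠ t : ℝ in 𝓝[≠] 0,
      ∃ A : Lp (E d) 2 (volume.restrict Ω) →L[ℝ] Lp (E d) 2 (volume.restrict Ω),
        (∀ G, A G =ᵐ[volume.restrict Ω] fun x => pulledMatrix (t • DU x) (G x)) ∧
        (∀ G, ‖A G - G‖ ≤ ε * ‖G‖) ∧ ∀ G, ‖A G - G - t • A' G‖ ≤ ε * |t| * ‖G‖ := by
  have h := eventually_norm_pulledMatrix_sub_le (d := d) (eLpNorm DU ⊤ volume).toReal hε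
  filter_upwards [nhdsWithin_le_nhds h, hU.eventually_norm_smul_lt_one] with t ht h1
  have hb : ∀ᵐ x ∂(volume.restrict Ω), ‖DU x‖ ≤ (eLpNorm DU ⊤ volume).toReal :=
    ae_restrict_of_ae (ae_norm_le_toReal_eLpNorm_top hU.memLp_deriv)
  have hm : AEStronglyMeasurable (fun x => pulledMatrix (t • DU x)) (volume.restrict Ω) :=
    aestronglyMeasurable_pulledMatrix (hU.memLp_deriv.1.restrict.const_smul t)
      (ae_restrict_of_ae h1)
  have hn : ∀ᵐ x ∂(volume.restrict Ω), ‖pulledMatrix (t • DU x)‖ ≤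
      ε + ‖(1 : E d →L[ℝ] E d)‖ := by
    filter_upwards [hb] with x hx
    have h2 := (ht _ hx).1
    have h3 := norm_add_le (pulledMatrix (t • DU x) - 1) 1
    rw [sub_add_cancel] at h3
    linarith
  obtain ⟨A, hA⟩ := exists_lpMul hm hn
  refine ⟨A, hA, fun G => ?_, fun G => norm_lpMul_sub_le hA hA' ?_ G⟩
  -- With `t = 0` the first-order term drops out, and the same lemma gives the zeroth-order
  -- estimate.
  · have h2 := norm_lpMul_sub_le hA hA' (t := 0) (C := ε) ?_ G
    · rwa [zero_smul, sub_zero] at h2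
    · filter_upwards [hb] with x hx
      rw [zero_smul, sub_zero]
      exact (ht _ hx).1
  · filter_upwards [hb] with x hx
    exact (ht _ hx).2

theorem eventually_exists_isPullback (hΩ : IsBoundedLipschitzDomain Ω) (hU : IsW1Infty U DU)
    (hU0 : ∀ᶠ x in 𝓝ˢ (frontier Ω), U x = 0) (ut : ℝ → H1 Ω) :
    ∀ᶠ t : ℝ in 𝓝[≠] 0, ∃ T : E d ≃ₜ E d, ⇑T = Phi U t ∧ FixesBoundary Ω T ∧
      ∃ v, IsPullback T (ut t) v := by
  obtain ⟨K, hK⟩ := hU.exists_lipschitzWith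
  filter_upwards [eventually_abs_mul_le K one_half_pos] with t ht
  obtain ⟨T, hT⟩ := exists_homeomorph_Phi hK ht
  have hTΩ := fixesBoundary_of_eq_Phi hK ht hU0 hT
  exact ⟨T, hT, hTΩ, hTΩ.exists_isPullback hΩ (ut t)⟩

/-- A function that equals `ut t ∘ Φ_t` wherever the latter belongs to `H^1(Ω)`. -/
theorem exists_eq_comp_Phi (U : E d → E d) (ut : ℝ → H1 Ω) :
    ∃ v : ℝ → H1 Ω, ∀ t, (∃ v' : H1 Ω, fn v' =ᵐ[volume.restrict Ω] fn (ut t) ∘ Phi U t) →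
      fn (v t) =ᵐ[volume.restrict Ω] fn (ut t) ∘ Phi U t := by
  have h : ∀ t, ∃ v : H1 Ω, (∃ v' : H1 Ω, fn v' =ᵐ[volume.restrict Ω] fn (ut t) ∘ Phi U t) →
      fn v =ᵐ[volume.restrict Ω] fn (ut t) ∘ Phi U t := fun t => by
    by_cases h : ∃ v' : H1 Ω, fn v' =ᵐ[volume.restrict Ω] fn (ut t) ∘ Phi U t
    · exact h.imp fun v hv _ => hv
    · exact ⟨0, fun h' => absurd h' h⟩
  choose v hv using h
  exact ⟨v, hv⟩

theorem eventually_exists_isPullback_eq (hΩ : IsBoundedLipschitzDomain Ω) (hU : IsW1Infty U DU)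
    (hU0 : ∀ᶠ x in 𝓝ˢ (frontier Ω), U x = 0) {ut v : ℝ → H1 Ω}
    (hv : ∀ t, (∃ v' : H1 Ω, fn v' =ᵐ[volume.restrict Ω] fn (ut t) ∘ Phi U t) →
      fn (v t) =ᵐ[volume.restrict Ω] fn (ut t) ∘ Phi U t) :
    ∀ᶠ t : ℝ in 𝓝[≠] 0, ∃ T : E d ≃ₜ E d, ⇑T = Phi U t ∧ FixesBoundary Ω T ∧
      IsPullback T (ut t) (v t) := by
  filter_upwards [eventually_exists_isPullback hΩ hU hU0 ut] with t ht
  obtain ⟨T, hT, hTΩ, v', hpb⟩ := ht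
  have h1 : fn v' =ᵐ[volume.restrict Ω] fn (ut t) ∘ Phi U t := by
    rw [← hT]
    exact hpb.fn_eq
  have h2 : v' = v t := H1.ext_fn hΩ.isOpen (h1.trans (hv t ⟨v', h1⟩).symm)
  exact ⟨T, hT, hTΩ, h2 ▸ hpb⟩

/-- Convergence of the gradients of the difference quotients. -/
theorem tendsto_grad_differenceQuotient (hΩ : IsBoundedLipschitzDomain Ω) (hU : IsW1Infty U DU)
    {S A' : Lp (E d) 2 (volume.restrict Ω) →L[ℝ] Lp (E d) 2 (volume.restrict Ω)}
    (hS : ∀ G, S G =ᵐ[volume.restrict Ω]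
      fun x => (σ x • ContinuousLinearMap.id ℝ (E d)) (G x))
    (hA' : ∀ G, A' G =ᵐ[volume.restrict Ω] fun x => calA DU x (G x))
    {lam : ℝ} (hlam : 0 < lam) (hSlam : ∀ G, lam * ‖G‖ ^ 2 ≤ ⟪S G, G⟫)
    (htr : ∀ w : H1 Ω, ∃ γ : Hhalf Ω, IsTrace w γ)
    {g : Hhalf Ω →ₗ[ℝ] ℝ} {f : Hhalf Ω} {u udot : H1 Ω} (hu : IsNeumannSolution σ g f u)
    (hudot : ∀ w : H1 Ω, ⟪S (grad udot), grad w⟫ = -⟪S (A' (grad u)), grad w⟫)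
    {ut v : ℝ → H1 Ω}
    (hut : ∀ᶠ t in 𝓝[≠] (0 : ℝ), IsNeumannSolution (transported U σ t) g f (ut t))
    (hv : ∀ᶠ t : ℝ in 𝓝[≠] 0, ∃ T : E d ≃ₜ E d, ⇑T = Phi U t ∧ FixesBoundary Ω T ∧
      IsPullback T (ut t) (v t)) :
    Tendsto (fun t => t⁻¹ • (grad (v t) - grad u)) (𝓝[≠] 0) (𝓝 (grad udot)) := by
  rw [Metric.tendsto_nhds]
  intro η hη
  set q := 2 * ‖S‖ / lam * (‖grad u‖ + ‖grad udot‖) with hq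
  have hq0 : 0 ≤ q := by positivity
  -- The first entry permits the absorption in the energy estimate; the second makes the final bound
  -- `q ε` smaller than `η`.
  set ε := min (lam / (2 * (‖S‖ + 1))) (η / (q + 1)) with hεdef
  have hε : 0 < ε := by positivity
  have hεS : ‖S‖ * ε ≤ lam / 2 := by
    calc ‖S‖ * ε ≤ (‖S‖ + 1) * (lam / (2 * (‖S‖ + 1))) := by
          gcongr
          · linarith
          · exact min_le_left _ _
      _ = lam / 2 := by field_simp
  have hεq : q * ε < η := by
    calc q * ε ≤ q * (η / (q + 1)) := by gcongr; exact min_le_right _ _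
      _ < (q + 1) * (η / (q + 1)) := by gcongr; linarith
      _ = η := by field_simp
  filter_upwards [hut, hv, hU.eventually_exists_lpMul hA' hε, self_mem_nhdsWithin,
    hU.eventually_norm_smul_lt_one] with t hut hv hA ht hDU
  obtain ⟨T, hT, hTΩ, hvt⟩ := hv
  obtain ⟨A, hA, hA1, hA2⟩ := hA
  -- The error itself is an admissible test function for all three weak equations.
  set z : H1 Ω := t⁻¹ • (v t - u) - udot with hz
  have hζ : grad z = t⁻¹ • (grad (v t) - grad u) - grad udot := rfl
  obtain ⟨γ, hγ⟩ := htr z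
  have h1 : ⟪S (A (grad (v t))), grad z⟫ = ⟪S (grad u), grad z⟫ := by
    rw [inner_lpMul_eq hS (hA _), inner_lpMul_eq hS (EventuallyEq.refl _ _), hu.weak_eq z γ hγ]
    exact setIntegral_pulledMatrix hΩ hU hDU hT hTΩ hut hvt hγ
  have h2 := norm_differenceQuotient_sub_le hlam hSlam ht hζ h1 (hudot z) hA1 hA2 hε.le hεS
  rw [dist_eq_norm, ← hζ]
  refine h2.trans_lt (lt_of_le_of_lt (le_of_eq ?_) hεq)
  rw [hq]
  ring

end MaterialDerivative

end EIT

end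

/-! ### Existence of the material derivative. -/

theorem lemma2p1 {d : ℕ} (hd : d = 2 ∨ d = 3) (Ω : Set (E d)) (hΩ : IsBoundedLipschitzDomain Ω)
    (σ : E d → ℝ) (hσ : MemLp σ ∞ (volume.restrict Ω))
    (lam : ℝ) (hlam : 0 < lam) (hσlam : ∀ᵐ x ∂(volume.restrict Ω), lam ≤ σ x)
    (U : E d → E d) (DU : E d → E d →L[ℝ] E d) (hU : IsW1Infty U DU)
    (hU0 : ∀ᶠ x in 𝓝ˢ (frontier Ω), U x = 0)
    (g : Hhalf Ω →ₗ[ℝ] ℝ) (hg : IsNeumannDatum g) (f : Hhalf Ω)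
    (u : H1 Ω) (hu : IsNeumannSolution σ g f u) :
    ∃ udot : H1 Ω,
      (∀ w : H1 Ω, ∫ x in Ω, σ x * ⟪grad udot x, grad w x⟫
        = - ∫ x in Ω, σ x * ⟪calA DU x (grad u x), grad w x⟫) ∧
      (∃ γ : Hhalf Ω, IsTrace udot γ ∧ boundaryIntegral γ = 0) ∧
      ∀ ut : ℝ → H1 Ω,
        (∀ᶠ t in 𝓝[≠] (0 : ℝ), IsNeumannSolution (transported U σ t) g f (ut t)) →
        HasMaterialDerivative U u ut udot := by
  have hd0 : d ≠ 0 := by lia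
  obtain ⟨m, htr, hm, hmφ⟩ := hΩ.exists_boundaryMean
  obtain ⟨S, hS⟩ := exists_lpMul_conductivity hσ
  obtain ⟨A', hA'⟩ := exists_lpMul_calA hU Ω
  have hSlam := lpMul_coercive hS hσlam
  obtain ⟨udot, hudot, hm0⟩ := hΩ.exists_solution hd0 hmφ S hlam hSlam (-S (A' (grad u)))
  have hudot' : ∀ w : H1 Ω, ⟪S (grad udot), grad w⟫ = -⟪S (A' (grad u)), grad w⟫ := fun w =>
    (hudot w).trans (inner_neg_left _ _)
  refine ⟨udot, fun w => ?_, (htr udot).imp fun γ hγ => ⟨hγ, (hm _ _ hγ).trans hm0⟩,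
    fun ut hut => ?_⟩
  · rw [← inner_lpMul_eq hS (EventuallyEq.refl _ _), ← inner_lpMul_eq hS (hA' _)]
    exact hudot' w
  -- Pullback preserves traces, so `v_t` and `u` have the same boundary mean, that of `f`, and their
  -- difference quotients have mean zero.
  have hmsol : ∀ {s : E d → ℝ} {w : H1 Ω} {w' : H1 Ω}, IsNeumannSolution s g f w →
      (∀ γ, IsTrace w γ → IsTrace w' γ) → m w' = boundaryIntegral f := fun hw hww' =>
    hw.normalization.elim fun γ hγ => (hm _ _ (hww' γ hγ.1)).symm.trans hγ.2
  obtain ⟨v, hv⟩ := exists_eq_comp_Phi U ut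
  have hv' := eventually_exists_isPullback_eq hΩ hU hU0 hv
  obtain ⟨C, -, hC⟩ := hΩ.exists_norm_sq_le hd0 hmφ
  have hmv : ∀ᶠ t in 𝓝[≠] (0 : ℝ), m (v t) = m u := by
    filter_upwards [hv', hut] with t ht hut
    obtain ⟨T, -, -, hT⟩ := ht
    exact (hmsol hut hT.isTrace).trans (hmsol hu fun _ h => h).symm
  refine ⟨v, ?_, tendsto_of_tendsto_components (H1.gradL Ω) m hC hmv hm0
    (tendsto_grad_differenceQuotient hΩ hU hS hA' hlam hSlam htr hu hudot' hut hv')⟩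
  filter_upwards [hv'] with t ht
  obtain ⟨T, hT, -, hpb⟩ := ht
  rw [← hT]
  exact hpb.fn_eq
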